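/- Conventions. All C*-algebras are unital; $\otimes$ denotes the minimal tensor product of C*-algebras and the exterior tensor product of Hilbert modules; $[X]$ is the closed linear span of $X$. A compact quantum group $G$ is a unital C*-algebra $\mathrm{C}(G)$ with a unital $*$-homomorphism $\Delta:\mathrm{C}(G)\to \mathrm{C}(G)\otimes \mathrm{C}(G)$ that is coassociative and satisfies $[\Delta(\mathrm{C}(G))(1\otimes \mathrm{C}(G))]=[\Delta(\mathrm{C}(G))(\mathrm{C}(G)\otimes 1)]=\mathrm{C}(G)\otimes \mathrm{C}(G)$. A $G$-action on a C*-algebra $B$ is a unital $*$-homomorphism $\alpha:B\to B\otimes \mathrm{C}(G)$ with $(\alpha\otimes\mathrm{id})\alpha=(\mathrm{id}\otimes\Delta)\alpha$ and $[\alpha(B)(1\otimes \mathrm{C}(G))]=B\otimes \mathrm{C}(G)$. A C*-correspondence $(E,\phi)$ over $B$ is a right Hilbert $B$-module $E$ with a unital $*$-homomorphism $\phi:B\to\mathcal L(E)$. It is $G$-equivariant over $(B,\alpha)$, via a linear map $\lambda:E\to E\otimes \mathrm{C}(G)$, if $\lambda(\xi b)=\lambda(\xi)\alpha(b)$, $\langle\lambda(\xi),\lambda(\eta)\rangle=\alpha(\langle\xi,\eta\rangle)$,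 $(\lambda\otimes\mathrm{id})\lambda=(\mathrm{id}\otimes\Delta)\lambda$, $[\lambda(E)(1\otimes \mathrm{C}(G))]=E\otimes \mathrm{C}(G)$ and $\lambda(\phi(b)\xi)=(\phi\otimes\mathrm{id})(\alpha(b))\lambda(\xi)$ for all $b\in B$ and $\xi,\eta\in E$. A representation of $(E,\phi)$ on a C*-algebra $D$ is a pair $(t,\pi)$ of a linear map $t:E\to D$ and a unital $*$-homomorphism $\pi:B\to D$ with $t(\xi)^*t(\eta)=\pi(\langle\xi,\eta\rangle)$ and $t(\phi(b)\xi)=\pi(b)t(\xi)$; it is covariant if $\psi_t(\phi(b))=\pi(b)$ for all $b\in\phi^{-1}(\mathcal K(E))$ with $b\ker\phi=0$, where $\psi_t:\mathcal K(E)\to D$ is given by $\psi_t(\theta_{\xi,\eta})=t(\xi)t(\eta)^*$. The Pimsner algebra $\mathcal O_E$ is the target of the universal covariant representation $(k_E,k_B)$; its gauge action is the circle action that fixes $k_B(B)$ and multiplies $k_E(E)$ by $z$. A $G$-action $\rho$ on $\mathcal O_E$ is a lift if there are a $G$-action $\alpha$ on $B$ and a map $\lambda:E\to E\otimes \mathrm{C}(G)$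 making $(E,\phi)$ a $G$-equivariant C*-correspondence over $(B,\alpha)$ such that $\rho$ is the unique unital $*$-homomorphism $\omega:\mathcal O_E\to\mathcal O_E\otimes \mathrm{C}(G)$ with $\omega\circ k_E=(k_E\otimes\mathrm{id})\circ\lambda$ and $\omega\circ k_B=(k_B\otimes\mathrm{id})\circ\alpha$. Theorem. Let $A$ be a unital C*-algebra with a strongly continuous action $\gamma$ of the circle group $\mathbb T$ by $*$-automorphisms. For $n\in\mathbb Z$ let $A(n)=\{a\in A:\gamma_z(a)=z^na\text{ for all }z\in\mathbb T\}$, a right Hilbert module over the C*-algebra $A(0)$ by right multiplication and $\langle\xi,\eta\rangle=\xi^*\eta$. Suppose that - $\gamma$ is principal, i.e. for all $m,n\in\mathbb Z$ the linear span $A(m)A(n)$ of products equals $A(m+n)$; - $A(0)$ is separable; - $A(1)$ and $A(-1)$ are full Hilbert $A(0)$-modules. Then $A(1)$ is finitely generated and projective over $A(0)$, and $A$, with the inclusions of $A(1)$ and $A(0)$ as universal covariant representation, is the Pimsner algebra $\mathcal O_{A(1)}$ of the C*-correspondence $(A(1),\phi)$, $\phi(a)\xi=a\xi$, with gauge action $\gamma$.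 Moreover, for every compact quantum group $G$, every $G$-action $\rho:A\to A\otimes \mathrm{C}(G)$ that is gauge-equivariant, i.e. $(\gamma_z\otimes\mathrm{id})\circ\rho=\rho\circ\gamma_z$ for all $z\in\mathbb T$, is a lift. -/

import Mathlib

universe u

open scoped TensorProduct

/-- `⋆`-algebras with a C⋆-seminorm: the Hausdorff completion is a C⋆-algebra. -/
class PreCStarAlgebra (R : Type u) extends SeminormedRing R, StarRing R, NormedAlgebra ℂ R,
    StarModule ℂ R where
  norm_mul_self_le' (x : R) : ‖x‖ * ‖x‖ ≤ ‖star x * x‖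

namespace PreCStarAlgebra

variable (R : Type u) [PreCStarAlgebra R]

theorem norm_star_le (x : R) : ‖star x‖ ≤ ‖x‖ := by
  have h := (norm_mul_self_le' (star x)).trans (norm_mul_le _ _)
  rw [star_star] at h
  rcases (norm_nonneg (star x)).eq_or_lt with h0 | h0
  · rw [← h0]; exact norm_nonneg _
  · exact le_of_mul_le_mul_right h h0

instance : NormedStarGroup R where
  norm_star_le := norm_star_le R

/-- The completion of a `⋆`-algebra with respect to a C⋆-seminorm. -/
def Compl : Type u := UniformSpace.Completion R

open UniformSpace

noncomputable instance : NormedRing (Compl R) := inferInstanceAs (NormedRing (Completion R))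
noncomputable instance : Algebra ℂ (Compl R) := inferInstanceAs (Algebra ℂ (Completion R))
noncomputable instance : CompleteSpace (Compl R) :=
  inferInstanceAs (CompleteSpace (Completion R))

variable {R}

/-- The canonical map into the completion. -/
noncomputable def toCompl (x : R) : Compl R := (x : Completion R)

theorem norm_toCompl (x : R) : ‖toCompl x‖ = ‖x‖ := Completion.norm_coe x

theorem denseRange_toCompl : DenseRange (toCompl : R → Compl R) := Completion.denseRange_coe

theorem continuous_toCompl : Continuous (toCompl : R → Compl R) := Completion.continuous_coe R

theorem toCompl_add (x y : R) : toCompl (x + y) = toCompl x + toCompl y := Completion.coe_add x y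
theorem toCompl_mul (x y : R) : toCompl (x * y) = toCompl x * toCompl y := Completion.coe_mul x y
theorem toCompl_smul (z : ℂ) (x : R) : toCompl (z • x) = z • toCompl x := Completion.coe_smul z x
theorem toCompl_one : toCompl (1 : R) = 1 := rfl

noncomputable instance : Star (Compl R) where
  star := Completion.map (star : R → R)

theorem toCompl_star (x : R) : toCompl (star x) = star (toCompl x) :=
  (Completion.map_coe (f := (star : R → R)) (starNormedAddGroupHom.uniformContinuous) x).symm

theorem continuous_star_compl : Continuous (star : Compl R → Compl R) :=
  Completion.continuous_map

noncomputable instance : StarRing (Compl R) where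
  star_involutive x := by
    refine denseRange_toCompl.induction_on x ?_ ?_
    · exact isClosed_eq (continuous_star_compl.comp continuous_star_compl) continuous_id
    · intro a; rw [← toCompl_star, ← toCompl_star, star_star]
  star_mul x y := by
    refine denseRange_toCompl.induction_on₂ ?_ ?_ x y
    · exact isClosed_eq (continuous_star_compl.comp continuous_mul)
        ((continuous_star_compl.comp continuous_snd).mul
          (continuous_star_compl.comp continuous_fst))
    · intro a b; simp only [← toCompl_star, ← toCompl_mul, star_mul]
  star_add x y := by
    refine denseRange_toCompl.induction_on₂ ?_ ?_ x y
    · exact isClosed_eq (continuous_star_compl.comp continuous_add)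
        ((continuous_star_compl.comp continuous_fst).add
          (continuous_star_compl.comp continuous_snd))
    · intro a b; simp only [← toCompl_star, ← toCompl_add, star_add]

noncomputable instance : NormedAlgebra ℂ (Compl R) where
  norm_smul_le z x := by
    refine denseRange_toCompl.induction_on x ?_ ?_
    · exact isClosed_le
        (continuous_norm.comp (continuous_const_smul (T := Completion R) z))
        (continuous_const.mul continuous_norm)
    · intro a
      rw [← toCompl_smul, norm_toCompl, norm_toCompl]
      exact norm_smul_le z a

noncomputable instance : CStarAlgebra (Compl R) where
  norm_smul_le := norm_smul_le
  star_smul z x := by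
    refine denseRange_toCompl.induction_on x ?_ ?_
    · exact isClosed_eq (continuous_star_compl.comp (continuous_const_smul z))
        ((continuous_star_compl (R := R)).const_smul (star z))
    · intro a; simp only [← toCompl_star, ← toCompl_smul, star_smul]
  norm_mul_self_le := fun (x : Compl R) => by
    refine denseRange_toCompl.induction_on x ?_ ?_
    · exact isClosed_le (continuous_norm.mul continuous_norm)
        ((continuous_star_compl.mul continuous_id).norm)
    · intro a
      rw [← toCompl_star, ← toCompl_mul, norm_toCompl, norm_toCompl]
      exact PreCStarAlgebra.norm_mul_self_le' a

/-- The canonical map into the completion, as a `⋆`-homomorphism. -/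
noncomputable def toComplHom : R →⋆ₐ[ℂ] Compl R where
  toFun := toCompl
  map_one' := rfl
  map_mul' := toCompl_mul
  map_zero' := rfl
  map_add' := toCompl_add
  commutes' _ := rfl
  map_star' := toCompl_star

/-- A contractive `⋆`-homomorphism into a C⋆-algebra extends to the completion. -/
noncomputable def extendHom {D : Type u} [CStarAlgebra D] (f : R →⋆ₐ[ℂ] D)
    (hf : ∀ x, ‖f x‖ ≤ ‖x‖) : Compl R →⋆ₐ[ℂ] D :=
  have hc : Continuous f.toAlgHom.toRingHom :=
    AddMonoidHomClass.continuous_of_bound f 1 (by simpa using hf)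
  have key : ∀ a : R, Completion.extensionHom f.toAlgHom.toRingHom hc (a : Completion R) = f a :=
    fun a => Completion.extensionHom_coe _ hc a
  have hcont : Continuous (Completion.extensionHom f.toAlgHom.toRingHom hc) :=
    Completion.continuous_extension
  { (Completion.extensionHom f.toAlgHom.toRingHom hc : Completion R →+* D) with
    commutes' := fun z => (key (algebraMap ℂ R z)).trans (AlgHomClass.commutes f z)
    map_star' := fun x => by
      refine denseRange_toCompl.induction_on x ?_ ?_
      · exact isClosed_eq (hcont.comp continuous_star_compl) (continuous_star.comp hcont)
      · intro a
        rw [← toCompl_star]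
        exact (key _).trans ((map_star f a).trans (congrArg star (key a).symm)) }

theorem extendHom_toCompl {D : Type u} [CStarAlgebra D] (f : R →⋆ₐ[ℂ] D)
    (hf : ∀ x, ‖f x‖ ≤ ‖x‖) (x : R) : extendHom f hf (toCompl x) = f x :=
  Completion.extensionHom_coe f.toAlgHom.toRingHom
    (AddMonoidHomClass.continuous_of_bound f 1 (by simpa using hf)) x

end PreCStarAlgebra

section MinTensor

/-- A unital `⋆`-representation of a C⋆-algebra on a Hilbert space. -/
structure HilbertRep (A : Type u) [CStarAlgebra A] where
  /-- The Hilbert space. -/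
  H : Type u
  [instN : NormedAddCommGroup H]
  [instI : InnerProductSpace ℂ H]
  [instC : CompleteSpace H]
  /-- The `⋆`-homomorphism into the bounded operators. -/
  rep : A →⋆ₐ[ℂ] (H →L[ℂ] H)

attribute [instance] HilbertRep.instN HilbertRep.instI HilbertRep.instC

variable {A B : Type u} [CStarAlgebra A] [CStarAlgebra B]

/-- The Hilbert space tensor product. -/
def HilbertTensor (H K : Type u) [NormedAddCommGroup H] [InnerProductSpace ℂ H]
    [NormedAddCommGroup K] [InnerProductSpace ℂ K] : Type u :=
  UniformSpace.Completion (H ⊗[ℂ] K)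

section HilbertTensor

variable {H K : Type u} [NormedAddCommGroup H] [InnerProductSpace ℂ H]
  [NormedAddCommGroup K] [InnerProductSpace ℂ K]

noncomputable instance : NormedAddCommGroup (HilbertTensor H K) :=
  inferInstanceAs (NormedAddCommGroup (UniformSpace.Completion (H ⊗[ℂ] K)))

noncomputable instance : InnerProductSpace ℂ (HilbertTensor H K) :=
  inferInstanceAs (InnerProductSpace ℂ (UniformSpace.Completion (H ⊗[ℂ] K)))

instance : CompleteSpace (HilbertTensor H K) :=
  inferInstanceAs (CompleteSpace (UniformSpace.Completion (H ⊗[ℂ] K)))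

/-- The canonical map from the algebraic tensor product. -/
noncomputable def HilbertTensor.of : H ⊗[ℂ] K →ₗ[ℂ] HilbertTensor H K :=
  (UniformSpace.Completion.toComplₗᵢ (𝕜 := ℂ) (E := H ⊗[ℂ] K)).toLinearMap

theorem HilbertTensor.denseRange_of : DenseRange (HilbertTensor.of : H ⊗[ℂ] K → _) :=
  UniformSpace.Completion.denseRange_coe

theorem HilbertTensor.inner_of (v w : H ⊗[ℂ] K) :
    inner ℂ (HilbertTensor.of v) (HilbertTensor.of w) = inner ℂ v w :=
  UniformSpace.Completion.inner_coe v w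

/-- The bounded operator `S ⊗ T` on the Hilbert space tensor product. -/
noncomputable def HilbertTensor.map (S : H →L[ℂ] H) (T : K →L[ℂ] K) :
    HilbertTensor H K →L[ℂ] HilbertTensor H K :=
  (TensorProduct.mapL S T).completion

theorem HilbertTensor.map_of (S : H →L[ℂ] H) (T : K →L[ℂ] K) (v : H ⊗[ℂ] K) :
    HilbertTensor.map S T (of v) = of (TensorProduct.map S.toLinearMap T.toLinearMap v) :=
  (ContinuousLinearMap.completion_apply_coe _ _).trans
    (congrArg _ (TensorProduct.mapL_apply S T v))

theorem HilbertTensor.clm_ext {S T : HilbertTensor H K →L[ℂ] HilbertTensor H K}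
    (h : ∀ v : H ⊗[ℂ] K, S (of v) = T (of v)) : S = T := by
  ext x
  exact denseRange_of.induction_on x (isClosed_eq S.continuous T.continuous) h

theorem HilbertTensor.map_one : HilbertTensor.map (1 : H →L[ℂ] H) (1 : K →L[ℂ] K) = 1 := by
  refine clm_ext fun v => ?_
  rw [map_of]
  exact congrArg _ (LinearMap.congr_fun TensorProduct.map_id v)

theorem HilbertTensor.map_mul (S S' : H →L[ℂ] H) (T T' : K →L[ℂ] K) :
    HilbertTensor.map (S * S') (T * T') = HilbertTensor.map S T * HilbertTensor.map S' T' := by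
  refine clm_ext fun v => ?_
  change _ = HilbertTensor.map S T (HilbertTensor.map S' T' (of v))
  rw [map_of, map_of, map_of]
  exact congrArg _ (LinearMap.congr_fun (TensorProduct.map_comp _ _ _ _) v)

theorem HilbertTensor.map_add_left (S S' : H →L[ℂ] H) (T : K →L[ℂ] K) :
    HilbertTensor.map (S + S') T = HilbertTensor.map S T + HilbertTensor.map S' T := by
  refine clm_ext fun v => ?_
  change _ = HilbertTensor.map S T (of v) + HilbertTensor.map S' T (of v)
  rw [map_of, map_of, map_of, ← map_add]
  exact congrArg _ (LinearMap.congr_fun (TensorProduct.map_add_left _ _ _) v)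

theorem HilbertTensor.map_add_right (S : H →L[ℂ] H) (T T' : K →L[ℂ] K) :
    HilbertTensor.map S (T + T') = HilbertTensor.map S T + HilbertTensor.map S T' := by
  refine clm_ext fun v => ?_
  change _ = HilbertTensor.map S T (of v) + HilbertTensor.map S T' (of v)
  rw [map_of, map_of, map_of, ← map_add]
  exact congrArg _ (LinearMap.congr_fun (TensorProduct.map_add_right _ _ _) v)

theorem HilbertTensor.map_smul_left (z : ℂ) (S : H →L[ℂ] H) (T : K →L[ℂ] K) :
    HilbertTensor.map (z • S) T = z • HilbertTensor.map S T := by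
  refine clm_ext fun v => ?_
  change _ = z • HilbertTensor.map S T (of v)
  rw [map_of, map_of, ← map_smul]
  exact congrArg _ (LinearMap.congr_fun (TensorProduct.map_smul_left _ _ _) v)

theorem HilbertTensor.map_smul_right (z : ℂ) (S : H →L[ℂ] H) (T : K →L[ℂ] K) :
    HilbertTensor.map S (z • T) = z • HilbertTensor.map S T := by
  refine clm_ext fun v => ?_
  change _ = z • HilbertTensor.map S T (of v)
  rw [map_of, map_of, ← map_smul]
  exact congrArg _ (LinearMap.congr_fun (TensorProduct.map_smul_right _ _ _) v)

theorem HilbertTensor.map_star [CompleteSpace H] [CompleteSpace K] (S : H →L[ℂ] H)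
    (T : K →L[ℂ] K) : HilbertTensor.map (star S) (star T) = star (HilbertTensor.map S T) := by
  refine (ContinuousLinearMap.eq_adjoint_iff _ _).mpr fun x y => ?_
  refine denseRange_of.induction_on₂ ?_ (fun v w => ?_) x y
  · exact isClosed_eq (((HilbertTensor.map _ _).continuous.comp continuous_fst).inner
      continuous_snd) (continuous_fst.inner ((HilbertTensor.map _ _).continuous.comp
        continuous_snd))
  · rw [map_of, map_of, inner_of, inner_of]
    induction v with
    | zero => simp
    | add v v' h h' => simp only [_root_.map_add, inner_add_left, h, h']
    | tmul h k =>
      induction w with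
      | zero => simp
      | add w w' h h' => simp only [_root_.map_add, inner_add_right, h, h']
      | tmul h' k' =>
        simp only [TensorProduct.map_tmul, TensorProduct.inner_tmul,
          ContinuousLinearMap.star_eq_adjoint, ContinuousLinearMap.coe_coe,
          ContinuousLinearMap.adjoint_inner_left]

end HilbertTensor

namespace HilbertRep

/-- The representation `a ↦ π(a) ⊗ 1`. -/
noncomputable def left (π : HilbertRep A) (σ : HilbertRep B) :
    A →⋆ₐ[ℂ] (HilbertTensor π.H σ.H →L[ℂ] HilbertTensor π.H σ.H) where
  __ := AlgHom.ofLinearMap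
      { toFun := fun a => HilbertTensor.map (π.rep a) (1 : σ.H →L[ℂ] σ.H)
        map_add' := fun a b => by rw [map_add, HilbertTensor.map_add_left]
        map_smul' := fun z a => by rw [map_smul, HilbertTensor.map_smul_left, RingHom.id_apply] }
      (by simp only [LinearMap.coe_mk, AddHom.coe_mk, map_one, HilbertTensor.map_one])
      (fun a b => by
        simp only [LinearMap.coe_mk, AddHom.coe_mk]
        rw [map_mul, ← HilbertTensor.map_mul, mul_one])
  map_star' a := by
    change HilbertTensor.map (π.rep (star a)) 1 = star (HilbertTensor.map (π.rep a) 1)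
    rw [← HilbertTensor.map_star, map_star, star_one]

/-- The representation `b ↦ 1 ⊗ σ(b)`. -/
noncomputable def right (π : HilbertRep A) (σ : HilbertRep B) :
    B →⋆ₐ[ℂ] (HilbertTensor π.H σ.H →L[ℂ] HilbertTensor π.H σ.H) where
  __ := AlgHom.ofLinearMap
      { toFun := fun b => HilbertTensor.map (1 : π.H →L[ℂ] π.H) (σ.rep b)
        map_add' := fun a b => by rw [map_add, HilbertTensor.map_add_right]
        map_smul' := fun z a => by rw [map_smul, HilbertTensor.map_smul_right, RingHom.id_apply] }
      (by simp only [LinearMap.coe_mk, AddHom.coe_mk, map_one, HilbertTensor.map_one])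
      (fun a b => by
        simp only [LinearMap.coe_mk, AddHom.coe_mk]
        rw [map_mul, ← HilbertTensor.map_mul, mul_one])
  map_star' b := by
    change HilbertTensor.map 1 (σ.rep (star b)) = star (HilbertTensor.map 1 (σ.rep b))
    rw [← HilbertTensor.map_star, map_star, star_one]

theorem left_apply (π : HilbertRep A) (σ : HilbertRep B) (a : A) :
    π.left σ a = HilbertTensor.map (π.rep a) 1 := rfl

theorem right_apply (π : HilbertRep A) (σ : HilbertRep B) (b : B) :
    π.right σ b = HilbertTensor.map 1 (σ.rep b) := rfl

/-- The product representation `π ⊗ σ` of the algebraic tensor product `A ⊙ B` on `H ⊗ K`. -/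
noncomputable def prod (π : HilbertRep A) (σ : HilbertRep B) :
    A ⊗[ℂ] B →ₐ[ℂ] (HilbertTensor π.H σ.H →L[ℂ] HilbertTensor π.H σ.H) :=
  Algebra.TensorProduct.lift (π.left σ).toAlgHom (π.right σ).toAlgHom fun a b => by
    change π.left σ a * π.right σ b = π.right σ b * π.left σ a
    rw [left_apply, right_apply, ← HilbertTensor.map_mul, ← HilbertTensor.map_mul, one_mul,
      mul_one, one_mul, mul_one]

theorem prod_tmul' (π : HilbertRep A) (σ : HilbertRep B) (a : A) (b : B) :
    π.prod σ (a ⊗ₜ b) = π.left σ a * π.right σ b :=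
  Algebra.TensorProduct.lift_tmul _ _ _ _ _

theorem prod_tmul (π : HilbertRep A) (σ : HilbertRep B) (a : A) (b : B) :
    π.prod σ (a ⊗ₜ b) = HilbertTensor.map (π.rep a) (σ.rep b) := by
  rw [prod_tmul', left_apply, right_apply, ← HilbertTensor.map_mul, one_mul, mul_one]

theorem prod_star (π : HilbertRep A) (σ : HilbertRep B) (x : A ⊗[ℂ] B) :
    π.prod σ (star x) = star (π.prod σ x) := by
  induction x with
  | zero => simp
  | add x y hx hy => simp only [star_add, map_add, hx, hy]
  | tmul a b =>
    rw [TensorProduct.star_tmul, prod_tmul, prod_tmul, map_star, map_star, HilbertTensor.map_star]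

theorem norm_prod_tmul_le (π : HilbertRep A) (σ : HilbertRep B) (a : A) (b : B) :
    ‖π.prod σ (a ⊗ₜ b)‖ ≤ ‖a‖ * ‖b‖ := by
  rw [prod_tmul']
  refine (norm_mul_le _ _).trans ?_
  gcongr
  · exact NonUnitalStarAlgHom.norm_apply_le (π.left σ) a
  · exact NonUnitalStarAlgHom.norm_apply_le (π.right σ) b

theorem norm_prod_mul_self_le (π : HilbertRep A) (σ : HilbertRep B) (x : A ⊗[ℂ] B) :
    ‖π.prod σ x‖ * ‖π.prod σ x‖ ≤ ‖π.prod σ (star x * x)‖ := by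
  rw [map_mul, prod_star, CStarRing.norm_star_mul_self]

end HilbertRep

variable (A B) in
/-- The algebraic tensor product `A ⊙ B` of two C⋆-algebras, as a carrier for the minimal
C⋆-norm. -/
def AlgTensor : Type u := A ⊗[ℂ] B

noncomputable instance : Ring (AlgTensor A B) := inferInstanceAs (Ring (A ⊗[ℂ] B))
noncomputable instance : Algebra ℂ (AlgTensor A B) := inferInstanceAs (Algebra ℂ (A ⊗[ℂ] B))
noncomputable instance : StarRing (AlgTensor A B) := inferInstanceAs (StarRing (A ⊗[ℂ] B))
noncomputable instance : StarModule ℂ (AlgTensor A B) := inferInstanceAs (StarModule ℂ (A ⊗[ℂ] B))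

/-- The minimal (spatial) norm: the supremum of the operator norms of `(π ⊗ σ)(x)` over all pairs
of representations. -/
noncomputable instance : Norm (AlgTensor A B) where
  norm x := ⨆ p : HilbertRep A × HilbertRep B, ‖p.1.prod p.2 x‖

theorem AlgTensor.norm_def (x : AlgTensor A B) :
    ‖x‖ = ⨆ p : HilbertRep A × HilbertRep B, ‖p.1.prod p.2 x‖ := rfl

theorem AlgTensor.bddAbove (x : AlgTensor A B) :
    BddAbove (Set.range fun p : HilbertRep A × HilbertRep B => ‖p.1.prod p.2 x‖) := by
  suffices h : ∀ x : A ⊗[ℂ] B, ∃ C, ∀ p : HilbertRep A × HilbertRep B, ‖p.1.prod p.2 x‖ ≤ C by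
    obtain ⟨C, hC⟩ := h x
    exact ⟨C, by rintro _ ⟨p, rfl⟩; exact hC p⟩
  intro x
  induction x with
  | zero => exact ⟨0, fun p => by simp⟩
  | tmul a b => exact ⟨‖a‖ * ‖b‖, fun p => p.1.norm_prod_tmul_le p.2 a b⟩
  | add x y hx hy =>
    obtain ⟨C, hC⟩ := hx
    obtain ⟨C', hC'⟩ := hy
    exact ⟨C + C', fun p => by rw [map_add]; exact norm_add_le_of_le (hC p) (hC' p)⟩

theorem AlgTensor.norm_prod_le (π : HilbertRep A) (σ : HilbertRep B) (x : AlgTensor A B) :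
    ‖π.prod σ x‖ ≤ ‖x‖ :=
  le_ciSup (AlgTensor.bddAbove x) (π, σ)

theorem AlgTensor.norm_le (x : AlgTensor A B) {r : ℝ} (hr : 0 ≤ r)
    (h : ∀ (π : HilbertRep A) (σ : HilbertRep B), ‖π.prod σ x‖ ≤ r) : ‖x‖ ≤ r :=
  Real.iSup_le (fun p => h p.1 p.2) hr

theorem AlgTensor.norm_nonneg' (x : AlgTensor A B) : 0 ≤ ‖x‖ :=
  Real.iSup_nonneg fun _ => norm_nonneg _

theorem AlgTensor.seminormCore : SeminormedSpace.Core ℂ (AlgTensor A B) where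
  norm_nonneg := norm_nonneg'
  norm_smul z x := by
    rw [norm_def, norm_def, Real.mul_iSup_of_nonneg (norm_nonneg z)]
    congr 1
    ext p
    rw [← norm_smul]
    exact congrArg norm (map_smul (p.1.prod p.2) z (x : A ⊗[ℂ] B))
  norm_triangle x y := by
    refine norm_le _ (add_nonneg (norm_nonneg' x) (norm_nonneg' y)) fun π σ => ?_
    refine (le_of_eq (congrArg norm (map_add (π.prod σ) (x : A ⊗[ℂ] B) y))).trans ?_
    exact norm_add_le_of_le (norm_prod_le π σ x) (norm_prod_le π σ y)

noncomputable instance : PreCStarAlgebra (AlgTensor A B) where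
  __ := (inferInstance : Algebra ℂ (AlgTensor A B))
  toSeminormedRing :=
    { SeminormedAddCommGroup.ofCore AlgTensor.seminormCore,
      (inferInstance : Ring (AlgTensor A B)) with
      norm_mul_le := fun x y => by
        refine AlgTensor.norm_le _ (mul_nonneg (AlgTensor.norm_nonneg' x)
          (AlgTensor.norm_nonneg' y)) fun π σ => ?_
        refine (le_of_eq (congrArg norm (map_mul (π.prod σ) (x : A ⊗[ℂ] B) y))).trans ?_
        refine (norm_mul_le _ _).trans ?_
        exact mul_le_mul (AlgTensor.norm_prod_le π σ x) (AlgTensor.norm_prod_le π σ y)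
          (norm_nonneg _) (AlgTensor.norm_nonneg' x) }
  star_mul := star_mul
  star_add := star_add
  norm_smul_le z x := (AlgTensor.seminormCore.norm_smul z x).le
  star_smul := star_smul
  norm_mul_self_le' x := by
    have h0 : 0 ≤ ‖star x * x‖ := AlgTensor.norm_nonneg' _
    have h : ‖x‖ ≤ √‖star x * x‖ := by
      refine AlgTensor.norm_le _ (Real.sqrt_nonneg _) fun π σ => ?_
      refine Real.le_sqrt_of_sq_le ?_
      rw [sq]
      exact (π.norm_prod_mul_self_le σ x).trans (AlgTensor.norm_prod_le π σ (star x * x))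
    calc ‖x‖ * ‖x‖ ≤ √‖star x * x‖ * √‖star x * x‖ :=
          mul_le_mul h h (AlgTensor.norm_nonneg' x) (Real.sqrt_nonneg _)
      _ = _ := Real.mul_self_sqrt h0

variable (A B) in
/-- The minimal tensor product of two unital C⋆-algebras. -/
def MinTensor : Type u := PreCStarAlgebra.Compl (AlgTensor A B)

noncomputable instance : CStarAlgebra (MinTensor A B) :=
  inferInstanceAs (CStarAlgebra (PreCStarAlgebra.Compl (AlgTensor A B)))

/-- The canonical `⋆`-homomorphism `A ⊙ B → A ⊗ B`. -/
noncomputable def MinTensor.of : A ⊗[ℂ] B →⋆ₐ[ℂ] MinTensor A B :=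
  PreCStarAlgebra.toComplHom (R := AlgTensor A B)

/-- The elementary tensor `a ⊗ b` in the minimal tensor product. -/
noncomputable def MinTensor.tmul (a : A) (b : B) : MinTensor A B := MinTensor.of (a ⊗ₜ b)

theorem MinTensor.denseRange_of : DenseRange (MinTensor.of : A ⊗[ℂ] B → MinTensor A B) :=
  PreCStarAlgebra.denseRange_toCompl (R := AlgTensor A B)

theorem MinTensor.norm_of (x : A ⊗[ℂ] B) :
    ‖MinTensor.of x‖ = ⨆ p : HilbertRep A × HilbertRep B, ‖p.1.prod p.2 x‖ :=
  PreCStarAlgebra.norm_toCompl (R := AlgTensor A B) x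

variable {A' B' : Type u} [CStarAlgebra A'] [CStarAlgebra B']

/-- Pullback of a representation along a `⋆`-homomorphism. -/
noncomputable def HilbertRep.comap (π : HilbertRep A') (f : A →⋆ₐ[ℂ] A') : HilbertRep A where
  H := π.H
  rep := π.rep.comp f

theorem HilbertRep.prod_map (π : HilbertRep A') (σ : HilbertRep B') (f : A →⋆ₐ[ℂ] A')
    (g : B →⋆ₐ[ℂ] B') (x : A ⊗[ℂ] B) :
    π.prod σ (Algebra.TensorProduct.map f.toAlgHom g.toAlgHom x)
      = (π.comap f).prod (σ.comap g) x := by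
  induction x with
  | zero => simp; rfl
  | add x y hx hy => rw [map_add, map_add, hx, hy]; exact (map_add _ x y).symm
  | tmul a b =>
    rw [Algebra.TensorProduct.map_tmul, prod_tmul]
    exact (prod_tmul (π.comap f) (σ.comap g) a b).symm

/-- `f ⊙ g` on algebraic tensor products, as a `⋆`-homomorphism. -/
noncomputable def AlgTensor.map (f : A →⋆ₐ[ℂ] A') (g : B →⋆ₐ[ℂ] B') :
    A ⊗[ℂ] B →⋆ₐ[ℂ] A' ⊗[ℂ] B' where
  __ := Algebra.TensorProduct.map f.toAlgHom g.toAlgHom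
  map_star' x := by
    change Algebra.TensorProduct.map f.toAlgHom g.toAlgHom (star x)
      = star (Algebra.TensorProduct.map f.toAlgHom g.toAlgHom x)
    induction x with
    | zero => simp
    | add x y hx hy => simp only [star_add, map_add, hx, hy]
    | tmul a b => simp [TensorProduct.star_tmul, map_star]

/-- The `⋆`-homomorphism `f ⊗ g : A ⊗ B → A' ⊗ B'` of minimal tensor products. -/
noncomputable def MinTensor.map (f : A →⋆ₐ[ℂ] A') (g : B →⋆ₐ[ℂ] B') :
    MinTensor A B →⋆ₐ[ℂ] MinTensor A' B' :=
  PreCStarAlgebra.extendHom (R := AlgTensor A B)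
    ((MinTensor.of (A := A') (B := B')).comp (AlgTensor.map f g)) fun x => by
    refine (le_of_eq (MinTensor.norm_of _)).trans ?_
    refine Real.iSup_le (fun p => ?_) (AlgTensor.norm_nonneg' x)
    refine (le_of_eq (congrArg norm (p.1.prod_map p.2 f g x))).trans ?_
    exact AlgTensor.norm_prod_le (p.1.comap f) (p.2.comap g) x

theorem MinTensor.map_of (f : A →⋆ₐ[ℂ] A') (g : B →⋆ₐ[ℂ] B') (x : A ⊗[ℂ] B) :
    MinTensor.map f g (MinTensor.of x) = MinTensor.of (AlgTensor.map f g x) :=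
  PreCStarAlgebra.extendHom_toCompl (R := AlgTensor A B) _ _ x

end MinTensor

section Positivity

variable {D : Type u} [CStarAlgebra D]

/-- Positive elements of a C⋆-algebra. -/
def IsPos (d : D) : Prop := ∃ c : D, d = star c * c

theorem isPos_iff_nonneg (d : D) :
    IsPos d ↔ (letI := CStarAlgebra.spectralOrder D; 0 ≤ d) := by
  let _ := CStarAlgebra.spectralOrder D
  have _ := CStarAlgebra.spectralOrderedRing D
  exact CStarAlgebra.nonneg_iff_eq_star_mul_self.symm

theorem IsPos.add {c d : D} (hc : IsPos c) (hd : IsPos d) : IsPos (c + d) := by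
  let _ := CStarAlgebra.spectralOrder D
  have _ := CStarAlgebra.spectralOrderedRing D
  rw [isPos_iff_nonneg] at *
  exact add_nonneg hc hd

theorem IsPos.sum {ι : Type*} (s : Finset ι) {f : ι → D} (h : ∀ i ∈ s, IsPos (f i)) :
    IsPos (∑ i ∈ s, f i) := by
  let _ := CStarAlgebra.spectralOrder D
  have _ := CStarAlgebra.spectralOrderedRing D
  rw [isPos_iff_nonneg]
  exact Finset.sum_nonneg fun i hi => (isPos_iff_nonneg _).1 (h i hi)

theorem isClosed_isPos : IsClosed {d : D | IsPos d} := by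
  let _ := CStarAlgebra.spectralOrder D
  have _ := CStarAlgebra.spectralOrderedRing D
  simp only [isPos_iff_nonneg]
  exact CStarAlgebra.isClosed_nonneg

theorem IsPos.map {D' : Type u} [CStarAlgebra D'] {d : D} (h : IsPos d) (f : D →⋆ₐ[ℂ] D') :
    IsPos (f d) := by
  obtain ⟨c, rfl⟩ := h
  exact ⟨f c, by rw [map_mul, map_star]⟩

/-- The norm estimate behind the Cauchy–Schwarz inequality for Hilbert C⋆-modules. -/
theorem norm_sq_le_of_isPos {p q a : D} (hp : IsPos p)
    (h : ∀ t : ℝ, IsPos ((t ^ 2) • (star a * p * a) - (2 * t) • (star a * a) + q)) :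
    ‖a‖ ^ 2 ≤ ‖p‖ * ‖q‖ := by
  let _ := CStarAlgebra.spectralOrder D
  have _ := CStarAlgebra.spectralOrderedRing D
  simp only [isPos_iff_nonneg] at hp h
  have key : ∀ ε : ℝ, 0 < ε → ‖a‖ ^ 2 ≤ (‖p‖ + ε) * ‖q‖ := by
    intro ε hε
    have hs : 0 < ‖p‖ + ε := by positivity
    have h1 : star a * p * a ≤ (‖p‖ + ε) • (star a * a) := by
      have h2 : star a * p * a ≤ ‖p‖ • (star a * a) :=
        CStarAlgebra.star_left_conjugate_le_norm_smul (hb := IsSelfAdjoint.of_nonneg hp)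
      refine h2.trans ?_
      exact smul_le_smul_of_nonneg_right (by linarith) (star_mul_self_nonneg a)
    set t : ℝ := (‖p‖ + ε)⁻¹ with ht
    have htp : 0 < t := inv_pos.2 hs
    have h3 : (t ^ 2) • (star a * p * a) ≤ t • (star a * a) := by
      calc (t ^ 2) • (star a * p * a) ≤ (t ^ 2) • ((‖p‖ + ε) • (star a * a)) :=
            smul_le_smul_of_nonneg_left h1 (by positivity)
        _ = t • (star a * a) := by
            rw [smul_smul]; congr 1; rw [ht]; field_simp
    have h4 : t • (star a * a) ≤ q := by
      have h5 := h t
      have h6 : (t ^ 2) • (star a * p * a) - (2 * t) • (star a * a) + q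
          ≤ t • (star a * a) - (2 * t) • (star a * a) + q := by gcongr
      have h7 := h5.trans h6
      have h8 : t • (star a * a) - (2 * t) • (star a * a) + q = q - t • (star a * a) := by
        rw [two_mul, add_smul]; abel
      rw [h8] at h7
      exact sub_nonneg.1 h7
    have h9 : ‖t • (star a * a)‖ ≤ ‖q‖ :=
      CStarAlgebra.norm_le_norm_of_nonneg_of_le (smul_nonneg htp.le (star_mul_self_nonneg a)) h4
    rw [norm_smul, CStarRing.norm_star_mul_self, Real.norm_of_nonneg htp.le, ht,
      inv_mul_le_iff₀ hs] at h9
    rw [sq]; exact h9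
  refine le_of_forall_pos_le_add fun δ hδ => ?_
  refine (key (δ / (‖q‖ + 1)) (by positivity)).trans ?_
  rw [add_mul]
  gcongr
  rw [div_mul_eq_mul_div, div_le_iff₀ (by positivity)]
  gcongr
  linarith

theorem exists_posPart_negPart (x : D) (hx : IsSelfAdjoint x) :
    ∃ p n : D, x = p - n ∧ IsPos p ∧ IsPos n ∧ p * n = 0 := by
  let _ := CStarAlgebra.spectralOrder D
  have _ := CStarAlgebra.spectralOrderedRing D
  exact ⟨x⁺, x⁻, (CFC.posPart_sub_negPart x hx).symm,
    (isPos_iff_nonneg _).2 (CFC.posPart_nonneg x), (isPos_iff_nonneg _).2 (CFC.negPart_nonneg x),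
    CFC.posPart_mul_negPart x⟩

/-- A matrix `g` over a C⋆-algebra with `∑ bₖ* gₖₗ bₗ ≥ 0` for all `b` is of the form `s* s`. -/
theorem exists_gram {n : Type} [Fintype n] [DecidableEq n] (g : n → n → D)
    (hs : ∀ i j, star (g i j) = g j i)
    (hg : ∀ b : n → D, IsPos (∑ i, ∑ j, star (b i) * g i j * b j)) :
    ∃ s : n → n → D, ∀ i j, g i j = ∑ k, star (s k i) * s k j := by
  let _ := CStarAlgebra.spectralOrder D
  have _ := CStarAlgebra.spectralOrderedRing D
  set M : CStarMatrix n n D := CStarMatrix.ofMatrix (Matrix.of g) with hM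
  have hMsa : IsSelfAdjoint M := by
    refine CStarMatrix.ext fun i j => ?_
    rw [CStarMatrix.star_apply]
    exact hs j i
  obtain ⟨P, N, hMPN, ⟨S, hS⟩, ⟨R, hR⟩, hPN⟩ := exists_posPart_negPart M hMsa
  have hNsa : star N = N := by rw [hR, star_mul, star_star]
  have h1 : N * M * N = - (star (R * N) * (R * N)) := by
    have h2 : M * N = - (N * N) := by
      rw [hMPN, sub_mul, hPN, zero_sub]
    rw [mul_assoc, h2, star_mul, hNsa, mul_neg]
    congr 1
    rw [mul_assoc, ← mul_assoc (star R), ← hR]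
  have h3 : R * N = 0 := by
    refine CStarMatrix.ext fun k j => ?_
    have h4 : 0 ≤ (N * M * N) j j := by
      have := (isPos_iff_nonneg _).1 (hg fun i => (N) i j)
      refine this.trans (le_of_eq ?_)
      rw [mul_assoc, CStarMatrix.mul_apply]
      refine Finset.sum_congr rfl fun i _ => ?_
      rw [CStarMatrix.mul_apply, Finset.mul_sum]
      refine Finset.sum_congr rfl fun l _ => ?_
      have : star ((N) i j) = (N) j i := by
        conv_rhs => rw [← hNsa]
        rw [CStarMatrix.star_apply]
      rw [this, mul_assoc]
      rfl
    have h5 : (star (R * N) * (R * N)) j j = ∑ k, star ((R * N) k j) * (R * N) k j := by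
      rw [CStarMatrix.mul_apply]
      rfl
    rw [h1, CStarMatrix.neg_apply, h5, neg_nonneg] at h4
    have h6 : ∑ k, star ((R * N) k j) * (R * N) k j = 0 :=
      le_antisymm h4 (Finset.sum_nonneg fun k _ => star_mul_self_nonneg _)
    have h7 := (Finset.sum_eq_zero_iff_of_nonneg
      (fun k _ => star_mul_self_nonneg ((R * N) k j))).1 h6 k (Finset.mem_univ k)
    exact (CStarRing.star_mul_self_eq_zero_iff _).1 h7
  have h8 : N = 0 := by
    rw [← CStarRing.star_mul_self_eq_zero_iff, hNsa]
    conv_lhs => enter [1]; rw [hR]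
    rw [mul_assoc, h3, mul_zero]
  rw [h8, sub_zero, hS] at hMPN
  refine ⟨fun k i => S k i, fun i j => ?_⟩
  have : g i j = (star S * S) i j := by rw [← hMPN]; rfl
  rw [this, CStarMatrix.mul_apply]
  rfl

end Positivity

section HilbertModule

open MulOpposite

/-- A right Hilbert C⋆-module `E` over the unital C⋆-algebra `B`. The right action of `B` is the
scalar action of `Bᵐᵒᵖ` and the inner product is linear in the second variable.
(Mathlib's `CStarModule` is set up for left actions, `⟪x, a • y⟫ = a * ⟪x, y⟫`.) -/
class HilbertModule (B : Type u) (E : Type u) [CStarAlgebra B] [NormedAddCommGroup E]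
    [NormedSpace ℂ E] [Module Bᵐᵒᵖ E] where
  complete : CompleteSpace E
  /-- The `B`-valued inner product. -/
  ip : E → E → B
  ip_add_right (x y z : E) : ip x (y + z) = ip x y + ip x z
  ip_smul_right (c : ℂ) (x y : E) : ip x (c • y) = c • ip x y
  ip_op_smul_right (b : B) (x y : E) : ip x (op b • y) = ip x y * b
  star_ip (x y : E) : star (ip x y) = ip y x
  isPos_ip_self (x : E) : IsPos (ip x x)
  norm_sq_eq (x : E) : ‖x‖ ^ 2 = ‖ip x x‖

namespace HilbertModule

variable {B E : Type u} [CStarAlgebra B] [NormedAddCommGroup E] [NormedSpace ℂ E]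
  [Module Bᵐᵒᵖ E] [HilbertModule B E]

theorem ip_add_left (x y z : E) : ip (B := B) (x + y) z = ip x z + ip y z := by
  rw [← star_ip z, ip_add_right, star_add, star_ip, star_ip]

theorem ip_smul_left (c : ℂ) (x y : E) : ip (B := B) (c • x) y = star c • ip x y := by
  rw [← star_ip y, ip_smul_right, star_smul, star_ip]

theorem ip_op_smul_left (b : B) (x y : E) : ip (op b • x) y = star b * ip x y := by
  rw [← star_ip y, ip_op_smul_right, star_mul, star_ip]

/-- The inner product as a sesquilinear map. -/
noncomputable def ipₗ : E →ₗ⋆[ℂ] E →ₗ[ℂ] B :=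
  LinearMap.mk₂'ₛₗ (starRingEnd ℂ) (RingHom.id ℂ) ip ip_add_left ip_smul_left
    ip_add_right ip_smul_right

theorem ipₗ_apply (x y : E) : ipₗ x y = ip (B := B) x y := rfl

theorem ip_zero_left (y : E) : ip (B := B) 0 y = 0 := (ipₗ (B := B)).map_zero₂ y

theorem ip_sub_right (x y z : E) : ip (B := B) x (y - z) = ip x y - ip x z :=
  map_sub (ipₗ x) y z

theorem ip_sub_left (x y z : E) : ip (B := B) (x - y) z = ip x z - ip y z := by
  rw [← star_ip z, ip_sub_right, star_sub, star_ip, star_ip]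

theorem ip_sum_right {ι : Type*} (s : Finset ι) (x : E) (f : ι → E) :
    ip (B := B) x (∑ i ∈ s, f i) = ∑ i ∈ s, ip x (f i) := map_sum (ipₗ x) f s

theorem ip_sum_left {ι : Type*} (s : Finset ι) (x : E) (f : ι → E) :
    ip (B := B) (∑ i ∈ s, f i) x = ∑ i ∈ s, ip (f i) x := by
  rw [← star_ip x, ip_sum_right, star_sum]
  exact Finset.sum_congr rfl fun i _ => star_ip _ _

variable (B) in
theorem eq_of_ip_left {x y : E} (h : ∀ z, ip (B := B) z x = ip z y) : x = y := by
  rw [← sub_eq_zero, ← norm_eq_zero, ← sq_eq_zero_iff, norm_sq_eq (B := B), ip_sub_right, h,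
    sub_self, norm_zero]

theorem op_smul_smul (c : ℂ) (b : B) (x : E) : op (c • b) • x = c • (op b • x) :=
  eq_of_ip_left B fun z => by
    rw [ip_op_smul_right, ip_smul_right, ip_op_smul_right, mul_smul_comm]

theorem norm_ip_le (x y : E) : ‖ip (B := B) x y‖ ≤ ‖x‖ * ‖y‖ := by
  refine abs_le_of_sq_le_sq' ?_ (by positivity) |>.2
  rw [mul_pow, norm_sq_eq (B := B) x, norm_sq_eq (B := B) y]
  refine norm_sq_le_of_isPos (isPos_ip_self x) fun t => ?_
  convert isPos_ip_self (B := B) (((t : ℂ) • (op (ip (B := B) x y) • x) : E) - y) using 1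
  simp only [ip_sub_left, ip_sub_right, ip_smul_left, ip_smul_right, ip_op_smul_left,
    ip_op_smul_right, star_ip]
  simp only [Complex.star_def, Complex.conj_ofReal, Complex.coe_smul, smul_mul_assoc,
    sub_mul, mul_assoc]
  module

theorem norm_op_smul_le (b : B) (x : E) : ‖op b • x‖ ≤ ‖x‖ * ‖b‖ := by
  refine abs_le_of_sq_le_sq' ?_ (by positivity) |>.2
  rw [mul_pow, norm_sq_eq (B := B), norm_sq_eq (B := B), ip_op_smul_right, ip_op_smul_left]
  refine (norm_mul_le _ _).trans ?_
  refine (mul_le_mul_of_nonneg_right (norm_mul_le _ _) (norm_nonneg _)).trans ?_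
  rw [norm_star]
  exact le_of_eq (by ring)

variable (B E) in
/-- The module is full: the inner products span a dense subspace of `B`. -/
def IsFull : Prop :=
  (Submodule.span ℂ {b : B | ∃ x y : E, b = ip x y}).topologicalClosure = ⊤

variable (B) in
/-- The rank-one operator `θ_{x,y} z = x ⟪y, z⟫`. -/
noncomputable def theta (x y : E) : E →L[ℂ] E :=
  LinearMap.mkContinuous
    { toFun := fun z => op (ip (B := B) y z) • x
      map_add' := fun z w => by rw [ip_add_right, op_add, add_smul]
      map_smul' := fun c z => by rw [ip_smul_right, op_smul_smul]; rfl }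
    (‖x‖ * ‖y‖) fun z => by
      refine (norm_op_smul_le _ _).trans ?_
      rw [mul_assoc]
      exact mul_le_mul_of_nonneg_left (norm_ip_le y z) (norm_nonneg x)

variable (B E) in
/-- The compact operators `𝒦(E)`: the closed linear span of the rank-one operators. -/
noncomputable def compacts : Submodule ℂ (E →L[ℂ] E) :=
  (Submodule.span ℂ {T | ∃ x y : E, T = theta B x y}).topologicalClosure

variable (B) in
theorem theta_mem_compacts (x y : E) : theta B x y ∈ compacts B E :=
  Submodule.le_topologicalClosure _ (Submodule.subset_span ⟨x, y, rfl⟩)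

end HilbertModule

end HilbertModule

section ExtTensor

open MulOpposite HilbertModule

/-- The algebraic tensor product `E ⊙ C` of a Hilbert `B`-module `E` and a C⋆-algebra `C`, as a
carrier for the norm of the exterior tensor product (`C` is a Hilbert module over itself). -/
def AlgExt (_B E C : Type u) [NormedAddCommGroup E] [NormedSpace ℂ E] [CStarAlgebra C] : Type u :=
  E ⊗[ℂ] C

variable (B E C : Type u) [CStarAlgebra B] [CStarAlgebra C] [NormedAddCommGroup E]
  [NormedSpace ℂ E] [Module Bᵐᵒᵖ E] [HilbertModule B E]

noncomputable instance : AddCommGroup (AlgExt B E C) := inferInstanceAs (AddCommGroup (E ⊗[ℂ] C))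
noncomputable instance : Module ℂ (AlgExt B E C) := inferInstanceAs (Module ℂ (E ⊗[ℂ] C))

namespace AlgExt

/-- The `(B ⊙ C)`-valued inner product `⟪x ⊗ c, y ⊗ d⟫ = ⟪x, y⟫ ⊗ c* d` on `E ⊙ C`. -/
noncomputable def ip : E ⊗[ℂ] C →ₗ⋆[ℂ] E ⊗[ℂ] C →ₗ[ℂ] B ⊗[ℂ] C :=
  TensorProduct.map₂ (ipₗ (B := B))
    (LinearMap.mk₂'ₛₗ (starRingEnd ℂ) (RingHom.id ℂ) (fun c d : C => star c * d)
      (fun a b c => by rw [star_add, add_mul])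
      (fun z a b => by rw [star_smul, smul_mul_assoc]; rfl)
      (fun a b c => mul_add _ _ _)
      (fun z a b => by rw [mul_smul_comm]; rfl))

theorem ip_tmul (x y : E) (c d : C) :
    ip B E C (x ⊗ₜ c) (y ⊗ₜ d) = HilbertModule.ip (B := B) x y ⊗ₜ (star c * d) := rfl

/-- The right action of `B ⊙ C` on `E ⊙ C`, `(x ⊗ c)(b ⊗ d) = x b ⊗ c d`. -/
noncomputable def act : E ⊗[ℂ] C →ₗ[ℂ] B ⊗[ℂ] C →ₗ[ℂ] E ⊗[ℂ] C :=
  TensorProduct.map₂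
    (LinearMap.mk₂ ℂ (fun (x : E) (b : B) => op b • x)
      (fun x y b => smul_add _ _ _)
      (fun z x b => eq_of_ip_left B fun w => by
        rw [ip_op_smul_right, ip_smul_right, ip_smul_right, ip_op_smul_right, smul_mul_assoc])
      (fun x b c => by rw [op_add, add_smul])
      (fun z x b => op_smul_smul z b x))
    (LinearMap.mul ℂ C)

theorem act_tmul (x : E) (c : C) (b : B) (d : C) :
    act B E C (x ⊗ₜ c) (b ⊗ₜ d) = (op b • x) ⊗ₜ (c * d) := rfl

variable {B E C}

theorem star_ip (x y : E ⊗[ℂ] C) : star (ip B E C x y) = ip B E C y x := by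
  induction x with
  | zero => simp
  | add x x' h h' => simp only [map_add, LinearMap.add_apply, star_add, h, h']
  | tmul x c =>
    induction y with
    | zero => simp
    | add y y' h h' => simp only [map_add, LinearMap.add_apply, star_add, h, h']
    | tmul y d =>
      rw [ip_tmul, ip_tmul, TensorProduct.star_tmul, HilbertModule.star_ip, star_mul, star_star]

theorem ip_act_right (x y : E ⊗[ℂ] C) (b : B ⊗[ℂ] C) :
    ip B E C x (act B E C y b) = ip B E C x y * b := by
  induction b with
  | zero => simp
  | add b b' h h' => simp only [map_add, mul_add, h, h']
  | tmul b e =>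
    induction y with
    | zero => simp
    | add y y' h h' => simp only [map_add, LinearMap.add_apply, add_mul, h, h']
    | tmul y d =>
      induction x with
      | zero => simp
      | add x x' h h' => simp only [map_add, LinearMap.add_apply, add_mul, h, h']
      | tmul x c =>
        rw [act_tmul, ip_tmul, ip_tmul, ip_op_smul_right, Algebra.TensorProduct.tmul_mul_tmul,
          mul_assoc]

theorem ip_act_left (x y : E ⊗[ℂ] C) (b : B ⊗[ℂ] C) :
    ip B E C (act B E C x b) y = star b * ip B E C x y := by
  rw [← star_ip, ip_act_right, star_mul, star_ip]

/-- Positivity of the inner product of `E ⊙ C` in the minimal tensor product. -/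
theorem isPos_ip_self (x : E ⊗[ℂ] C) : IsPos (MinTensor.of (ip B E C x x)) := by
  obtain ⟨n, e, c, rfl⟩ : ∃ (n : ℕ) (e : Fin n → E) (c : Fin n → C),
      x = ∑ i, e i ⊗ₜ[ℂ] c i := by
    induction x with
    | zero => exact ⟨0, 0, 0, by simp⟩
    | tmul x c => exact ⟨1, fun _ => x, fun _ => c, by simp⟩
    | add x y hx hy =>
      obtain ⟨n, e, c, rfl⟩ := hx
      obtain ⟨m, e', c', rfl⟩ := hy
      exact ⟨n + m, Fin.append e e', Fin.append c c', by simp [Fin.sum_univ_add]⟩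
  obtain ⟨s, hs⟩ := exists_gram (fun i j => HilbertModule.ip (B := B) (e i) (e j))
    (fun i j => HilbertModule.star_ip _ _) (fun b => by
      convert HilbertModule.isPos_ip_self (B := B) (∑ i, op (b i) • e i) using 1
      simp only [ip_sum_left, ip_sum_right, ip_op_smul_left, ip_op_smul_right,
        Finset.sum_mul, mul_assoc]
      exact Finset.sum_comm)
  have h : ip B E C (∑ i, e i ⊗ₜ[ℂ] c i) (∑ i, e i ⊗ₜ[ℂ] c i)
      = ∑ k, star (∑ i, s k i ⊗ₜ[ℂ] c i) * ∑ i, s k i ⊗ₜ[ℂ] c i := by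
    simp only [map_sum, LinearMap.sum_apply, ip_tmul, star_sum, TensorProduct.star_tmul,
      Finset.sum_mul, Finset.mul_sum, Algebra.TensorProduct.tmul_mul_tmul, hs,
      TensorProduct.sum_tmul]
    rw [Finset.sum_comm_cycle]
  rw [h, map_sum]
  exact IsPos.sum _ fun k _ => ⟨MinTensor.of (∑ i, s k i ⊗ₜ[ℂ] c i), by rw [map_mul, map_star]⟩

variable (B) in
/-- The norm `‖x‖ = ‖⟪x, x⟫‖ ^ (1/2)` of the exterior tensor product on `E ⊙ C`. -/
noncomputable def nrm (x : E ⊗[ℂ] C) : ℝ := √‖MinTensor.of (ip B E C x x)‖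

theorem nrm_nonneg (x : E ⊗[ℂ] C) : 0 ≤ nrm B x := Real.sqrt_nonneg _

theorem nrm_sq (x : E ⊗[ℂ] C) : nrm B x ^ 2 = ‖MinTensor.of (ip B E C x x)‖ :=
  Real.sq_sqrt (norm_nonneg _)

theorem norm_ip_le (x y : E ⊗[ℂ] C) : ‖MinTensor.of (ip B E C x y)‖ ≤ nrm B x * nrm B y := by
  refine abs_le_of_sq_le_sq' ?_ (mul_nonneg (nrm_nonneg _) (nrm_nonneg _)) |>.2
  rw [mul_pow, nrm_sq, nrm_sq]
  refine norm_sq_le_of_isPos (isPos_ip_self _) fun t => ?_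
  have h := isPos_ip_self (B := B) ((t : ℂ) • act B E C x (ip B E C x y) - y : E ⊗[ℂ] C)
  convert h using 1
  rw [← map_star]
  simp only [map_sub, map_smul, LinearMap.map_smulₛₗ, LinearMap.sub_apply, LinearMap.smul_apply,
    ip_act_left, ip_act_right, star_ip, map_mul, Complex.conj_ofReal]
  simp only [Complex.coe_smul, mul_assoc]
  module

theorem nrm_smul (z : ℂ) (x : E ⊗[ℂ] C) : nrm B (z • x) = ‖z‖ * nrm B x := by
  refine (sq_eq_sq₀ (nrm_nonneg _) (mul_nonneg (norm_nonneg _) (nrm_nonneg _))).1 ?_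
  rw [mul_pow, nrm_sq, nrm_sq, map_smul, LinearMap.map_smulₛₗ, LinearMap.smul_apply, map_smul,
    map_smul, norm_smul, norm_smul, RCLike.norm_conj, sq, mul_assoc]

theorem nrm_add_le (x y : E ⊗[ℂ] C) : nrm B (x + y) ≤ nrm B x + nrm B y := by
  refine abs_le_of_sq_le_sq' ?_ (add_nonneg (nrm_nonneg _) (nrm_nonneg _)) |>.2
  have : ip B E C (x + y) (x + y)
      = ip B E C x x + ip B E C x y + ip B E C y x + ip B E C y y := by
    simp only [map_add, LinearMap.add_apply]; abel
  rw [nrm_sq, this, map_add, map_add, map_add]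
  have h1 := norm_ip_le (B := B) x y
  have h2 := norm_ip_le (B := B) y x
  have h3 := nrm_sq (B := B) x
  have h4 := nrm_sq (B := B) y
  refine (norm_add₄_le).trans ?_
  nlinarith

theorem nrm_act_le (x : E ⊗[ℂ] C) (b : B ⊗[ℂ] C) :
    nrm B (act B E C x b) ≤ nrm B x * ‖MinTensor.of b‖ := by
  refine abs_le_of_sq_le_sq' ?_ (mul_nonneg (nrm_nonneg _) (norm_nonneg _)) |>.2
  rw [mul_pow, nrm_sq, nrm_sq, ip_act_right, ip_act_left, map_mul, map_mul, map_star]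
  refine (norm_mul_le _ _).trans ?_
  refine (mul_le_mul_of_nonneg_right (norm_mul_le _ _) (norm_nonneg _)).trans ?_
  rw [norm_star]
  exact le_of_eq (by ring)

noncomputable instance : Norm (AlgExt B E C) where
  norm x := nrm B (E := E) (C := C) x

theorem seminormCore : SeminormedSpace.Core ℂ (AlgExt B E C) where
  norm_nonneg x := nrm_nonneg (B := B) (E := E) (C := C) x
  norm_smul z x := nrm_smul (B := B) (E := E) (C := C) z x
  norm_triangle x y := nrm_add_le (B := B) (E := E) (C := C) x y

noncomputable instance : SeminormedAddCommGroup (AlgExt B E C) :=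
  SeminormedAddCommGroup.ofCore seminormCore

noncomputable instance : NormedSpace ℂ (AlgExt B E C) where
  norm_smul_le z x := (seminormCore.norm_smul z x).le

end AlgExt

end ExtTensor

section Extend

variable {X X' Y Y' Z : Type*} [AddCommGroup X] [Module ℂ X] [AddCommGroup Y] [Module ℂ Y]
  [NormedAddCommGroup X'] [NormedSpace ℂ X'] [NormedAddCommGroup Y'] [NormedSpace ℂ Y']
  [NormedAddCommGroup Z] [NormedSpace ℂ Z] [CompleteSpace Z] {σ : ℂ →+* ℂ}

/-- Extension of a bounded (sesqui-)bilinear map along maps with dense range. -/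
noncomputable def extendBilin (T : X →ₛₗ[σ] Y →ₗ[ℂ] Z) (i : X →ₗ[ℂ] X') (j : Y →ₗ[ℂ] Y')
    (hj : DenseRange j) (h : ∀ x y, ‖T x y‖ ≤ ‖i x‖ * ‖j y‖) : X' →SL[σ] Y' →L[ℂ] Z :=
  LinearMap.extendOfNorm
    { toFun := fun x => (T x).extendOfNorm j
      map_add' := fun x x' => ContinuousLinearMap.ext fun y => by
        refine hj.induction_on y (isClosed_eq (by fun_prop) (by fun_prop)) fun y => ?_
        rw [_root_.add_apply, LinearMap.extendOfNorm_eq hj ⟨_, h _⟩,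
          LinearMap.extendOfNorm_eq hj ⟨_, h _⟩, LinearMap.extendOfNorm_eq hj ⟨_, h _⟩, map_add,
          LinearMap.add_apply]
      map_smul' := fun c x => ContinuousLinearMap.ext fun y => by
        refine hj.induction_on y (isClosed_eq (by fun_prop) (by fun_prop)) fun y => ?_
        rw [_root_.smul_apply, LinearMap.extendOfNorm_eq hj ⟨_, h _⟩,
          LinearMap.extendOfNorm_eq hj ⟨_, h _⟩, LinearMap.map_smulₛₗ, LinearMap.smul_apply] } i

theorem extendBilin_apply (T : X →ₛₗ[σ] Y →ₗ[ℂ] Z) (i : X →ₗ[ℂ] X') (j : Y →ₗ[ℂ] Y')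
    (hi : DenseRange i) (hj : DenseRange j) (h : ∀ x y, ‖T x y‖ ≤ ‖i x‖ * ‖j y‖) (x : X) (y : Y) :
    extendBilin T i j hj h (i x) (j y) = T x y := by
  rw [extendBilin, LinearMap.extendOfNorm_eq hi]
  · exact LinearMap.extendOfNorm_eq hj ⟨_, h _⟩ y
  · exact ⟨1, fun x => by
      rw [one_mul]
      exact LinearMap.opNorm_extendOfNorm_le hj (norm_nonneg _) (h x)⟩

end Extend

section ExtTensor

open MulOpposite

/-- The exterior tensor product `E ⊗ C`, a Hilbert module over the minimal tensor product
`B ⊗ C`: the completion of `E ⊙ C`. -/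
def ExtTensor (B E C : Type u) [CStarAlgebra B] [CStarAlgebra C] [NormedAddCommGroup E]
    [NormedSpace ℂ E] [Module Bᵐᵒᵖ E] [HilbertModule B E] : Type u :=
  UniformSpace.Completion (AlgExt B E C)

namespace ExtTensor

variable {B E C : Type u} [CStarAlgebra B] [CStarAlgebra C] [NormedAddCommGroup E]
  [NormedSpace ℂ E] [Module Bᵐᵒᵖ E] [HilbertModule B E]

noncomputable instance : NormedAddCommGroup (ExtTensor B E C) :=
  inferInstanceAs (NormedAddCommGroup (UniformSpace.Completion (AlgExt B E C)))

noncomputable instance : NormedSpace ℂ (ExtTensor B E C) :=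
  inferInstanceAs (NormedSpace ℂ (UniformSpace.Completion (AlgExt B E C)))

instance : CompleteSpace (ExtTensor B E C) :=
  inferInstanceAs (CompleteSpace (UniformSpace.Completion (AlgExt B E C)))

variable (B) in
/-- The canonical map `E ⊙ C → E ⊗ C`. -/
noncomputable def of : E ⊗[ℂ] C →ₗ[ℂ] ExtTensor B E C :=
  (UniformSpace.Completion.toComplₗᵢ (𝕜 := ℂ) (E := AlgExt B E C)).toLinearMap

theorem denseRange_of : DenseRange (of B : E ⊗[ℂ] C → ExtTensor B E C) :=
  UniformSpace.Completion.denseRange_coe (α := AlgExt B E C)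

theorem norm_of (x : E ⊗[ℂ] C) : ‖of B x‖ = AlgExt.nrm B x :=
  UniformSpace.Completion.norm_coe (E := AlgExt B E C) x

variable (B) in
/-- The elementary tensor `x ⊗ c` in the exterior tensor product. -/
noncomputable def tmul (x : E) (c : C) : ExtTensor B E C := of B (x ⊗ₜ c)

/-- The `(B ⊗ C)`-valued inner product of `E ⊗ C`. -/
noncomputable def inn : ExtTensor B E C →L⋆[ℂ] ExtTensor B E C →L[ℂ] MinTensor B C :=
  extendBilin ((AlgExt.ip B E C).compr₂ₛₗ (MinTensor.of (A := B) (B := C)).toAlgHom.toLinearMap)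
    (of B) (of B) denseRange_of fun x y => by
    rw [norm_of, norm_of]
    exact AlgExt.norm_ip_le x y

theorem inn_of (x y : E ⊗[ℂ] C) :
    inn (of B x) (of B y) = MinTensor.of (AlgExt.ip B E C x y) :=
  extendBilin_apply _ _ _ denseRange_of denseRange_of _ x y

/-- The right action of `B ⊗ C` on `E ⊗ C`. -/
noncomputable def act : ExtTensor B E C →L[ℂ] MinTensor B C →L[ℂ] ExtTensor B E C :=
  extendBilin ((AlgExt.act B E C).compr₂ₛₗ (of B))
    (of B) (MinTensor.of (A := B) (B := C)).toAlgHom.toLinearMap MinTensor.denseRange_of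
    fun x y => by
    rw [norm_of]
    exact (norm_of _).trans_le (AlgExt.nrm_act_le x y)

theorem act_of (x : E ⊗[ℂ] C) (b : B ⊗[ℂ] C) :
    act (of B x) (MinTensor.of b) = of B (AlgExt.act B E C x b) :=
  extendBilin_apply _ _ _ denseRange_of MinTensor.denseRange_of _ x b

theorem inn_act_right (x y : ExtTensor B E C) (b : MinTensor B C) : inn x (act y b) = inn x y * b := by
  refine denseRange_of.induction_on₂ (isClosed_eq (by fun_prop) (by fun_prop)) (fun x y => ?_) x y
  refine MinTensor.denseRange_of.induction_on b (isClosed_eq (by fun_prop) (by fun_prop))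
    fun b => ?_
  rw [act_of, inn_of, inn_of, AlgExt.ip_act_right, map_mul]

theorem star_inn (x y : ExtTensor B E C) : star (inn x y) = inn y x := by
  refine denseRange_of.induction_on₂ (isClosed_eq (by fun_prop) (by fun_prop)) (fun x y => ?_) x y
  rw [inn_of, inn_of, ← map_star, AlgExt.star_ip]

theorem norm_sq_eq (x : ExtTensor B E C) : ‖x‖ ^ 2 = ‖inn x x‖ := by
  refine denseRange_of.induction_on x (isClosed_eq (by fun_prop) (by fun_prop)) fun x => ?_
  rw [inn_of, norm_of, AlgExt.nrm_sq]

theorem eq_of_inn {x y : ExtTensor B E C} (h : ∀ z, inn z x = inn z y) : x = y := by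
  rw [← sub_eq_zero, ← norm_eq_zero, ← sq_eq_zero_iff, norm_sq_eq, map_sub, h, sub_self, norm_zero]

noncomputable instance : Module (MinTensor B C)ᵐᵒᵖ (ExtTensor B E C) where
  smul b x := act x b.unop
  one_smul x := eq_of_inn fun z => (inn_act_right z x 1).trans (mul_one _)
  mul_smul b b' x := eq_of_inn fun z => by
    refine (inn_act_right z x (b'.unop * b.unop)).trans ?_
    refine Eq.trans ?_ (inn_act_right z (act x b'.unop) b.unop).symm
    rw [inn_act_right, mul_assoc]
  smul_zero b := by change act 0 b.unop = 0; simp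
  smul_add b x y := by change act (x + y) b.unop = act x b.unop + act y b.unop; simp
  add_smul b b' x := map_add (act x) b.unop b'.unop
  zero_smul x := map_zero (act x)

theorem op_smul_eq (x : ExtTensor B E C) (b : MinTensor B C) : op b • x = act x b := rfl

noncomputable instance : HilbertModule (MinTensor B C) (ExtTensor B E C) where
  complete := inferInstance
  ip x y := inn x y
  ip_add_right x y z := map_add (inn x) y z
  ip_smul_right c x y := map_smul (inn x) c y
  ip_op_smul_right b x y := inn_act_right x y b
  star_ip := star_inn
  isPos_ip_self x := by
    refine denseRange_of.induction_on x ?_ fun x => ?_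
    · exact isClosed_isPos.preimage (f := fun x : ExtTensor B E C => inn x x) (by fun_prop)
    · rw [inn_of]; exact AlgExt.isPos_ip_self x
  norm_sq_eq := norm_sq_eq

theorem ip_eq (x y : ExtTensor B E C) : HilbertModule.ip (B := MinTensor B C) x y = inn x y := rfl

variable {B' F C' : Type u} [CStarAlgebra B'] [CStarAlgebra C'] [NormedAddCommGroup F]
  [NormedSpace ℂ F] [Module B'ᵐᵒᵖ F] [HilbertModule B' F]

theorem ip_map (T : E →ₗ[ℂ] F) (f : B →⋆ₐ[ℂ] B') (g : C →⋆ₐ[ℂ] C')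
    (h : ∀ x y, HilbertModule.ip (T x) (T y) = f (HilbertModule.ip x y)) (x y : E ⊗[ℂ] C) :
    AlgExt.ip B' F C' (TensorProduct.map T g.toAlgHom.toLinearMap x)
      (TensorProduct.map T g.toAlgHom.toLinearMap y) = AlgTensor.map f g (AlgExt.ip B E C x y) := by
  induction x with
  | zero => simp
  | add x x' h h' => simp only [map_add, LinearMap.add_apply, h, h']
  | tmul x c =>
    induction y with
    | zero => simp
    | add y y' h h' => simp only [map_add, h, h']
    | tmul y d =>
      rw [TensorProduct.map_tmul, TensorProduct.map_tmul, AlgExt.ip_tmul, AlgExt.ip_tmul, h]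
      change _ = f _ ⊗ₜ g (star c * d)
      rw [map_mul, map_star]
      rfl

/-- The map `T ⊗ g : E ⊗ C → F ⊗ C'` for `T : E → F` with `⟪T x, T y⟫ = f ⟪x, y⟫`. -/
noncomputable def map (T : E →ₗ[ℂ] F) (f : B →⋆ₐ[ℂ] B') (g : C →⋆ₐ[ℂ] C')
    (_h : ∀ x y, HilbertModule.ip (T x) (T y) = f (HilbertModule.ip x y)) :
    ExtTensor B E C →L[ℂ] ExtTensor B' F C' :=
  LinearMap.extendOfNorm (of B' ∘ₗ TensorProduct.map T g.toAlgHom.toLinearMap) (of B)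

theorem map_of (T : E →ₗ[ℂ] F) (f : B →⋆ₐ[ℂ] B') (g : C →⋆ₐ[ℂ] C')
    (h : ∀ x y, HilbertModule.ip (T x) (T y) = f (HilbertModule.ip x y)) (x : E ⊗[ℂ] C) :
    map T f g h (of B x) = of B' (TensorProduct.map T g.toAlgHom.toLinearMap x) := by
  refine LinearMap.extendOfNorm_eq denseRange_of ⟨1, fun x => ?_⟩ x
  rw [one_mul, LinearMap.comp_apply, norm_of, norm_of]
  refine Real.sqrt_le_sqrt ?_
  rw [ip_map T f g h, ← MinTensor.map_of]
  exact NonUnitalStarAlgHom.norm_apply_le _ _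

/-- The map `t ⊗ id : E ⊗ C → D ⊗ C` for a linear map `t : E → D` into a C⋆-algebra with
`t(x)* t(y) = π ⟪x, y⟫`. -/
noncomputable def mapAlg {D : Type u} [CStarAlgebra D] (t : E →ₗ[ℂ] D) (π : B →⋆ₐ[ℂ] D)
    (_h : ∀ x y, star (t x) * t y = π (HilbertModule.ip x y)) : ExtTensor B E C →L[ℂ] MinTensor D C :=
  LinearMap.extendOfNorm ((MinTensor.of (A := D) (B := C)).toAlgHom.toLinearMap ∘ₗ
    TensorProduct.map t LinearMap.id) (of B)

theorem mapAlg_of {D : Type u} [CStarAlgebra D] (t : E →ₗ[ℂ] D) (π : B →⋆ₐ[ℂ] D)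
    (h : ∀ x y, star (t x) * t y = π (HilbertModule.ip x y)) (x : E ⊗[ℂ] C) :
    mapAlg t π h (of B x) = MinTensor.of (TensorProduct.map t LinearMap.id x) := by
  refine LinearMap.extendOfNorm_eq denseRange_of ⟨1, fun x => ?_⟩ x
  have key : ∀ x y : E ⊗[ℂ] C, star (TensorProduct.map t LinearMap.id x)
      * TensorProduct.map t LinearMap.id y
        = AlgTensor.map π (StarAlgHom.id ℂ C) (AlgExt.ip B E C x y) := by
    intro x y
    induction x with
    | zero => simp
    | add x x' h h' => simp only [map_add, star_add, add_mul, LinearMap.add_apply, h, h']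
    | tmul x c =>
      induction y with
      | zero => simp
      | add y y' h h' => simp only [map_add, mul_add, h, h']
      | tmul y d =>
        rw [TensorProduct.map_tmul, TensorProduct.map_tmul, AlgExt.ip_tmul,
          TensorProduct.star_tmul, Algebra.TensorProduct.tmul_mul_tmul, h]
        rfl
  rw [one_mul, norm_of]
  refine Real.le_sqrt_of_sq_le ?_
  change ‖MinTensor.of (TensorProduct.map t LinearMap.id x)‖ ^ 2 ≤ _
  rw [sq, ← CStarRing.norm_star_mul_self, ← map_star, ← map_mul, key, ← MinTensor.map_of]
  exact NonUnitalStarAlgHom.norm_apply_le _ _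

end ExtTensor

end ExtTensor

section CompactQuantumGroups

open MulOpposite HilbertModule

variable {A B C D E : Type u} [CStarAlgebra A] [CStarAlgebra B] [CStarAlgebra C] [CStarAlgebra D]
  [NormedAddCommGroup E] [NormedSpace ℂ E] [Module Bᵐᵒᵖ E] [HilbertModule B E]

/-- `x` and `y` correspond to each other under the canonical isomorphism
`(A ⊗ B) ⊗ C ≅ A ⊗ (B ⊗ C)`. This isomorphism is isometric and given by
`(a ⊗ b) ⊗ c ↦ a ⊗ (b ⊗ c)` on the dense algebraic tensor product, so its graph is the closure of
the graph of the algebraic associator. -/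
def MinTensor.Assoc (x : MinTensor (MinTensor A B) C) (y : MinTensor A (MinTensor B C)) : Prop :=
  (x, y) ∈ closure (Set.range fun z : (A ⊗[ℂ] B) ⊗[ℂ] C =>
    ((MinTensor.of (TensorProduct.map (MinTensor.of (A := A) (B := B)).toAlgHom.toLinearMap
        LinearMap.id z) : MinTensor (MinTensor A B) C),
      (MinTensor.of (TensorProduct.map LinearMap.id
        (MinTensor.of (A := B) (B := C)).toAlgHom.toLinearMap (TensorProduct.assoc ℂ A B C z)) :
          MinTensor A (MinTensor B C))))

/-- `x` and `y` correspond to each other under the canonical isomorphism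
`(E ⊗ C) ⊗ D ≅ E ⊗ (C ⊗ D)` of Hilbert modules. -/
def ExtTensor.Assoc (x : ExtTensor (MinTensor B C) (ExtTensor B E C) D)
    (y : ExtTensor B E (MinTensor C D)) : Prop :=
  (x, y) ∈ closure (Set.range fun z : (E ⊗[ℂ] C) ⊗[ℂ] D =>
    ((ExtTensor.of (MinTensor B C) (TensorProduct.map (ExtTensor.of B) LinearMap.id z) :
        ExtTensor (MinTensor B C) (ExtTensor B E C) D),
      (ExtTensor.of B (TensorProduct.map LinearMap.id
        (MinTensor.of (A := C) (B := D)).toAlgHom.toLinearMap (TensorProduct.assoc ℂ E C D z)) :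
          ExtTensor B E (MinTensor C D))))

/-- A compact quantum group with C⋆-algebra of functions `C = C(G)`. -/
structure CompactQuantumGroup (C : Type u) [CStarAlgebra C] where
  /-- The comultiplication. -/
  Δ : C →⋆ₐ[ℂ] MinTensor C C
  coassoc (c : C) : MinTensor.Assoc (MinTensor.map Δ (StarAlgHom.id ℂ C) (Δ c))
    (MinTensor.map (StarAlgHom.id ℂ C) Δ (Δ c))
  dense_right : (Submodule.span ℂ
    {x : MinTensor C C | ∃ a b : C, x = Δ a * MinTensor.tmul 1 b}).topologicalClosure = ⊤
  dense_left : (Submodule.span ℂ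
    {x : MinTensor C C | ∃ a b : C, x = Δ a * MinTensor.tmul b 1}).topologicalClosure = ⊤

/-- `α` is an action of the compact quantum group `G` on the unital C⋆-algebra `B`, that is,
`(B, α)` is a `G`-C⋆-algebra. -/
structure IsAction (G : CompactQuantumGroup C) (α : B →⋆ₐ[ℂ] MinTensor B C) : Prop where
  coassoc (b : B) : MinTensor.Assoc (MinTensor.map α (StarAlgHom.id ℂ C) (α b))
    (MinTensor.map (StarAlgHom.id ℂ B) G.Δ (α b))
  podles : (Submodule.span ℂ
    {x : MinTensor B C | ∃ (b : B) (c : C), x = α b * MinTensor.tmul 1 c}).topologicalClosure = ⊤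

/-- `(E, l)` is a `G`-equivariant Hilbert module over the `G`-C⋆-algebra `(B, α)`. -/
structure IsEquivariantModule (G : CompactQuantumGroup C) (α : B →⋆ₐ[ℂ] MinTensor B C)
    (l : E →ₗ[ℂ] ExtTensor B E C) : Prop where
  map_op_smul (b : B) (x : E) : l (op b • x) = op (α b) • l x
  ip_map (x y : E) : ip (l x) (l y) = α (ip x y)
  coassoc (x : E) : ExtTensor.Assoc (ExtTensor.map l α (StarAlgHom.id ℂ C) ip_map (l x))
    (ExtTensor.map LinearMap.id (StarAlgHom.id ℂ B) G.Δ (fun _ _ => rfl) (l x))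
  podles : (Submodule.span ℂ {y : ExtTensor B E C | ∃ (x : E) (c : C),
    y = op (MinTensor.tmul (1 : B) c) • l x}).topologicalClosure = ⊤

variable (B E) in
/-- The left action of a C⋆-correspondence over `B` with underlying right Hilbert `B`-module `E`:
a unital `⋆`-homomorphism `φ` from `B` to the adjointable operators on `E`. -/
structure LeftAction where
  /-- The homomorphism into the bounded operators. -/
  φ : B →ₐ[ℂ] (E →L[ℂ] E)
  ip_left (b : B) (x y : E) : ip (B := B) (φ b x) y = ip x (φ (star b) y)

/-- The left action of `B ⊙ C` on `E ⊙ C`, `(b ⊗ c)(x ⊗ d) = φ(b) x ⊗ c d`. -/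
noncomputable def LeftAction.alg (L : LeftAction B E) :
    B ⊗[ℂ] C →ₗ[ℂ] E ⊗[ℂ] C →ₗ[ℂ] E ⊗[ℂ] C :=
  TensorProduct.map₂ ((ContinuousLinearMap.coeLM ℂ).comp L.φ.toLinearMap) (LinearMap.mul ℂ C)

/-- The relation `(φ ⊗ id)(b) x = y`, for `b` in `B ⊗ C` and `x, y` in `E ⊗ C`. The left action of
`B ⊗ C` on `E ⊗ C` is the unique continuous extension of the left action of `B ⊙ C` on `E ⊙ C`, so
its graph is the closure of the graph of the latter. -/
def LeftAction.Rel (L : LeftAction B E) (b : MinTensor B C) (x y : ExtTensor B E C) : Prop :=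
  (b, x, y) ∈ closure (Set.range fun p : (B ⊗[ℂ] C) × (E ⊗[ℂ] C) =>
    ((MinTensor.of p.1 : MinTensor B C), (ExtTensor.of B p.2 : ExtTensor B E C),
      (ExtTensor.of B (L.alg p.1 p.2) : ExtTensor B E C)))

/-- `(E, φ, l)` is a `G`-equivariant C⋆-correspondence over the `G`-C⋆-algebra `(B, α)`. -/
structure IsEquivariantCorrespondence (G : CompactQuantumGroup C) (L : LeftAction B E)
    (α : B →⋆ₐ[ℂ] MinTensor B C) (l : E →ₗ[ℂ] ExtTensor B E C) : Prop
    extends IsEquivariantModule G α l where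
  map_left (b : B) (x : E) : L.Rel (α b) (l x) (l (L.φ b x))

/-- A representation `(t, π)` of the C⋆-correspondence `(E, φ)` on the unital C⋆-algebra `D`. -/
structure CorrRep (L : LeftAction B E) (D : Type u) [CStarAlgebra D] where
  /-- The map on the module. -/
  t : E →ₗ[ℂ] D
  /-- The map on the algebra of coefficients. -/
  π : B →⋆ₐ[ℂ] D
  star_mul (x y : E) : star (t x) * t y = π (ip x y)
  left_mul (b : B) (x : E) : t (L.φ b x) = π b * t x

/-- The map `t ⊗ id : E ⊗ C → D ⊗ C`. -/
noncomputable def CorrRep.tensor {L : LeftAction B E} (r : CorrRep L D) :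
    ExtTensor B E C →L[ℂ] MinTensor D C :=
  ExtTensor.mapAlg r.t r.π r.star_mul

/-- Covariance: with `ψ` the map on `𝒦(E)` determined by `ψ(θ_{x,y}) = t(x) t(y)*`, one has
`ψ(φ(b)) = π(b)` for all `b` in `φ⁻¹(𝒦(E)) ∩ (ker φ)^⊥`. -/
def CorrRep.IsCovariant {L : LeftAction B E} (r : CorrRep L D) : Prop :=
  ∃ ψ : compacts B E →L[ℂ] D,
    (∀ x y : E, ψ ⟨theta B x y, theta_mem_compacts B x y⟩ = r.t x * star (r.t y)) ∧
    ∀ (b : B) (hb : L.φ b ∈ compacts B E), (∀ a : B, L.φ a = 0 → b * a = 0) →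
      ψ ⟨L.φ b, hb⟩ = r.π b

/-- `D` is the Pimsner algebra `𝒪_E`, with universal covariant representation `k = (k_E, k_B)`. -/
def CorrRep.IsPimsnerAlgebra {L : LeftAction B E} (k : CorrRep L D) : Prop :=
  k.IsCovariant ∧ ∀ (D' : Type u) [CStarAlgebra D'] (r : CorrRep L D'), r.IsCovariant →
    ∃! f : D →⋆ₐ[ℂ] D', (∀ x, f (k.t x) = r.t x) ∧ ∀ b, f (k.π b) = r.π b

/-- The defining relations of the `⋆`-homomorphism `ω : 𝒪_E → 𝒪_E ⊗ C(G)` induced by `α` and `l`: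
`ω ∘ k_E = (k_E ⊗ id) ∘ l` and `ω ∘ k_B = (k_B ⊗ id) ∘ α`. -/
def CorrRep.IsInduced {L : LeftAction B E} (k : CorrRep L D) (α : B →⋆ₐ[ℂ] MinTensor B C)
    (l : E →ₗ[ℂ] ExtTensor B E C) (ω : D →⋆ₐ[ℂ] MinTensor D C) : Prop :=
  (∀ x : E, ω (k.t x) = k.tensor (l x)) ∧
    ∀ b : B, ω (k.π b) = MinTensor.map k.π (StarAlgHom.id ℂ C) (α b)

/-- The action `ρ` of `G` on the Pimsner algebra `D = 𝒪_E` is a lift: there are actions `α` of `G`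
on `B` and `l` of `G` on `E` that make `(E, φ)` a `G`-equivariant C⋆-correspondence, and `ρ` is the
unique `⋆`-homomorphism induced by `α` and `l`. -/
def CorrRep.IsLift {L : LeftAction B E} (k : CorrRep L D) (G : CompactQuantumGroup C)
    (ρ : D →⋆ₐ[ℂ] MinTensor D C) : Prop :=
  ∃ (α : B →⋆ₐ[ℂ] MinTensor B C) (l : E →ₗ[ℂ] ExtTensor B E C),
    IsAction G α ∧ IsEquivariantCorrespondence G L α l ∧
    k.IsInduced α l ρ ∧ ∀ ω : D →⋆ₐ[ℂ] MinTensor D C, k.IsInduced α l ω → ω = ρ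

end CompactQuantumGroups

section CircleActions

open MulOpposite

/-- A (strongly continuous) action of the circle group on the C⋆-algebra `A` by unital
`⋆`-automorphisms, i.e. the structure of a `𝕋`-C⋆-algebra. -/
structure CircleAction (A : Type u) [CStarAlgebra A] where
  /-- The automorphisms `γ_z`; they are invertible by `map_one` and `map_mul`. -/
  act : Circle → A →⋆ₐ[ℂ] A
  map_one (a : A) : act 1 a = a
  map_mul (z w : Circle) (a : A) : act (z * w) a = act z (act w a)
  continuous (a : A) : Continuous fun z => act z a

namespace CircleAction

variable {A : Type u} [CStarAlgebra A] (γ : CircleAction A)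

/-- The spectral subspace `A(n)` of homogeneous elements of degree `n`. -/
def spectral (n : ℤ) : Submodule ℂ A where
  carrier := {a | ∀ z : Circle, γ.act z a = (z : ℂ) ^ n • a}
  add_mem' ha hb z := by rw [map_add, ha z, hb z, smul_add]
  zero_mem' z := by rw [map_zero, smul_zero]
  smul_mem' c a ha z := by rw [map_smul, ha z, smul_comm]

theorem mem_spectral {n : ℤ} {a : A} :
    a ∈ γ.spectral n ↔ ∀ z : Circle, γ.act z a = (z : ℂ) ^ n • a := Iff.rfl

theorem continuous_act (z : Circle) : Continuous (γ.act z) :=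
  AddMonoidHomClass.continuous_of_bound (γ.act z) 1 fun a => by
    simpa using NonUnitalStarAlgHom.norm_apply_le (γ.act z) a

theorem isClosed_spectral (n : ℤ) : IsClosed (γ.spectral n : Set A) := by
  have : (γ.spectral n : Set A) = ⋂ z : Circle, {a | γ.act z a = (z : ℂ) ^ n • a} := by
    ext a; simp [mem_spectral]
  rw [this]
  exact isClosed_iInter fun z => isClosed_eq (γ.continuous_act z) (continuous_const_smul _)

instance (n : ℤ) : CompleteSpace (γ.spectral n) := (γ.isClosed_spectral n).completeSpace_coe

theorem mul_mem {m n : ℤ} {a b : A} (ha : a ∈ γ.spectral m) (hb : b ∈ γ.spectral n) :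
    a * b ∈ γ.spectral (m + n) := fun z => by
  rw [_root_.map_mul, ha z, hb z, smul_mul_smul_comm, zpow_add₀ (Circle.coe_ne_zero z)]

theorem star_mem {n : ℤ} {a : A} (ha : a ∈ γ.spectral n) : star a ∈ γ.spectral (-n) := fun z => by
  rw [map_star, ha z, star_smul, zpow_neg, ← inv_zpow, ← Circle.coe_inv, Circle.coe_inv_eq_conj,
    star_zpow₀]
  rfl

/-- The fixed point algebra `A(0)`. -/
def fixed : StarSubalgebra ℂ A where
  carrier := γ.spectral 0
  mul_mem' ha hb := γ.mul_mem ha hb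
  add_mem' ha hb := (γ.spectral 0).add_mem ha hb
  algebraMap_mem' c z := by rw [AlgHomClass.commutes, zpow_zero, one_smul]
  star_mem' ha := γ.star_mem ha

theorem mem_fixed {a : A} : a ∈ γ.fixed ↔ a ∈ γ.spectral 0 := Iff.rfl

instance : IsClosed (γ.fixed : Set A) := γ.isClosed_spectral 0

noncomputable instance : CStarAlgebra γ.fixed := inferInstance

/-- The right `A(0)`-module structure of `A(n)`, by multiplication in `A`. -/
instance (n : ℤ) : Module (γ.fixed)ᵐᵒᵖ (γ.spectral n) where
  smul b x := ⟨x * b.unop, by simpa using γ.mul_mem x.2 b.unop.2⟩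
  one_smul x := Subtype.ext (mul_one (x : A))
  mul_smul b c x := Subtype.ext (mul_assoc (x : A) c.unop b.unop).symm
  smul_zero b := Subtype.ext (zero_mul (b.unop : A))
  smul_add b x y := Subtype.ext (add_mul (x : A) y b.unop)
  add_smul b c x := Subtype.ext (mul_add (x : A) b.unop c.unop)
  zero_smul x := Subtype.ext (mul_zero (x : A))

theorem coe_op_smul {n : ℤ} (b : γ.fixed) (x : γ.spectral n) :
    ((op b • x : γ.spectral n) : A) = x * b := rfl

theorem star_mul_mem {n : ℤ} (x y : γ.spectral n) : star (x : A) * y ∈ γ.fixed := by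
  rw [mem_fixed]; simpa using γ.mul_mem (γ.star_mem x.2) y.2

theorem isPos_star_mul {n : ℤ} (x : γ.spectral n) :
    IsPos (⟨star (x : A) * x, γ.star_mul_mem x x⟩ : γ.fixed) := by
  let _ := CStarAlgebra.spectralOrder A
  have _ := CStarAlgebra.spectralOrderedRing A
  have h0 : 0 ≤ star (x : A) * x := star_mul_self_nonneg _
  have hc : CFC.sqrt (star (x : A) * x) ∈ γ.fixed := fun z => by
    rw [zpow_zero, one_smul]
    refine (CFC.sqrt_unique ?_ ?_).symm
    · rw [← _root_.map_mul, CFC.sqrt_mul_sqrt_self _ h0]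
      simpa using γ.star_mul_mem x x z
    · refine (isPos_iff_nonneg _).1 (IsPos.map ?_ (γ.act z))
      exact (isPos_iff_nonneg _).2 (CFC.sqrt_nonneg _)
  refine ⟨⟨_, hc⟩, Subtype.ext ?_⟩
  have hs : star (CFC.sqrt (star (x : A) * x)) = CFC.sqrt (star (x : A) * x) :=
    (CFC.sqrt_nonneg (star (x : A) * x)).isSelfAdjoint.star_eq
  change _ = star (CFC.sqrt (star (x : A) * x)) * CFC.sqrt (star (x : A) * x)
  rw [hs, CFC.sqrt_mul_sqrt_self _ h0]

/-- The Hilbert `A(0)`-module structure of `A(n)`, with `⟪x, y⟫ = x* y`. -/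
noncomputable instance (n : ℤ) : HilbertModule γ.fixed (γ.spectral n) where
  complete := inferInstance
  ip x y := ⟨star (x : A) * y, γ.star_mul_mem x y⟩
  ip_add_right x y z := Subtype.ext (mul_add (star (x : A)) y z)
  ip_smul_right c x y := Subtype.ext (mul_smul_comm c (star (x : A)) y)
  ip_op_smul_right b x y := Subtype.ext (mul_assoc (star (x : A)) y b).symm
  star_ip x y := Subtype.ext (by simp)
  isPos_ip_self x := γ.isPos_star_mul x
  norm_sq_eq x := by
    rw [sq]; exact (CStarRing.norm_star_mul_self (x := (x : A))).symm

/-- The left action `φ(a) x = a x` of `A(0)` on `A(1)`. -/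
noncomputable def leftAction : LeftAction γ.fixed (γ.spectral 1) where
  φ := AlgHom.ofLinearMap
    { toFun := fun b => LinearMap.mkContinuous
        { toFun := fun x => ⟨(b : A) * x, by simpa using γ.mul_mem b.2 x.2⟩
          map_add' := fun x y => Subtype.ext (mul_add (b : A) x y)
          map_smul' := fun c x => Subtype.ext (mul_smul_comm c (b : A) x) } ‖b‖
        fun x => norm_mul_le (b : A) x
      map_add' := fun b c => ContinuousLinearMap.ext fun x =>
        Subtype.ext (add_mul (b : A) c x)
      map_smul' := fun c b => ContinuousLinearMap.ext fun x =>
        Subtype.ext (smul_mul_assoc c (b : A) x) }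
    (ContinuousLinearMap.ext fun x => Subtype.ext (one_mul (x : A)))
    (fun b c => ContinuousLinearMap.ext fun x => Subtype.ext (mul_assoc (b : A) c x))
  ip_left b x y := Subtype.ext (by
    change star ((b : A) * x) * y = star (x : A) * (star (b : A) * y)
    rw [star_mul, mul_assoc])

/-- The representation of the correspondence `A(1)` over `A(0)` on `A` given by the inclusions. -/
noncomputable def inclusion : CorrRep γ.leftAction A where
  t := (γ.spectral 1).subtype
  π := γ.fixed.subtype
  star_mul _ _ := rfl
  left_mul _ _ := rfl

/-- The action is principal: `A(m) A(n) = A(m + n)`, i.e. the grading is strong. -/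
def IsPrincipal : Prop := ∀ m n : ℤ, γ.spectral m * γ.spectral n = γ.spectral (m + n)

/-- The `G`-action `ρ` is equivariant for the circle action: `(γ_z ⊗ id) ∘ ρ = ρ ∘ γ_z`. -/
def IsGaugeEquivariant {C : Type u} [CStarAlgebra C] (ρ : A →⋆ₐ[ℂ] MinTensor A C) : Prop :=
  ∀ (z : Circle) (a : A), MinTensor.map (γ.act z) (StarAlgHom.id ℂ C) (ρ a) = ρ (γ.act z a)

/-- The action is the gauge action for the representation `k`: `γ_z(k_B(b)) = k_B(b)` and
`γ_z(k_E(x)) = z k_E(x)`. -/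
def IsGaugeAction {B E : Type u} [CStarAlgebra B] [NormedAddCommGroup E] [NormedSpace ℂ E]
    [Module Bᵐᵒᵖ E] [HilbertModule B E] {L : LeftAction B E} (k : CorrRep L A) : Prop :=
  ∀ z : Circle, (∀ b : B, γ.act z (k.π b) = k.π b) ∧ ∀ x : E, γ.act z (k.t x) = (z : ℂ) • k.t x

end CircleAction

end CircleActions

section CircleCoefficients

open AddCircle MeasureTheory

variable {X Y : Type*} [NormedAddCommGroup X] [NormedSpace ℂ X]
  [NormedAddCommGroup Y] [NormedSpace ℂ Y]

theorem AddCircle.exists_toCircle_eq (w : Circle) : ∃ s : AddCircle (1 : ℝ), toCircle s = w := by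
  obtain ⟨s, hs⟩ := (homeomorphCircle (T := 1) one_ne_zero).surjective w
  exact ⟨s, (homeomorphCircle_apply one_ne_zero s).symm.trans hs⟩

/-- The `n`-th Fourier coefficient `∫ z⁻ⁿ f(z) dz` of a function on the circle. -/
noncomputable def circleCoeff (n : ℤ) (f : Circle → X) : X :=
  ∫ t : AddCircle (1 : ℝ), ((toCircle t : ℂ) ^ (-n)) • f (toCircle t) ∂haarAddCircle

theorem circleCoeff_eq_fourierCoeff (n : ℤ) (f : Circle → X) :
    circleCoeff n f = fourierCoeff (T := 1) (fun t => f (toCircle t)) n := by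
  simp only [circleCoeff, fourierCoeff, fourier_apply, toCircle_zsmul, Circle.coe_zpow]

theorem continuous_zpow_smul (n : ℤ) {f : Circle → X} (hf : Continuous f) :
    Continuous fun z : Circle => ((z : ℂ) ^ n) • f z := by
  refine Continuous.smul ?_ hf
  simp only [← Circle.coe_zpow]
  exact continuous_subtype_val.comp (continuous_zpow n)

theorem integrable_circleCoeff (n : ℤ) {f : Circle → X} (hf : Continuous f) :
    Integrable (fun t : AddCircle (1 : ℝ) => ((toCircle t : ℂ) ^ (-n)) • f (toCircle t))
      haarAddCircle :=
  ((continuous_zpow_smul (-n) hf).comp continuous_toCircle).integrable_of_hasCompactSupport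
    (HasCompactSupport.of_compactSpace _)

theorem circleCoeff_add (n : ℤ) {f g : Circle → X} (hf : Continuous f) (hg : Continuous g) :
    circleCoeff n (fun z => f z + g z) = circleCoeff n f + circleCoeff n g := by
  simp only [circleCoeff, smul_add]
  exact integral_add (integrable_circleCoeff n hf) (integrable_circleCoeff n hg)

theorem circleCoeff_zero (n : ℤ) : circleCoeff n (fun _ => (0 : X)) = 0 := by
  simp [circleCoeff]

theorem circleCoeff_clm [CompleteSpace X] [CompleteSpace Y] (n : ℤ) (L : X →L[ℂ] Y)
    {f : Circle → X} (hf : Continuous f) :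
    circleCoeff n (fun z => L (f z)) = L (circleCoeff n f) := by
  simp only [circleCoeff, ← map_smul]
  exact L.integral_comp_comm (integrable_circleCoeff n hf)

theorem norm_circleCoeff_le (n : ℤ) {f : Circle → X} {M : ℝ} (h : ∀ z, ‖f z‖ ≤ M) :
    ‖circleCoeff n f‖ ≤ M := by
  refine (norm_integral_le_of_norm_le_const (C := M) (Filter.Eventually.of_forall fun t => ?_)).trans
    (by simp)
  rw [norm_smul, norm_zpow, Circle.norm_coe, one_zpow, one_mul]
  exact h _

theorem circleCoeff_zpow_smul [CompleteSpace X] (n : ℤ) (x : X) :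
    circleCoeff n (fun z => (z : ℂ) ^ n • x) = x := by
  have : ∀ z : Circle, ((z : ℂ) ^ (-n)) • ((z : ℂ) ^ n • x) = x := fun z => by
    rw [smul_smul, ← zpow_add₀ (Circle.coe_ne_zero z), neg_add_cancel, zpow_zero, one_smul]
  simp only [circleCoeff, this]
  simp

theorem circleCoeff_comp_mul (n : ℤ) (f : Circle → X) (w : Circle) :
    circleCoeff n (fun z => f (w * z)) = (w : ℂ) ^ n • circleCoeff n f := by
  obtain ⟨s, rfl⟩ := AddCircle.exists_toCircle_eq w
  have h := integral_add_left_eq_self (μ := haarAddCircle)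
    (fun t : AddCircle (1 : ℝ) => ((toCircle t : ℂ) ^ (-n)) • f (toCircle t)) s
  simp only [circleCoeff]
  rw [← h, ← integral_smul]
  refine integral_congr_ae (Filter.Eventually.of_forall fun t => ?_)
  simp only [toCircle_add, Circle.coe_mul, mul_zpow, smul_smul]
  rw [← mul_assoc, ← zpow_add₀ (Circle.coe_ne_zero _), add_neg_cancel, zpow_zero, one_mul]

theorem eq_zero_of_circleCoeff_eq_zero {f : Circle → ℂ} (hf : Continuous f)
    (h : ∀ n, circleCoeff n f = 0) : f = 0 := by
  let F : C(AddCircle (1 : ℝ), ℂ) := ⟨fun t => f (toCircle t), hf.comp continuous_toCircle⟩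
  have hF : ∀ n, fourierCoeff (⇑F) n = 0 := fun n =>
    (circleCoeff_eq_fourierCoeff n f).symm.trans (h n)
  have hs : HasSum (fun i : ℤ => fourierCoeff (⇑F) i • fourier (T := 1) i) F :=
    hasSum_fourier_series_of_summable (by rw [funext hF]; exact summable_zero)
  have h0 : (fun i : ℤ => fourierCoeff (⇑F) i • fourier (T := 1) i) = fun _ => 0 := by
    funext i
    rw [hF i]
    exact zero_smul ℂ (fourier (T := 1) i)
  rw [h0] at hs
  have hz : F = 0 := hs.unique hasSum_zero
  funext z
  obtain ⟨s, rfl⟩ := AddCircle.exists_toCircle_eq z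
  exact DFunLike.congr_fun hz s

/-- Averaging an approximation of an eigenvector improves it. -/
theorem norm_circleCoeff_sub_le [CompleteSpace X] {U : Circle → X →ₗ[ℂ] X}
    (hU : ∀ z x, ‖U z x‖ ≤ ‖x‖) {n : ℤ} {x y : X} (hx : ∀ z : Circle, U z x = (z : ℂ) ^ n • x)
    (hy : Continuous fun z => U z y) : ‖circleCoeff n (fun z => U z y) - x‖ ≤ ‖y - x‖ := by
  have hxc : Continuous fun z => U z (-x) := by
    simp only [map_neg, hx]; exact (continuous_zpow_smul n continuous_const).neg
  have h : circleCoeff n (fun z => U z y) - x = circleCoeff n (fun z => U z (y - x)) := by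
    have h1 : circleCoeff n (fun z => U z (-x)) = -x := by
      simp only [map_neg, hx, ← smul_neg]; exact circleCoeff_zpow_smul n (-x)
    rw [sub_eq_add_neg, ← h1, ← circleCoeff_add n hy hxc]
    simp only [← map_add, ← sub_eq_add_neg]
  rw [h]
  exact norm_circleCoeff_le n fun z => hU z _

end CircleCoefficients

namespace CircleAction

variable {A : Type u} [CStarAlgebra A] (γ : CircleAction A)

theorem circleCoeff_act_mem (n : ℤ) (a : A) : circleCoeff n (fun z => γ.act z a) ∈ γ.spectral n := by
  intro w
  let L : A →L[ℂ] A := ⟨(γ.act w).toAlgHom.toLinearMap, γ.continuous_act w⟩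
  rw [← circleCoeff_comp_mul]
  simp only [γ.map_mul]
  exact (circleCoeff_clm n L (γ.continuous a)).symm

/-- The projection `a ↦ ∫ z⁻ⁿ γ_z(a) dz` onto the spectral subspace `A(n)`. -/
noncomputable def proj (n : ℤ) : A →L[ℂ] γ.spectral n :=
  LinearMap.mkContinuous
    { toFun := fun a => ⟨circleCoeff n (fun z => γ.act z a), γ.circleCoeff_act_mem n a⟩
      map_add' := fun a b => Subtype.ext (by
        simp only [map_add]
        exact circleCoeff_add n (γ.continuous a) (γ.continuous b))
      map_smul' := fun c a => Subtype.ext (by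
        simp only [map_smul]
        exact circleCoeff_clm n (c • ContinuousLinearMap.id ℂ A) (γ.continuous a)) } 1
    fun a => by
      rw [one_mul]
      exact norm_circleCoeff_le n fun z => NonUnitalStarAlgHom.norm_apply_le (γ.act z) a

theorem coe_proj (n : ℤ) (a : A) : (γ.proj n a : A) = circleCoeff n (fun z => γ.act z a) := rfl

theorem norm_proj_le (n : ℤ) (a : A) : ‖γ.proj n a‖ ≤ ‖a‖ :=
  norm_circleCoeff_le n fun z => NonUnitalStarAlgHom.norm_apply_le (γ.act z) a

theorem proj_of_mem {n : ℤ} {a : A} (ha : a ∈ γ.spectral n) : (γ.proj n a : A) = a := by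
  rw [coe_proj]
  simp only [γ.mem_spectral.1 ha]
  exact circleCoeff_zpow_smul n a

theorem eq_zero_of_mem_spectral {m n : ℤ} (h : m ≠ n) {a : A} (hm : a ∈ γ.spectral m)
    (hn : a ∈ γ.spectral n) : a = 0 := by
  by_contra ha
  obtain ⟨z, hz⟩ : ∃ z : Circle, z ^ (m - n) ≠ 1 := by
    by_contra! hc
    have h2 := hc (Circle.exp 1)
    rw [← Circle.exp_zsmul, Circle.exp_eq_one] at h2
    obtain ⟨k, hk⟩ := h2
    have hmn : ((m - n : ℤ) : ℝ) ≠ 0 := by exact_mod_cast sub_ne_zero.2 h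
    have hk0 : (k : ℝ) ≠ 0 := by
      rintro h0
      rw [h0, zero_mul] at hk
      exact hmn (by simpa using hk)
    refine irrational_pi.ne_rational (m - n) (2 * k) ?_
    push_cast
    have : ((m - n : ℤ) : ℝ) = k * (2 * Real.pi) := by simpa using hk
    push_cast at this
    rw [this]
    field_simp
  have h1 := (hm z).symm.trans (hn z)
  have h2 : ((z : ℂ) ^ m - (z : ℂ) ^ n) • a = 0 := by rw [sub_smul, h1, sub_self]
  rcases smul_eq_zero.1 h2 with h3 | h3
  · refine hz (Circle.ext ?_)
    rw [Circle.coe_zpow, zpow_sub₀ (Circle.coe_ne_zero z), sub_eq_zero.1 h3,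
      div_self (zpow_ne_zero _ (Circle.coe_ne_zero z)), Circle.coe_one]
  · exact ha h3

theorem proj_of_mem_ne {m n : ℤ} (h : m ≠ n) {a : A} (ha : a ∈ γ.spectral m) :
    γ.proj n a = 0 := by
  refine Subtype.ext (γ.eq_zero_of_mem_spectral h ?_ (γ.proj n a).2)
  intro w
  let L : A →L[ℂ] A := ⟨(γ.act w).toAlgHom.toLinearMap, γ.continuous_act w⟩
  have h1 : γ.act w (circleCoeff n (fun z => γ.act z a))
      = circleCoeff n (fun z => γ.act w (γ.act z a)) :=
    (circleCoeff_clm n L (γ.continuous a)).symm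
  rw [coe_proj, h1]
  have h2 : ∀ z, γ.act w (γ.act z a) = ((w : ℂ) ^ m • ContinuousLinearMap.id ℂ A) (γ.act z a) :=
    fun z => by
      rw [γ.mem_spectral.1 ha z, map_smul, γ.mem_spectral.1 ha w, map_smul]; rfl
  simp only [h2]
  exact circleCoeff_clm n _ (γ.continuous a)

theorem dense_iSup_spectral : (⨆ n, γ.spectral n).topologicalClosure = ⊤ := by
  refine eq_top_iff.2 fun a _ => ?_
  set S := (⨆ n, γ.spectral n).topologicalClosure with hS
  have hSc : IsClosed (S : Set A) := Submodule.isClosed_topologicalClosure _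
  rw [← Submodule.Quotient.mk_eq_zero]
  refine SeparatingDual.eq_zero_of_forall_dual_eq_zero (R := ℂ) fun f => ?_
  let L : A →L[ℂ] ℂ := f.comp S.mkQL
  have hz : (fun z => L (γ.act z a)) = 0 := by
    refine eq_zero_of_circleCoeff_eq_zero (L.continuous.comp (γ.continuous a)) fun n => ?_
    rw [circleCoeff_clm n L (γ.continuous a)]
    have : circleCoeff n (fun z => γ.act z a) ∈ S :=
      Submodule.le_topologicalClosure _ (Submodule.mem_iSup_of_mem n (γ.circleCoeff_act_mem n a))
    change f (Submodule.Quotient.mk _) = 0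
    rw [(Submodule.Quotient.mk_eq_zero S).2 this, map_zero]
  have := congrFun hz 1
  simp only [γ.map_one] at this
  exact this

end CircleAction

section GradedTriple

variable {R : Type*} [Ring R] [Algebra ℂ R]

/-- Subspaces of degree `-1`, `0`, `1` of an algebra that generate a `ℤ`-graded subalgebra with
`G0` in degree zero. -/
structure IsGradedTriple (Gm G0 G1 : Submodule ℂ R) : Prop where
  one_le : 1 ≤ G0
  zero_zero : G0 * G0 ≤ G0
  zero_one : G0 * G1 ≤ G1
  one_zero : G1 * G0 ≤ G1
  zero_neg : G0 * Gm ≤ Gm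
  neg_zero : Gm * G0 ≤ Gm
  one_neg : G1 * Gm ≤ G0
  neg_one : Gm * G1 ≤ G0

namespace IsGradedTriple

variable {Gm G0 G1 : Submodule ℂ R} (h : IsGradedTriple Gm G0 G1)

include h

theorem symm : IsGradedTriple G1 G0 Gm :=
  ⟨h.one_le, h.zero_zero, h.zero_neg, h.neg_zero, h.zero_one, h.one_zero, h.neg_one, h.one_neg⟩

theorem le_zero_mul (S : Submodule ℂ R) : S ≤ G0 * S := by
  conv_lhs => rw [← one_mul S]
  exact mul_le_mul' h.one_le le_rfl

theorem one_mul_pow (k : ℕ) : G1 * (G0 * G1 ^ k) ≤ G0 * G1 ^ (k + 1) := by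
  rw [← mul_assoc, pow_succ']
  exact (mul_le_mul' h.one_zero le_rfl).trans (h.le_zero_mul _)

theorem neg_mul_pow (k : ℕ) : Gm * (G0 * G1 ^ (k + 1)) ≤ G0 * G1 ^ k := by
  rw [← mul_assoc, pow_succ', ← mul_assoc]
  exact mul_le_mul' ((mul_le_mul' h.neg_zero le_rfl).trans h.neg_one) le_rfl

theorem pow_mul_pow_le (k : ℕ) : Gm ^ k * G0 * G1 ^ k ≤ G0 := by
  induction k with
  | zero => simp
  | succ k ih =>
    calc Gm ^ (k + 1) * G0 * G1 ^ (k + 1) = Gm ^ k * (Gm * G0 * G1) * G1 ^ k := by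
          rw [pow_succ, pow_succ']; simp only [mul_assoc]
      _ ≤ Gm ^ k * G0 * G1 ^ k :=
          mul_le_mul' (mul_le_mul' le_rfl ((mul_le_mul' h.neg_zero le_rfl).trans h.neg_one)) le_rfl
      _ ≤ G0 := ih

end IsGradedTriple

/-- The component of degree `n` of the graded algebra generated by a graded triple. -/
def gradedPart (Gm G0 G1 : Submodule ℂ R) : ℤ → Submodule ℂ R
  | Int.ofNat k => G0 * G1 ^ k
  | Int.negSucc k => G0 * Gm ^ (k + 1)

namespace IsGradedTriple

variable {Gm G0 G1 : Submodule ℂ R} (h : IsGradedTriple Gm G0 G1)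

include h

theorem zero_mul_gradedPart (n : ℤ) : G0 * gradedPart Gm G0 G1 n ≤ gradedPart Gm G0 G1 n := by
  cases n <;>
  · simp only [gradedPart]
    rw [← mul_assoc]
    exact mul_le_mul' h.zero_zero le_rfl

theorem one_mul_gradedPart (n : ℤ) :
    G1 * gradedPart Gm G0 G1 n ≤ gradedPart Gm G0 G1 (n + 1) := by
  rcases n with k | k
  · exact h.one_mul_pow k
  · rcases k with _ | k
    · exact h.symm.neg_mul_pow 0
    · have h1 : (Int.negSucc (k + 1) + 1) = Int.negSucc k := by omega
      rw [h1]
      exact h.symm.neg_mul_pow (k + 1)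

theorem neg_mul_gradedPart (n : ℤ) :
    Gm * gradedPart Gm G0 G1 n ≤ gradedPart Gm G0 G1 (n - 1) := by
  rcases n with k | k
  · rcases k with _ | k
    · have h1 := h.symm.one_mul_pow 0
      exact h1
    · have h1 : (Int.ofNat (k + 1) - 1) = Int.ofNat k := by
        simp
      rw [h1]
      exact h.neg_mul_pow k
  · have h1 : (Int.negSucc k - 1) = Int.negSucc (k + 1) := by omega
    rw [h1]
    exact h.symm.one_mul_pow (k + 1)

theorem one_le_sup : 1 ≤ Gm ⊔ G0 ⊔ G1 := h.one_le.trans (le_sup_right.trans le_sup_left)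

theorem sup_pow_le (d : ℕ) : (Gm ⊔ G0 ⊔ G1) ^ d ≤
    ⨆ n ∈ Finset.Icc (-d : ℤ) d, gradedPart Gm G0 G1 n := by
  induction d with
  | zero =>
    rw [pow_zero]
    refine h.one_le.trans (le_trans ?_ (le_iSup₂ (0 : ℤ) (by simp)))
    change G0 ≤ G0 * G1 ^ 0
    rw [pow_zero, mul_one]
  | succ d ih =>
    rw [pow_succ']
    refine (mul_le_mul' le_rfl ih).trans ?_
    simp only [Submodule.mul_iSup, Submodule.sup_mul]
    refine iSup₂_le fun n hn => ?_
    rw [Finset.mem_Icc] at hn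
    push_cast
    refine sup_le (sup_le ?_ ?_) ?_
    · exact (h.neg_mul_gradedPart n).trans
        (le_iSup₂_of_le (n - 1) (Finset.mem_Icc.2 ⟨by omega, by omega⟩) le_rfl)
    · exact (h.zero_mul_gradedPart n).trans
        (le_iSup₂_of_le (n) (Finset.mem_Icc.2 ⟨by omega, by omega⟩) le_rfl)
    · exact (h.one_mul_gradedPart n).trans
        (le_iSup₂_of_le (n + 1) (Finset.mem_Icc.2 ⟨by omega, by omega⟩) le_rfl)

end IsGradedTriple

variable [StarRing R]

theorem star_mem_mul {S T S' T' : Submodule ℂ R} (hS : ∀ s ∈ S, star s ∈ S')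
    (hT : ∀ s ∈ T, star s ∈ T') : ∀ s ∈ S * T, star s ∈ T' * S' := by
  intro s hs
  refine Submodule.mul_induction_on hs (fun a ha b hb => ?_) fun a b ha hb => ?_
  · rw [star_mul]; exact Submodule.mul_mem_mul (hT b hb) (hS a ha)
  · rw [star_add]; exact add_mem ha hb

variable [StarModule ℂ R]

theorem star_mem_pow {S S' : Submodule ℂ R} (hS : ∀ s ∈ S, star s ∈ S') (k : ℕ) :
    ∀ s ∈ S ^ k, star s ∈ S' ^ k := by
  induction k with
  | zero =>
    intro s hs
    rw [pow_zero, Submodule.mem_one] at hs ⊢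
    obtain ⟨c, rfl⟩ := hs
    exact ⟨star c, algebraMap_star_comm c⟩
  | succ k ih =>
    rw [pow_succ, pow_succ']
    exact star_mem_mul ih hS

theorem IsGradedTriple.star_mul_self_mem {Gm G0 G1 : Submodule ℂ R}
    (h : IsGradedTriple Gm G0 G1) (h0 : ∀ s ∈ G0, star s ∈ G0) (h1 : ∀ s ∈ G1, star s ∈ Gm)
    (hm : ∀ s ∈ Gm, star s ∈ G1) (n : ℤ) : ∀ s ∈ gradedPart Gm G0 G1 n, star s * s ∈ G0 := by
  have key : ∀ {S T : Submodule ℂ R}, IsGradedTriple S G0 T → (∀ s ∈ T, star s ∈ S) → ∀ k : ℕ,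
      ∀ s ∈ G0 * T ^ k, star s * s ∈ G0 := by
    intro S T hST hT k s hs
    have h2 : star s * s ∈ S ^ k * G0 * (G0 * T ^ k) :=
      Submodule.mul_mem_mul (star_mem_mul h0 (star_mem_pow hT k) s hs) hs
    refine hST.pow_mul_pow_le k ((?_ : S ^ k * G0 * (G0 * T ^ k) ≤ _) h2)
    calc S ^ k * G0 * (G0 * T ^ k) = S ^ k * (G0 * G0) * T ^ k := by simp only [mul_assoc]
      _ ≤ _ := mul_le_mul' (mul_le_mul' le_rfl hST.zero_zero) le_rfl
  rcases n with k | k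
  · exact key h h1 k
  · exact key h.symm hm (k + 1)

end GradedTriple

theorem le_of_pow_two_pow_le {a b c : ℝ} (hb : 0 ≤ b) (hc : 0 ≤ c)
    (h : ∀ m : ℕ, a ^ 2 ^ m ≤ (c * 2 ^ m + 1) * b ^ 2 ^ m) : a ≤ b := by
  by_contra! hab
  rcases hb.eq_or_lt with rfl | hb
  · have := h 0
    simp at this
    linarith
  have hr : 1 < a / b := (one_lt_div hb).2 hab
  have h1 : ∀ m : ℕ, (a / b) ^ 2 ^ m ≤ (c + 1) * ((2 ^ m : ℕ) : ℝ) := fun m => by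
    rw [div_pow, div_le_iff₀ (by positivity)]
    refine (h m).trans (mul_le_mul_of_nonneg_right ?_ (by positivity))
    have : (1 : ℝ) ≤ 2 ^ m := one_le_pow₀ (by norm_num)
    push_cast
    linarith
  have h2 := (tendsto_pow_const_div_const_pow_of_one_lt 1 hr).comp
    (tendsto_pow_atTop_atTop_of_one_lt (one_lt_two : 1 < (2 : ℕ)))
  have h3 := (h2.eventually (gt_mem_nhds (show (0 : ℝ) < 1 / (c + 1) by positivity))).exists
  obtain ⟨m, hm⟩ := h3
  simp only [Function.comp_apply, pow_one] at hm
  rw [div_lt_div_iff₀ (by positivity) (by positivity)] at hm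
  have := h1 m
  linarith

theorem StarAlgHom.continuous_cstar {A D : Type*} [CStarAlgebra A] [CStarAlgebra D]
    (f : A →⋆ₐ[ℂ] D) : Continuous f :=
  AddMonoidHomClass.continuous_of_bound f 1 fun a => by
    simpa using NonUnitalStarAlgHom.norm_apply_le f a

/-- The direct sum of two C⋆-algebras. -/
def PairAlg (A D : Type*) : Type _ := A × D

noncomputable instance {A D : Type*} [CStarAlgebra A] [CStarAlgebra D] :
    CStarAlgebra (PairAlg A D) := inferInstanceAs (CStarAlgebra (A × D))

namespace CircleAction

open MulOpposite HilbertModule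

variable {A : Type u} [CStarAlgebra A] (γ : CircleAction A)

variable {γ} in
/-- A closed `⋆`-subalgebra that contains `A(0)` and `A(1)` is everything. -/
theorem IsPrincipal.eq_top (hγ : γ.IsPrincipal) (S : StarSubalgebra ℂ A)
    (hS : IsClosed (S : Set A)) (h0 : ∀ a ∈ γ.spectral 0, a ∈ S)
    (h1 : ∀ a ∈ γ.spectral 1, a ∈ S) : S = ⊤ := by
  have hnat : ∀ k : ℕ, ∀ a ∈ γ.spectral k, a ∈ S := by
    intro k
    induction k with
    | zero => exact h0
    | succ k ih =>
      intro a ha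
      push_cast at ha
      rw [← hγ] at ha
      exact Submodule.mul_induction_on ha (fun x hx y hy => MulMemClass.mul_mem (ih x hx) (h1 y hy))
        fun x y => add_mem
  have hint : ∀ n : ℤ, γ.spectral n ≤ S.toSubalgebra.toSubmodule := by
    intro n a ha
    rcases Int.eq_nat_or_neg n with ⟨k, rfl | rfl⟩
    · exact hnat k a ha
    · have := hnat k (star a) (by simpa using γ.star_mem ha)
      rw [← star_star a]
      exact S.star_mem' this
  have h2 : (⨆ n, γ.spectral n).topologicalClosure ≤ S.toSubalgebra.toSubmodule :=
    Submodule.topologicalClosure_minimal _ (iSup_le hint) hS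
  rw [γ.dense_iSup_spectral] at h2
  exact eq_top_iff.2 fun a _ => h2 trivial

variable {γ} in
theorem IsPrincipal.starAlgHom_ext (hγ : γ.IsPrincipal) {D : Type*} [CStarAlgebra D]
    {f g : A →⋆ₐ[ℂ] D} (h0 : ∀ a ∈ γ.spectral 0, f a = g a)
    (h1 : ∀ a ∈ γ.spectral 1, f a = g a) : f = g := by
  have h := hγ.eq_top (StarAlgHom.equalizer f g)
    (isClosed_eq (StarAlgHom.continuous_cstar f) (StarAlgHom.continuous_cstar g)) h0 h1
  exact StarAlgHom.ext fun a => (h ▸ trivial : a ∈ StarAlgHom.equalizer f g)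

variable {γ} in
theorem IsPrincipal.exists_sum_eq_one (hγ : γ.IsPrincipal) :
    ∃ (n : ℕ) (p : Fin n → γ.spectral 1) (q : Fin n → γ.spectral (-1)),
      ∑ i, (p i : A) * q i = 1 := by
  have h : (1 : A) ∈ γ.spectral 1 * γ.spectral (-1) := by
    rw [hγ]; exact γ.fixed.one_mem
  generalize (1 : A) = a at h
  refine Submodule.mul_induction_on h (fun x hx y hy => ?_) fun x y hx hy => ?_
  · exact ⟨1, fun _ => ⟨x, hx⟩, fun _ => ⟨y, hy⟩, by simp⟩
  · obtain ⟨n, p, q, rfl⟩ := hx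
    obtain ⟨m, p', q', rfl⟩ := hy
    exact ⟨n + m, Fin.append p p', Fin.append q q', by simp [Fin.sum_univ_add]⟩

theorem mul_mem_fixed {n : ℤ} (x : γ.spectral (-n)) (y : γ.spectral n) :
    (x : A) * y ∈ γ.fixed := by
  rw [mem_fixed]; simpa using γ.mul_mem x.2 y.2

variable {γ} in
theorem IsPrincipal.finite_and_projective (hγ : γ.IsPrincipal) :
    Module.Finite (γ.fixed)ᵐᵒᵖ (γ.spectral 1) ∧ Module.Projective (γ.fixed)ᵐᵒᵖ (γ.spectral 1) := by
  obtain ⟨n, p, q, hpq⟩ := hγ.exists_sum_eq_one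
  let i : γ.spectral 1 →ₗ[(γ.fixed)ᵐᵒᵖ] (Fin n → (γ.fixed)ᵐᵒᵖ) :=
    { toFun := fun x j => op ⟨q j * x, γ.mul_mem_fixed (q j) x⟩
      map_add' := fun x y => funext fun j => unop_injective (Subtype.ext (mul_add (q j : A) x y))
      map_smul' := fun b x => funext fun j => unop_injective (Subtype.ext
        (mul_assoc (q j : A) x b.unop).symm) }
  let s : (Fin n → (γ.fixed)ᵐᵒᵖ) →ₗ[(γ.fixed)ᵐᵒᵖ] γ.spectral 1 :=
    Fintype.linearCombination (γ.fixed)ᵐᵒᵖ p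
  have hsi : s ∘ₗ i = LinearMap.id := by
    refine LinearMap.ext fun x => Subtype.ext ?_
    rw [LinearMap.comp_apply, Fintype.linearCombination_apply, AddSubmonoidClass.coe_finsetSum]
    change ∑ j, (p j : A) * (q j * x) = x
    simp only [← mul_assoc, ← Finset.sum_mul, hpq, one_mul]
  exact ⟨Module.Finite.of_surjective s
    (Function.RightInverse.surjective fun x => LinearMap.congr_fun hsi x),
    Module.Projective.of_split i s hsi⟩

theorem coe_leftAction (b : γ.fixed) (x : γ.spectral 1) : (γ.leftAction.φ b x : A) = b * x := rfl

theorem coe_theta (x y z : γ.spectral 1) :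
    ((theta γ.fixed x y z : γ.spectral 1) : A) = x * (star (y : A) * z) := rfl

variable {γ} in
theorem IsPrincipal.isCovariant_inclusion (hγ : γ.IsPrincipal) : γ.inclusion.IsCovariant := by
  obtain ⟨n, p, q, hpq⟩ := hγ.exists_sum_eq_one
  let Ψ : (γ.spectral 1 →L[ℂ] γ.spectral 1) →L[ℂ] A :=
    ∑ j, ((ContinuousLinearMap.mul ℂ A).flip (q j)).comp
      ((γ.spectral 1).subtypeL.comp (ContinuousLinearMap.apply ℂ _ (p j)))
  have hΨ : ∀ T, Ψ T = ∑ j, (T (p j) : A) * q j := fun T => by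
    simp [Ψ]
  refine ⟨Ψ.comp (compacts γ.fixed (γ.spectral 1)).subtypeL, fun x y => ?_, fun b hb _ => ?_⟩
  · change Ψ (theta γ.fixed x y) = x * star (y : A)
    rw [hΨ]
    simp only [coe_theta, mul_assoc, ← Finset.mul_sum, hpq, mul_one]
  · change Ψ (γ.leftAction.φ b) = b
    rw [hΨ]
    simp only [coe_leftAction, mul_assoc, ← Finset.mul_sum, hpq, mul_one]

variable {γ} in
theorem IsPrincipal.eq_zero_of_leftAction (hγ : γ.IsPrincipal) {a : γ.fixed}
    (ha : γ.leftAction.φ a = 0) : a = 0 := by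
  obtain ⟨n, p, q, hpq⟩ := hγ.exists_sum_eq_one
  have h : ∀ x : γ.spectral 1, (a : A) * x = 0 := fun x => by
    rw [← coe_leftAction, ha]; rfl
  refine Subtype.ext ?_
  rw [← mul_one (a : A), ← hpq, Finset.mul_sum]
  exact Finset.sum_eq_zero fun i _ => by rw [← mul_assoc, h, zero_mul]

end CircleAction

section HilbertModuleMaps

open MulOpposite HilbertModule

variable {B E D : Type u} [CStarAlgebra B] [CStarAlgebra D]
  [NormedAddCommGroup E] [NormedSpace ℂ E] [Module Bᵐᵒᵖ E] [HilbertModule B E]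

theorem map_op_smul_of_ip {t : E →ₗ[ℂ] D} {π : B →⋆ₐ[ℂ] D}
    (h : ∀ x y, star (t x) * t y = π (ip x y)) (b : B) (x : E) :
    t (op b • x) = t x * π b := by
  rw [← sub_eq_zero, ← CStarRing.star_mul_self_eq_zero_iff]
  simp only [star_sub, sub_mul, mul_sub, StarMul.star_mul, ← mul_assoc, h]
  simp only [mul_assoc, h, ip_op_smul_right, ip_op_smul_left, map_mul, map_star]
  simp

theorem CorrRep.t_op_smul {L : LeftAction B E} (r : CorrRep L D) (b : B) (x : E) :
    r.t (op b • x) = r.t x * r.π b := map_op_smul_of_ip r.star_mul b x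

end HilbertModuleMaps

namespace CircleAction

open MulOpposite HilbertModule

variable {A : Type u} [CStarAlgebra A] (γ : CircleAction A) {D : Type u} [CStarAlgebra D]

theorem mul_star_mem_fixed {n : ℤ} (x y : γ.spectral n) : (x : A) * star (y : A) ∈ γ.fixed := by
  rw [mem_fixed]; simpa using γ.mul_mem x.2 (γ.star_mem y.2)

variable {γ} in
theorem IsPrincipal.t_mul_star (hγ : γ.IsPrincipal) {r : CorrRep γ.leftAction D}
    (hr : r.IsCovariant) (x y : γ.spectral 1) :
    r.t x * star (r.t y) = r.π ⟨(x : A) * star (y : A), γ.mul_star_mem_fixed x y⟩ := by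
  obtain ⟨ψ, hψ, hcov⟩ := hr
  have h : γ.leftAction.φ ⟨(x : A) * star (y : A), γ.mul_star_mem_fixed x y⟩
      = theta γ.fixed x y :=
    ContinuousLinearMap.ext fun z => Subtype.ext (mul_assoc (x : A) (star (y : A)) z)
  rw [← hψ, ← hcov _ (h ▸ theta_mem_compacts γ.fixed x y) fun a ha => by
    rw [hγ.eq_zero_of_leftAction ha, mul_zero]]
  congr 2
  exact h.symm

variable {γ} (r : CorrRep γ.leftAction D)

/-- The graph of `π : A(0) → D`. -/
noncomputable def graphZero : Submodule ℂ (PairAlg A D) :=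
  LinearMap.range ((γ.fixed.subtype.toAlgHom.toLinearMap).prod r.π.toAlgHom.toLinearMap)

/-- The graph of `t : A(1) → D`. -/
noncomputable def graphOne : Submodule ℂ (PairAlg A D) :=
  LinearMap.range ((γ.spectral 1).subtype.prod r.t)

/-- The graph of `x ↦ t(x*)*` on `A(-1)`. -/
noncomputable def graphNeg : Submodule ℂ (PairAlg A D) where
  carrier := {s | star s ∈ graphOne r}
  add_mem' ha hb := by
    simp only [Set.mem_ofPred_eq, star_add] at *
    exact add_mem ha hb
  zero_mem' := by simp
  smul_mem' c x hx := by
    simp only [Set.mem_ofPred_eq, star_smul] at *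
    exact Submodule.smul_mem _ _ hx

theorem mem_graphNeg {s : PairAlg A D} :
    s ∈ graphNeg r ↔ ∃ x : γ.spectral 1, (star (x : A), star (r.t x)) = s := by
  constructor
  · rintro ⟨x, hx⟩
    exact ⟨x, (congrArg star hx).trans (star_star s)⟩
  · rintro ⟨x, rfl⟩
    exact ⟨x, Prod.ext (star_star (x : A)).symm (star_star (r.t x)).symm⟩

theorem IsPrincipal.isGradedTriple (hγ : γ.IsPrincipal) (hr : r.IsCovariant) :
    IsGradedTriple (graphNeg r) (graphZero r) (graphOne r) where
  one_le := by
    rw [Submodule.one_le]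
    exact ⟨1, Prod.ext rfl (_root_.map_one r.π)⟩
  zero_zero := by
    rw [Submodule.mul_le]
    rintro _ ⟨b, rfl⟩ _ ⟨c, rfl⟩
    exact ⟨b * c, Prod.ext rfl (_root_.map_mul r.π b c)⟩
  zero_one := by
    rw [Submodule.mul_le]
    rintro _ ⟨b, rfl⟩ _ ⟨x, rfl⟩
    exact ⟨γ.leftAction.φ b x, Prod.ext rfl (r.left_mul b x)⟩
  one_zero := by
    rw [Submodule.mul_le]
    rintro _ ⟨x, rfl⟩ _ ⟨b, rfl⟩
    exact ⟨op b • x, Prod.ext rfl (r.t_op_smul b x)⟩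
  zero_neg := by
    rw [Submodule.mul_le]
    rintro _ ⟨b, rfl⟩ y hy
    obtain ⟨x, rfl⟩ := (mem_graphNeg r).1 hy
    refine (mem_graphNeg r).2 ⟨op (star b) • x, Prod.ext ?_ ?_⟩
    · exact (star_mul (x : A) (star b)).trans (congrArg (· * star (x : A)) (star_star (b : A)))
    · change star (r.t (op (star b) • x)) = r.π b * star (r.t x)
      rw [r.t_op_smul, star_mul, map_star, star_star]
  neg_zero := by
    rw [Submodule.mul_le]
    rintro y hy _ ⟨b, rfl⟩
    obtain ⟨x, rfl⟩ := (mem_graphNeg r).1 hy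
    refine (mem_graphNeg r).2 ⟨γ.leftAction.φ (star b) x, Prod.ext ?_ ?_⟩
    · exact (star_mul (star (b : A)) (x : A)).trans
        (congrArg (star (x : A) * ·) (star_star (b : A)))
    · change star (r.t (γ.leftAction.φ (star b) x)) = star (r.t x) * r.π b
      rw [r.left_mul, star_mul, map_star, star_star]
  one_neg := by
    rw [Submodule.mul_le]
    rintro _ ⟨x, rfl⟩ y hy
    obtain ⟨y, rfl⟩ := (mem_graphNeg r).1 hy
    exact ⟨⟨_, γ.mul_star_mem_fixed x y⟩, Prod.ext rfl (hγ.t_mul_star hr x y).symm⟩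
  neg_one := by
    rw [Submodule.mul_le]
    rintro x hx _ ⟨y, rfl⟩
    obtain ⟨x, rfl⟩ := (mem_graphNeg r).1 hx
    exact ⟨ip x y, Prod.ext rfl (r.star_mul x y).symm⟩

theorem star_mem_graphZero : ∀ s ∈ graphZero r, star s ∈ graphZero r := by
  rintro _ ⟨b, rfl⟩
  exact ⟨star b, Prod.ext rfl (map_star r.π b)⟩

theorem star_mem_graphNeg : ∀ s ∈ graphOne r, star s ∈ graphNeg r := fun s hs => by
  change star (star s) ∈ graphOne r
  rwa [star_star]

theorem fst_mem_of_mem_mul {S T : Submodule ℂ (PairAlg A D)} {m n : ℤ}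
    (hS : ∀ s ∈ S, s.1 ∈ γ.spectral m) (hT : ∀ s ∈ T, s.1 ∈ γ.spectral n) :
    ∀ s ∈ S * T, s.1 ∈ γ.spectral (m + n) := fun _ hs =>
  Submodule.mul_induction_on hs (fun a ha b hb => γ.mul_mem (hS a ha) (hT b hb))
    fun _ _ ha hb => add_mem ha hb

theorem fst_mem_of_mem_pow {S : Submodule ℂ (PairAlg A D)} {m : ℤ}
    (hS : ∀ s ∈ S, s.1 ∈ γ.spectral m) (k : ℕ) : ∀ s ∈ S ^ k, s.1 ∈ γ.spectral (k * m) := by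
  induction k with
  | zero =>
    intro s hs
    rw [pow_zero, Submodule.mem_one] at hs
    obtain ⟨c, rfl⟩ := hs
    rw [Nat.cast_zero, zero_mul]
    exact γ.fixed.algebraMap_mem c
  | succ k ih =>
    intro s hs
    have h := fst_mem_of_mem_mul ih hS s (by rwa [← pow_succ])
    push_cast
    rwa [add_mul, one_mul]

theorem fst_mem_spectral (n : ℤ) :
    ∀ s ∈ gradedPart (graphNeg r) (graphZero r) (graphOne r) n, s.1 ∈ γ.spectral n := by
  have h0 : ∀ s ∈ graphZero r, s.1 ∈ γ.spectral 0 := by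
    rintro _ ⟨b, rfl⟩; exact b.2
  have h1 : ∀ s ∈ graphOne r, s.1 ∈ γ.spectral 1 := by
    rintro _ ⟨x, rfl⟩; exact x.2
  have hm : ∀ s ∈ graphNeg r, s.1 ∈ γ.spectral (-1) := by
    intro s hs
    obtain ⟨x, rfl⟩ := (mem_graphNeg r).1 hs
    exact γ.star_mem x.2
  intro s hs
  rcases n with k | k
  · simpa using fst_mem_of_mem_mul h0 (fst_mem_of_mem_pow h1 k) s hs
  · have h := fst_mem_of_mem_mul h0 (fst_mem_of_mem_pow hm (k + 1)) s hs
    convert h using 2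
    push_cast
    omega

theorem norm_snd_le_of_mem_graphZero {s : PairAlg A D} (hs : s ∈ graphZero r) : ‖s.2‖ ≤ ‖s.1‖ := by
  obtain ⟨b, rfl⟩ := hs
  exact NonUnitalStarAlgHom.norm_apply_le r.π b

theorem IsPrincipal.norm_snd_le_of_mem_gradedPart (hγ : γ.IsPrincipal) (hr : r.IsCovariant)
    {n : ℤ} {s : PairAlg A D} (hs : s ∈ gradedPart (graphNeg r) (graphZero r) (graphOne r) n) :
    ‖s.2‖ ≤ ‖s.1‖ := by
  have h := (hγ.isGradedTriple r hr).star_mul_self_mem (star_mem_graphZero r)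
    (star_mem_graphNeg r) (fun _ => id) n s hs
  have h2 := norm_snd_le_of_mem_graphZero r h
  change ‖star s.2 * s.2‖ ≤ ‖star s.1 * s.1‖ at h2
  rw [CStarRing.norm_star_mul_self, CStarRing.norm_star_mul_self] at h2
  exact abs_le_of_sq_le_sq' (by simpa [sq] using h2) (norm_nonneg _) |>.2

/-- The generators of the graph of the `⋆`-homomorphism `A → D` induced by `r`. -/
noncomputable def graphGen : Submodule ℂ (PairAlg A D) := graphNeg r ⊔ graphZero r ⊔ graphOne r

theorem IsPrincipal.norm_snd_le_of_mem_pow_aux (hγ : γ.IsPrincipal) (hr : r.IsCovariant)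
    (d : ℕ) {s : PairAlg A D} (hs : s ∈ graphGen r ^ d) : ‖s.2‖ ≤ (2 * d + 1) * ‖s.1‖ := by
  obtain ⟨f, rfl⟩ := (Submodule.mem_iSup_finset_iff_exists_sum _ _).1
    ((hγ.isGradedTriple r hr).sup_pow_le d hs)
  have hfst : (∑ i ∈ Finset.Icc (-d : ℤ) d, (f i : PairAlg A D)).1
      = ∑ i ∈ Finset.Icc (-d : ℤ) d, (f i : PairAlg A D).1 := map_sum (StarAlgHom.fst ℂ A D) _ _
  have hsnd : (∑ i ∈ Finset.Icc (-d : ℤ) d, (f i : PairAlg A D)).2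
      = ∑ i ∈ Finset.Icc (-d : ℤ) d, (f i : PairAlg A D).2 := map_sum (StarAlgHom.snd ℂ A D) _ _
  have h1 : ∀ n ∈ Finset.Icc (-d : ℤ) d, ‖(f n : PairAlg A D).2‖
      ≤ ‖(∑ i ∈ Finset.Icc (-d : ℤ) d, (f i : PairAlg A D)).1‖ := fun n hn => by
    refine (hγ.norm_snd_le_of_mem_gradedPart r hr (f n).2).trans ?_
    have h2 : (γ.proj n (∑ i ∈ Finset.Icc (-d : ℤ) d, (f i : PairAlg A D)).1 : A) = (f n : PairAlg A D).1 := by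
      rw [hfst, map_sum, AddSubmonoidClass.coe_finsetSum, Finset.sum_eq_single n]
      · exact γ.proj_of_mem (fst_mem_spectral r n _ (f n).2)
      · intro m _ hmn
        exact congrArg Subtype.val (γ.proj_of_mem_ne hmn (fst_mem_spectral r m _ (f m).2))
      · exact fun h => absurd hn h
    rw [← h2]
    exact γ.norm_proj_le n _
  rw [hsnd]
  refine (norm_sum_le_of_le _ h1).trans ?_
  rw [Finset.sum_const, Int.card_Icc, nsmul_eq_mul]
  refine mul_le_mul_of_nonneg_right (le_of_eq ?_) (norm_nonneg _)
  have : ((d : ℤ) + 1 - -d).toNat = 2 * d + 1 := by omega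
  rw [this]
  push_cast
  ring

theorem star_mem_graphGen : ∀ s ∈ graphGen r, star s ∈ graphGen r := by
  intro s hs
  obtain ⟨a, ha, c, hc, rfl⟩ := Submodule.mem_sup.1 hs
  obtain ⟨a, ha', b, hb, rfl⟩ := Submodule.mem_sup.1 ha
  rw [star_add, star_add]
  refine add_mem (add_mem ?_ ?_) ?_
  · exact Submodule.mem_sup_right ha'
  · exact Submodule.mem_sup_left (Submodule.mem_sup_right (star_mem_graphZero r b hb))
  · exact Submodule.mem_sup_left (Submodule.mem_sup_left (star_mem_graphNeg r c hc))

theorem IsPrincipal.norm_snd_le (hγ : γ.IsPrincipal) (hr : r.IsCovariant)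
    (d : ℕ) {s : PairAlg A D} (hs : s ∈ graphGen r ^ d) : ‖s.2‖ ≤ ‖s.1‖ := by
  have h2 : star s * s ∈ graphGen r ^ (d + d) := by
    rw [pow_add]
    exact Submodule.mul_mem_mul (star_mem_pow (star_mem_graphGen r) d s hs) hs
  have h3 : ‖star s.2 * s.2‖ ≤ ‖star s.1 * s.1‖ := by
    refine le_of_pow_two_pow_le (c := 2 * (d + d)) (norm_nonneg _) (by positivity) fun m => ?_
    rw [← (IsSelfAdjoint.star_mul_self s.2).norm_pow_two_pow,
      ← (IsSelfAdjoint.star_mul_self s.1).norm_pow_two_pow]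
    have h4 : (star s * s) ^ 2 ^ m ∈ graphGen r ^ ((d + d) * 2 ^ m) := by
      rw [pow_mul]; exact Submodule.pow_mem_pow _ h2 _
    have h5 := hγ.norm_snd_le_of_mem_pow_aux r hr _ h4
    push_cast at h5
    rw [← mul_assoc] at h5
    exact h5
  rw [CStarRing.norm_star_mul_self, CStarRing.norm_star_mul_self] at h3
  exact abs_le_of_sq_le_sq' (by simpa [sq] using h3) (norm_nonneg _) |>.2

/-- The `⋆`-algebra generated by the graphs of `π` and `t`. -/
noncomputable def graphAlg (h : 1 ≤ graphGen r) : StarSubalgebra ℂ (PairAlg A D) where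
  carrier := {s | ∃ d : ℕ, s ∈ graphGen r ^ d}
  mul_mem' := by
    rintro a b ⟨d, ha⟩ ⟨e, hb⟩
    exact ⟨d + e, by rw [pow_add]; exact Submodule.mul_mem_mul ha hb⟩
  add_mem' := by
    rintro a b ⟨d, ha⟩ ⟨e, hb⟩
    exact ⟨max d e, add_mem (pow_le_pow_right₀ h (le_max_left d e) ha)
      (pow_le_pow_right₀ h (le_max_right d e) hb)⟩
  algebraMap_mem' c := ⟨0, by rw [pow_zero]; exact Submodule.mem_one.2 ⟨c, rfl⟩⟩
  star_mem' := by
    rintro a ⟨d, ha⟩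
    exact ⟨d, star_mem_pow (star_mem_graphGen r) d a ha⟩

theorem IsPrincipal.exists_hom (hγ : γ.IsPrincipal) (hr : r.IsCovariant) :
    ∃ f : A →⋆ₐ[ℂ] D, (∀ x : γ.spectral 1, f x = r.t x) ∧ ∀ b : γ.fixed, f b = r.π b := by
  let T : StarSubalgebra ℂ (PairAlg A D) :=
    (graphAlg r (hγ.isGradedTriple r hr).one_le_sup).topologicalClosure
  have hTc : IsClosed (T : Set (PairAlg A D)) := StarSubalgebra.isClosed_topologicalClosure _
  have hT : ∀ s ∈ T, ‖s.2‖ ≤ ‖s.1‖ := fun s hs => by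
    refine closure_minimal (t := {s : PairAlg A D | ‖s.2‖ ≤ ‖s.1‖}) ?_
      (isClosed_le continuous_snd.norm continuous_fst.norm) hs
    rintro s ⟨d, hs⟩
    exact hγ.norm_snd_le r hr d hs
  have hgen : ∀ s ∈ graphGen r, s ∈ T := fun s hs =>
    StarSubalgebra.le_topologicalClosure _ ⟨1, by rwa [pow_one]⟩
  have h0 : ∀ b : γ.fixed, ((b : A), r.π b) ∈ T := fun b =>
    hgen _ (Submodule.mem_sup_left (Submodule.mem_sup_right ⟨b, rfl⟩))
  have h1 : ∀ x : γ.spectral 1, ((x : A), r.t x) ∈ T := fun x =>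
    hgen _ (Submodule.mem_sup_right ⟨x, rfl⟩)
  let F : T →⋆ₐ[ℂ] A := (StarAlgHom.fst ℂ A D).comp T.subtype
  have hFn : ∀ s, ‖F s‖ = ‖s‖ := fun s => (max_eq_left (hT s s.2)).symm
  have hFi : Isometry F := AddMonoidHomClass.isometry_of_norm F hFn
  have : CompleteSpace T := hTc.completeSpace_coe
  have hrange : F.range = ⊤ := by
    refine hγ.eq_top _ ?_ (fun a ha => ⟨⟨_, h0 ⟨a, ha⟩⟩, rfl⟩) fun a ha => ⟨⟨_, h1 ⟨a, ha⟩⟩, rfl⟩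
    have := hFi.isClosedEmbedding.isClosed_range
    exact this
  have hbij : Function.Bijective F := by
    refine ⟨hFi.injective, fun a => ?_⟩
    have : a ∈ F.range := hrange ▸ trivial
    exact this
  let e : T ≃⋆ₐ[ℂ] A := StarAlgEquiv.ofBijective F hbij
  let g : T →⋆ₐ[ℂ] D := (StarAlgHom.snd ℂ A D).comp T.subtype
  have he : ∀ s : T, e.symm s.1.1 = s := fun s => e.symm_apply_apply s
  refine ⟨g.comp (e.symm : A →⋆ₐ[ℂ] T), fun x => ?_, fun b => ?_⟩
  · exact congrArg g (he ⟨_, h1 x⟩)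
  · exact congrArg g (he ⟨_, h0 b⟩)

theorem IsPrincipal.isPimsnerAlgebra (hγ : γ.IsPrincipal) : γ.inclusion.IsPimsnerAlgebra := by
  refine ⟨hγ.isCovariant_inclusion, fun D' _ r hr => ?_⟩
  obtain ⟨f, hf1, hf0⟩ := hγ.exists_hom r hr
  refine ⟨f, ⟨hf1, hf0⟩, fun g hg => hγ.starAlgHom_ext (fun a ha => ?_) fun a ha => ?_⟩
  · exact (hg.2 ⟨a, ha⟩).trans (hf0 ⟨a, ha⟩).symm
  · exact (hg.1 ⟨a, ha⟩).trans (hf1 ⟨a, ha⟩).symm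

theorem isGaugeAction_inclusion : γ.IsGaugeAction γ.inclusion := fun z =>
  ⟨fun b => (γ.mem_spectral.1 b.2 z).trans (by rw [zpow_zero, one_smul]; rfl),
    fun x => (γ.mem_spectral.1 x.2 z).trans (by rw [zpow_one]; rfl)⟩

end CircleAction

section Dilation

variable {A B : Type u} [CStarAlgebra A] [CStarAlgebra B]

/-- `P : A → B` is a conditional expectation for the `⋆`-homomorphism `i : B → A`. -/
structure IsCondExp (i : B →⋆ₐ[ℂ] A) (P : A →L[ℂ] B) : Prop where
  apply_mul (a : A) (b : B) : P (a * i b) = P a * b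
  apply_star (a : A) : P (star a) = star (P a)
  isPos (a : A) : IsPos (P (star a * a))
  apply_one : P 1 = 1

namespace IsCondExp

variable {i : B →⋆ₐ[ℂ] A} {P : A →L[ℂ] B} (hP : IsCondExp i P)

include hP

theorem apply_hom_mul (a : A) (b : B) : P (i b * a) = b * P a := by
  rw [← star_star (i b * a), star_mul, ← map_star i, hP.apply_star, hP.apply_mul,
    hP.apply_star, star_mul, star_star, star_star]

theorem apply_hom (b : B) : P (i b) = b := by
  rw [← one_mul (i b), hP.apply_mul, hP.apply_one, one_mul]

theorem exists_gram {n : Type} [Fintype n] [DecidableEq n] (a : n → A) :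
    ∃ s : n → n → B, ∀ k l, P (star (a k) * a l) = ∑ j, star (s j k) * s j l := by
  refine _root_.exists_gram (fun k l => P (star (a k) * a l)) (fun k l => ?_) fun b => ?_
  · rw [← hP.apply_star, star_mul, star_star]
  · convert hP.isPos (∑ k, a k * i (b k)) using 1
    simp only [star_sum, Finset.sum_mul, Finset.mul_sum, map_sum]
    rw [Finset.sum_comm]
    refine Finset.sum_congr rfl fun l _ => Finset.sum_congr rfl fun k _ => ?_
    rw [star_mul, ← map_star i, mul_assoc (i (star (b k))), hP.apply_hom_mul,
      ← mul_assoc (star (a k)), hP.apply_mul, mul_assoc]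

end IsCondExp

/-- Finitely supported functions from `A` to the Hilbert space of a representation of `B`,
as a carrier of the pre-inner product that a conditional expectation `A → B` defines. -/
def DilationSpace (A : Type u) [CStarAlgebra A] (π : HilbertRep B) : Type u := A →₀ π.H

namespace DilationSpace

variable {i : B →⋆ₐ[ℂ] A} {P : A →L[ℂ] B} {π : HilbertRep B}

noncomputable instance : AddCommGroup (DilationSpace A π) := inferInstanceAs (AddCommGroup (A →₀ π.H))
noncomputable instance : Module ℂ (DilationSpace A π) := inferInstanceAs (Module ℂ (A →₀ π.H))

/-- The elementary vector `a ⊗ h`. -/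
noncomputable def single (π : HilbertRep B) (a : A) : π.H →ₗ[ℂ] DilationSpace A π :=
  Finsupp.lsingle a

@[elab_as_elim]
theorem induction {p : DilationSpace A π → Prop} (f : DilationSpace A π)
    (hs : ∀ a h, p (single π a h)) (hadd : ∀ f g, p f → p g → p (f + g)) : p f :=
  Finsupp.induction_linear f ((single π (0 : A)).map_zero ▸ hs 0 0) (fun f g => hadd f g) hs

/-- The form `⟪a ⊗ h, a' ⊗ h'⟫ = ⟪h, π(P(a* a')) h'⟫`. -/
noncomputable def form (P : A →L[ℂ] B) (f g : DilationSpace A π) : ℂ :=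
  Finsupp.sum (M := π.H) f fun a h => Finsupp.sum (M := π.H) g fun a' h' =>
    inner ℂ h (π.rep (P (star a * a')) h')

theorem form_single (a a' : A) (h h' : π.H) :
    form P (single π a h) (single π a' h') = inner ℂ h (π.rep (P (star a * a')) h') := by
  unfold form single
  refine (Finsupp.sum_single_index ?_).trans (Finsupp.sum_single_index ?_)
  · simp only [inner_zero_left]; exact Finset.sum_const_zero
  · simp

theorem form_add_left (f g k : DilationSpace A π) :
    form P (f + g) k = form P f k + form P g k := by
  refine Finsupp.sum_add_index' (fun a => ?_) fun a h h' => ?_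
  · simp only [inner_zero_left]; exact Finset.sum_const_zero
  · simp only [inner_add_left]; exact Finsupp.sum_add

theorem form_add_right (f g k : DilationSpace A π) :
    form P f (g + k) = form P f g + form P f k := by
  refine Eq.trans ?_ Finsupp.sum_add
  refine Finsupp.sum_congr fun a _ => Finsupp.sum_add_index' (fun a' => ?_) fun a' h h' => ?_
  · simp
  · rw [map_add, inner_add_right]

theorem form_smul_left (c : ℂ) (f g : DilationSpace A π) :
    form P (c • f) g = star c * form P f g := by
  refine induction f (fun a h => ?_) fun f f' hf hf' => ?_
  · refine induction g (fun a' h' => ?_) fun g g' hg hg' => ?_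
    · rw [← map_smul, form_single, form_single, inner_smul_left]; rfl
    · rw [form_add_right, form_add_right, hg, hg', mul_add]
  · rw [smul_add, form_add_left, form_add_left, hf, hf', mul_add]

theorem star_form (hP : IsCondExp i P) (f g : DilationSpace A π) :
    star (form P f g) = form P g f := by
  refine induction f (fun a h => ?_) fun f f' hf hf' => ?_
  · refine induction g (fun a' h' => ?_) fun g g' hg hg' => ?_
    · rw [form_single, form_single]
      have h1 : P (star a' * a) = star (P (star a * a')) := by
        rw [← hP.apply_star, star_mul, star_star]
      rw [h1, map_star, ContinuousLinearMap.star_eq_adjoint,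
        ContinuousLinearMap.adjoint_inner_right]
      exact inner_conj_symm _ _
    · rw [form_add_right, form_add_left, star_add, hg, hg']
  · rw [form_add_left, form_add_right, star_add, hf, hf']

theorem exists_sum (f : DilationSpace A π) : ∃ (n : ℕ) (a : Fin n → A) (h : Fin n → π.H),
    f = ∑ k, single π (a k) (h k) := by
  refine induction f (fun a h => ⟨1, fun _ => a, fun _ => h, by simp⟩) ?_
  rintro f g ⟨n, a, h, rfl⟩ ⟨m, a', h', rfl⟩
  exact ⟨n + m, Fin.append a a', Fin.append h h', by simp [Fin.sum_univ_add]⟩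

theorem form_sum {n : ℕ} (a : Fin n → A) (h : Fin n → π.H) :
    form P (∑ k, single π (a k) (h k)) (∑ k, single π (a k) (h k))
      = ∑ k, ∑ l, inner ℂ (h k) (π.rep (P (star (a k) * a l)) (h l)) := by
  let φ : DilationSpace A π →+ DilationSpace A π →+ ℂ :=
    AddMonoidHom.mk' (fun f => AddMonoidHom.mk' (form P f) (form_add_right f)) fun f g =>
      AddMonoidHom.ext fun k => form_add_left f g k
  change φ _ _ = _
  simp only [map_sum, AddMonoidHom.finsetSum_apply]
  refine Finset.sum_comm.trans (Finset.sum_congr rfl fun k _ => Finset.sum_congr rfl fun l _ => ?_)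
  exact form_single _ _ _ _

theorem form_self_nonneg (hP : IsCondExp i P) (f : DilationSpace A π) :
    0 ≤ (form P f f).re := by
  obtain ⟨n, a, h, rfl⟩ := exists_sum f
  obtain ⟨s, hs⟩ := hP.exists_gram a
  have : form P (∑ k, single π (a k) (h k)) (∑ k, single π (a k) (h k))
      = ∑ j, inner ℂ (∑ k, π.rep (s j k) (h k)) (∑ k, π.rep (s j k) (h k)) := by
    rw [form_sum]
    simp only [hs, map_sum, sum_inner, inner_sum, sum_apply, map_mul, map_star]
    simp only [mul_apply_eq_comp, ContinuousLinearMap.star_eq_adjoint,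
      ContinuousLinearMap.adjoint_inner_right]
    rw [Finset.sum_comm_cycle]
    exact Finset.sum_congr rfl fun j _ => Finset.sum_comm
  rw [this, Complex.re_sum]
  exact Finset.sum_nonneg fun j _ => inner_self_nonneg (𝕜 := ℂ)

/-- Left multiplication by `a` in the first variable. -/
noncomputable def lmul (π : HilbertRep B) (a : A) : DilationSpace A π →ₗ[ℂ] DilationSpace A π :=
  Finsupp.lmapDomain π.H ℂ (a * ·)

theorem lmul_single (a x : A) (h : π.H) : lmul π a (single π x h) = single π (a * x) h :=
  Finsupp.mapDomain_single

theorem lmul_one (f : DilationSpace A π) : lmul π 1 f = f := by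
  induction f using DilationSpace.induction with
  | hs x h => rw [lmul_single, one_mul]
  | hadd f g hf hg => rw [map_add, hf, hg]

theorem lmul_mul (a b : A) (f : DilationSpace A π) : lmul π (a * b) f = lmul π a (lmul π b f) := by
  induction f using DilationSpace.induction with
  | hs x h => rw [lmul_single, lmul_single, lmul_single, mul_assoc]
  | hadd f g hf hg => rw [map_add, map_add, map_add, hf, hg]

theorem form_lmul_left (a : A) (f g : DilationSpace A π) :
    form P (lmul π a f) g = form P f (lmul π (star a) g) := by
  induction f using DilationSpace.induction with
  | hs x h =>
    induction g using DilationSpace.induction with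
    | hs y k => rw [lmul_single, lmul_single, form_single, form_single, star_mul, mul_assoc]
    | hadd g g' hg hg' => rw [map_add, form_add_right, form_add_right, hg, hg']
  | hadd f f' hf hf' => rw [map_add, form_add_left, form_add_left, hf, hf']

theorem form_lmul_add (a b : A) (f g : DilationSpace A π) :
    form P f (lmul π (a + b) g) = form P f (lmul π a g + lmul π b g) := by
  rw [form_add_right]
  induction f using DilationSpace.induction with
  | hs x h =>
    induction g using DilationSpace.induction with
    | hs y k =>
      simp only [lmul_single, form_single, add_mul, mul_add, map_add, inner_add_right, add_apply]
    | hadd g g' hg hg' =>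
      simp only [map_add, form_add_right, hg, hg']; ring
  | hadd f f' hf hf' => simp only [form_add_left, hf, hf']; ring

theorem form_smul_right (c : ℂ) (f g : DilationSpace A π) :
    form P f (c • g) = c * form P f g := by
  induction f using DilationSpace.induction with
  | hs x h =>
    induction g using DilationSpace.induction with
    | hs y k => rw [← map_smul, form_single, form_single, map_smul, inner_smul_right]
    | hadd g g' hg hg' => simp only [smul_add, form_add_right, hg, hg', mul_add]
  | hadd f f' hf hf' => simp only [form_add_left, hf, hf', mul_add]

theorem form_lmul_smul (c : ℂ) (a : A) (f g : DilationSpace A π) :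
    form P f (lmul π (c • a) g) = form P f (c • lmul π a g) := by
  rw [form_smul_right]
  induction f using DilationSpace.induction with
  | hs x h =>
    induction g using DilationSpace.induction with
    | hs y k =>
      simp only [lmul_single, form_single, smul_mul_assoc, mul_smul_comm, map_smul,
        inner_smul_right, smul_apply]
    | hadd g g' hg hg' => simp only [map_add, form_add_right, hg, hg', mul_add]
  | hadd f f' hf hf' => simp only [form_add_left, hf, hf', mul_add]

theorem re_form_lmul_le (hP : IsCondExp i P) (a : A) (f : DilationSpace A π) :
    (form P (lmul π a f) (lmul π a f)).re ≤ ‖a‖ ^ 2 * (form P f f).re := by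
  obtain ⟨c, hc⟩ : IsPos (((‖a‖ ^ 2 : ℝ) : ℂ) • (1 : A) + (-1 : ℂ) • (star a * a)) := by
    let _ := CStarAlgebra.spectralOrder A
    have _ := CStarAlgebra.spectralOrderedRing A
    rw [isPos_iff_nonneg, neg_one_smul, ← sub_eq_add_neg, sub_nonneg]
    refine CStarAlgebra.star_mul_le_algebraMap_norm_sq.trans (le_of_eq ?_)
    rw [Algebra.algebraMap_eq_smul_one, Complex.coe_smul]
  have h := form_self_nonneg hP (lmul π c f)
  rw [form_lmul_left, ← lmul_mul, ← hc, form_lmul_add, form_add_right, form_lmul_smul,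
    form_lmul_smul, form_smul_right, form_smul_right, lmul_one, lmul_mul, ← form_lmul_left,
    Complex.add_re, Complex.re_ofReal_mul, neg_one_mul, Complex.neg_re] at h
  linarith

end DilationSpace

/-- The pre-Hilbert space of the dilation of `π ∘ P`. -/
def PreDilation {i : B →⋆ₐ[ℂ] A} {P : A →L[ℂ] B} (_hP : IsCondExp i P) (π : HilbertRep B) :
    Type u := DilationSpace A π

namespace PreDilation

open UniformSpace DilationSpace

variable {i : B →⋆ₐ[ℂ] A} {P : A →L[ℂ] B} (hP : IsCondExp i P) (π : HilbertRep B)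

noncomputable instance : AddCommGroup (PreDilation hP π) :=
  inferInstanceAs (AddCommGroup (DilationSpace A π))
noncomputable instance : Module ℂ (PreDilation hP π) :=
  inferInstanceAs (Module ℂ (DilationSpace A π))

/-- The pre-inner product of the dilation. -/
noncomputable abbrev core : PreInnerProductSpace.Core ℂ (PreDilation hP π) where
  inner f g := form P f g
  conj_inner_symm f g := star_form hP g f
  re_inner_nonneg f := form_self_nonneg hP f
  add_left f g k := form_add_left f g k
  smul_left f g c := form_smul_left c f g

noncomputable instance : SeminormedAddCommGroup (PreDilation hP π) :=
  @InnerProductSpace.Core.toSeminormedAddCommGroup ℂ _ _ _ _ (core hP π)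

noncomputable instance : InnerProductSpace ℂ (PreDilation hP π) :=
  InnerProductSpace.ofCore (core hP π)

theorem inner_eq (f g : PreDilation hP π) : inner ℂ f g = form P f g := rfl

theorem norm_sq_eq (f : PreDilation hP π) : ‖f‖ ^ 2 = (form P f f).re := by
  exact norm_sq_eq_re_inner (𝕜 := ℂ) f

theorem coe_eq_coe {f g : PreDilation hP π} (h : ∀ k : PreDilation hP π, form P k f = form P k g) :
    (f : Completion (PreDilation hP π)) = g := by
  rw [← sub_eq_zero, ← Completion.coe_sub, ← norm_eq_zero, Completion.norm_coe,
    ← sq_eq_zero_iff, norm_sq_eq_re_inner (𝕜 := ℂ), inner_sub_right, inner_eq, inner_eq, h,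
    sub_self, map_zero]

/-- Left multiplication as a bounded operator. -/
noncomputable def mulL (a : A) : PreDilation hP π →L[ℂ] PreDilation hP π :=
  LinearMap.mkContinuous (lmul π a : DilationSpace A π →ₗ[ℂ] DilationSpace A π) ‖a‖ fun f => by
    refine abs_le_of_sq_le_sq' ?_ (by positivity) |>.2
    rw [mul_pow, norm_sq_eq]
    exact (re_form_lmul_le hP a f).trans_eq (congrArg _ (norm_sq_eq hP π f).symm)

theorem mulL_apply (a : A) (f : PreDilation hP π) : mulL hP π a f = lmul π a f := rfl

theorem clm_ext {S T : Completion (PreDilation hP π) →L[ℂ] Completion (PreDilation hP π)}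
    (h : ∀ f : PreDilation hP π, S f = T f) : S = T := by
  ext x
  exact Completion.denseRange_coe.induction_on x (isClosed_eq S.continuous T.continuous) h

theorem completion_coe (a : A) (f : PreDilation hP π) :
    (mulL hP π a).completion (f : Completion (PreDilation hP π)) = (mulL hP π a f : PreDilation hP π) :=
  ContinuousLinearMap.completion_apply_coe _ _

/-- The dilation of `π ∘ P` to a representation of `A`. -/
noncomputable def rep : HilbertRep A where
  H := Completion (PreDilation hP π)
  rep :=
    { AlgHom.ofLinearMap
        { toFun := fun a => (mulL hP π a).completion
          map_add' := fun a b => clm_ext hP π fun f => by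
            rw [add_apply, completion_coe, completion_coe, completion_coe, ← Completion.coe_add]
            exact coe_eq_coe hP π fun k => form_lmul_add a b k f
          map_smul' := fun c a => clm_ext hP π fun f => by
            rw [smul_apply, completion_coe, completion_coe, RingHom.id_apply, ← Completion.coe_smul]
            exact coe_eq_coe hP π fun k => form_lmul_smul c a k f }
        (clm_ext hP π fun f => (completion_coe hP π 1 f).trans (congrArg _ (lmul_one f)))
        (fun a b => clm_ext hP π fun f => by
          change (mulL hP π (a * b)).completion _
            = (mulL hP π a).completion ((mulL hP π b).completion _)
          rw [completion_coe, completion_coe, completion_coe]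
          exact congrArg _ (lmul_mul a b f)) with
      map_star' := fun a => by
        change (mulL hP π (star a)).completion = star (mulL hP π a).completion
        refine (ContinuousLinearMap.eq_adjoint_iff _ _).mpr fun x y => ?_
        refine Completion.denseRange_coe.induction_on₂ ?_ (fun f g => ?_) x y
        · exact isClosed_eq (((mulL hP π (star a)).completion.continuous.comp continuous_fst).inner
            continuous_snd) (continuous_fst.inner ((mulL hP π a).completion.continuous.comp
              continuous_snd))
        · rw [completion_coe, completion_coe, Completion.inner_coe, Completion.inner_coe, inner_eq,
            inner_eq]
          exact (form_lmul_left (star a) f g).trans (by rw [star_star]; rfl) }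

theorem rep_coe (a : A) (f : PreDilation hP π) :
    (rep hP π).rep a (f : Completion (PreDilation hP π))
      = ((mulL hP π a f : PreDilation hP π) : Completion (PreDilation hP π)) :=
  completion_coe hP π a f

/-- The isometry of the dilation. -/
noncomputable def embed : π.H →ₗᵢ[ℂ] (rep hP π).H where
  toLinearMap := (Completion.toComplₗᵢ (𝕜 := ℂ) (E := PreDilation hP π)).toLinearMap ∘ₗ
    (single π (1 : A) : π.H →ₗ[ℂ] DilationSpace A π)
  norm_map' h := by
    refine (Completion.norm_coe (E := PreDilation hP π) _).trans ?_
    rw [← sq_eq_sq₀ (norm_nonneg _) (norm_nonneg _), norm_sq_eq]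
    refine (congrArg Complex.re (form_single (P := P) (1 : A) 1 h h)).trans ?_
    rw [star_one, one_mul, hP.apply_one, map_one, norm_sq_eq_re_inner (𝕜 := ℂ)]
    rfl

theorem inner_embed (a : A) (h h' : π.H) :
    inner ℂ (embed hP π h) ((rep hP π).rep a (embed hP π h')) = inner ℂ h (π.rep (P a) h') := by
  let e : PreDilation hP π := single π (1 : A) h'
  change inner ℂ (embed hP π h) ((rep hP π).rep a (e : Completion (PreDilation hP π))) = _
  rw [rep_coe]
  refine (Completion.inner_coe (E := PreDilation hP π) _ _).trans ?_
  rw [inner_eq, mulL_apply]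
  refine (congrArg (form P _) (lmul_single a 1 h')).trans ?_
  refine (form_single (P := P) (1 : A) (a * 1) h h').trans ?_
  rw [star_one, one_mul, mul_one]

end PreDilation

end Dilation

section TensorCondExp

variable {A B C : Type u} [CStarAlgebra A] [CStarAlgebra B] [CStarAlgebra C]
  {i : B →⋆ₐ[ℂ] A} {P : A →L[ℂ] B}

namespace MinTensor

theorem of_tmul (a : A) (c : C) : MinTensor.of (a ⊗ₜ[ℂ] c) = MinTensor.tmul a c := rfl

theorem exists_sum (x : A ⊗[ℂ] C) : ∃ (n : ℕ) (a : Fin n → A) (c : Fin n → C),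
    x = ∑ k, a k ⊗ₜ[ℂ] c k := by
  induction x with
  | zero => exact ⟨0, 0, 0, by simp⟩
  | tmul x c => exact ⟨1, fun _ => x, fun _ => c, by simp⟩
  | add x y hx hy =>
    obtain ⟨n, e, c, rfl⟩ := hx
    obtain ⟨m, e', c', rfl⟩ := hy
    exact ⟨n + m, Fin.append e e', Fin.append c c', by simp [Fin.sum_univ_add]⟩

end MinTensor

theorem AlgTensor.map_tmul {A' C' : Type u} [CStarAlgebra A'] [CStarAlgebra C'] (f : A →⋆ₐ[ℂ] A')
    (g : C →⋆ₐ[ℂ] C') (a : A) (c : C) : AlgTensor.map f g (a ⊗ₜ c) = f a ⊗ₜ g c := rfl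

namespace IsCondExp

variable (C) in
/-- The map `P ⊙ id` on algebraic tensor products. -/
noncomputable def algTensor (P : A →L[ℂ] B) : A ⊗[ℂ] C →ₗ[ℂ] B ⊗[ℂ] C :=
  TensorProduct.map P.toLinearMap LinearMap.id

theorem algTensor_tmul (a : A) (c : C) : algTensor C P (a ⊗ₜ c) = P a ⊗ₜ c := rfl

theorem inner_prod_algTensor (hP : IsCondExp i P) (π : HilbertRep B) (σ : HilbertRep C)
    (x : A ⊗[ℂ] C) (v w : π.H ⊗[ℂ] σ.H) :
    inner ℂ (HilbertTensor.of w) (π.prod σ (algTensor C P x) (HilbertTensor.of v))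
      = inner ℂ (HilbertTensor.of (TensorProduct.map (PreDilation.embed hP π).toLinearMap
            LinearMap.id w))
          ((PreDilation.rep hP π).prod σ x (HilbertTensor.of
            (TensorProduct.map (PreDilation.embed hP π).toLinearMap LinearMap.id v))) := by
  induction x with
  | zero => simp
  | add x y hx hy => simp only [map_add, add_apply, inner_add_right, hx, hy]
  | tmul a c =>
    induction v with
    | zero => simp
    | add v v' h h' => simp only [map_add, inner_add_right, h, h']
    | tmul h k =>
      induction w with
      | zero => simp
      | add w w' h h' => simp only [map_add, inner_add_left, h, h']
      | tmul h' k' =>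
        rw [algTensor_tmul, HilbertRep.prod_tmul, HilbertRep.prod_tmul, HilbertTensor.map_of,
          TensorProduct.map_tmul, TensorProduct.map_tmul, TensorProduct.map_tmul,
          HilbertTensor.map_of, TensorProduct.map_tmul, HilbertTensor.inner_of,
          HilbertTensor.inner_of, TensorProduct.inner_tmul, TensorProduct.inner_tmul]
        exact congrArg (· * _) (PreDilation.inner_embed hP π a h' h).symm

theorem norm_prod_algTensor_le (hP : IsCondExp i P) (π : HilbertRep B) (σ : HilbertRep C)
    (x : A ⊗[ℂ] C) :
    ‖π.prod σ (algTensor C P x)‖ ≤ ‖(PreDilation.rep hP π).prod σ x‖ := by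
  set T := π.prod σ (algTensor C P x)
  set S := (PreDilation.rep hP π).prod σ x
  have hV : ∀ v : π.H ⊗[ℂ] σ.H, ‖HilbertTensor.of (TensorProduct.map
      (PreDilation.embed hP π).toLinearMap LinearMap.id v)‖ = ‖HilbertTensor.of v‖ := fun v => by
    have h1 : ‖TensorProduct.map (PreDilation.embed hP π).toLinearMap
        (LinearIsometry.id (R := ℂ) (E := σ.H)).toLinearMap v‖ = ‖v‖ :=
      TensorProduct.norm_map (PreDilation.embed hP π) LinearIsometry.id v
    exact (UniformSpace.Completion.norm_coe _).trans
      (h1.trans (UniformSpace.Completion.norm_coe v).symm)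
  have key : ∀ x y, ‖inner ℂ y (T x)‖ ≤ ‖S‖ * ‖x‖ * ‖y‖ := by
    intro x y
    refine HilbertTensor.denseRange_of.induction_on₂ ?_ (fun v w => ?_) x y
    · exact isClosed_le (continuous_snd.inner (T.continuous.comp continuous_fst)).norm
        ((continuous_const.mul continuous_fst.norm).mul continuous_snd.norm)
    · rw [hP.inner_prod_algTensor, ← hV v, ← hV w]
      refine (norm_inner_le_norm _ _).trans ?_
      rw [mul_comm]
      exact mul_le_mul_of_nonneg_right (S.le_opNorm _) (norm_nonneg _)
  refine T.opNorm_le_bound (norm_nonneg _) fun x => ?_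
  rcases (norm_nonneg (T x)).eq_or_lt with h0 | h0
  · rw [← h0]; positivity
  · refine le_of_mul_le_mul_right ?_ h0
    refine le_trans (le_of_eq ?_) (key x (T x))
    rw [inner_self_eq_norm_sq_to_K, norm_pow, RCLike.norm_ofReal, abs_norm, sq]

theorem norm_of_algTensor_le (hP : IsCondExp i P) (x : A ⊗[ℂ] C) :
    ‖MinTensor.of (algTensor C P x)‖ ≤ ‖MinTensor.of x‖ := by
  rw [MinTensor.norm_of]
  refine Real.iSup_le (fun p => ?_) (norm_nonneg _)
  refine (hP.norm_prod_algTensor_le p.1 p.2 x).trans ?_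
  rw [MinTensor.norm_of]
  exact AlgTensor.norm_prod_le (PreDilation.rep hP p.1) p.2 x

variable (C) in
/-- The map `P ⊗ id` on minimal tensor products, for a conditional expectation `P`. -/
noncomputable def tensor (P : A →L[ℂ] B) : MinTensor A C →L[ℂ] MinTensor B C :=
  LinearMap.extendOfNorm ((MinTensor.of (A := B) (B := C)).toAlgHom.toLinearMap ∘ₗ algTensor C P)
    (MinTensor.of (A := A) (B := C)).toAlgHom.toLinearMap

theorem tensor_of (hP : IsCondExp i P) (x : A ⊗[ℂ] C) :
    tensor C P (MinTensor.of x) = MinTensor.of (algTensor C P x) :=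
  LinearMap.extendOfNorm_eq (f := (MinTensor.of (A := B) (B := C)).toAlgHom.toLinearMap ∘ₗ
    algTensor C P) (e := (MinTensor.of (A := A) (B := C)).toAlgHom.toLinearMap)
    MinTensor.denseRange_of ⟨1, fun x => by
      rw [one_mul]; exact hP.norm_of_algTensor_le x⟩ x

theorem isCondExp_tensor (hP : IsCondExp i P) :
    IsCondExp (MinTensor.map i (StarAlgHom.id ℂ C)) (tensor C P) where
  apply_mul x y := by
    have hc := StarAlgHom.continuous_cstar (MinTensor.map i (StarAlgHom.id ℂ C))
    refine MinTensor.denseRange_of.induction_on x (isClosed_eq (by fun_prop) (by fun_prop))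
      fun x => ?_
    refine MinTensor.denseRange_of.induction_on y (isClosed_eq (by fun_prop) (by fun_prop))
      fun y => ?_
    rw [MinTensor.map_of, ← map_mul, hP.tensor_of, hP.tensor_of, ← map_mul]
    congr 1
    induction x with
    | zero => simp
    | add x x' h h' => simp only [add_mul, map_add, h, h']
    | tmul a c =>
      induction y with
      | zero => simp
      | add y y' h h' => simp only [mul_add, map_add, h, h']
      | tmul b d =>
        rw [AlgTensor.map_tmul, Algebra.TensorProduct.tmul_mul_tmul, algTensor_tmul,
          algTensor_tmul, Algebra.TensorProduct.tmul_mul_tmul, hP.apply_mul]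
        rfl
  apply_star x := by
    refine MinTensor.denseRange_of.induction_on x (isClosed_eq (by fun_prop) (by fun_prop))
      fun x => ?_
    rw [← map_star, hP.tensor_of, hP.tensor_of, ← map_star]
    congr 1
    induction x with
    | zero => simp
    | add x x' h h' => simp only [star_add, map_add, h, h']
    | tmul a c =>
      rw [TensorProduct.star_tmul, algTensor_tmul, algTensor_tmul, TensorProduct.star_tmul,
        hP.apply_star]
  isPos x := by
    refine MinTensor.denseRange_of.induction_on x
      (isClosed_isPos.preimage (f := fun x => tensor C P (star x * x)) (by fun_prop)) fun x => ?_
    obtain ⟨n, a, c, rfl⟩ := MinTensor.exists_sum x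
    obtain ⟨s, hs⟩ := hP.exists_gram a
    have h : algTensor C P (star (∑ k, a k ⊗ₜ[ℂ] c k) * ∑ k, a k ⊗ₜ[ℂ] c k)
        = ∑ j, star (∑ k, s j k ⊗ₜ[ℂ] c k) * ∑ k, s j k ⊗ₜ[ℂ] c k := by
      simp only [map_sum, star_sum, TensorProduct.star_tmul,
        Finset.sum_mul, Finset.mul_sum, Algebra.TensorProduct.tmul_mul_tmul, algTensor_tmul, hs,
        TensorProduct.sum_tmul]
      rw [Finset.sum_comm_cycle]
    rw [← map_star, ← map_mul, hP.tensor_of, h, map_sum]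
    exact IsPos.sum _ fun k _ => ⟨MinTensor.of (∑ i, s k i ⊗ₜ[ℂ] c i), by rw [map_mul, map_star]⟩
  apply_one := by
    rw [← map_one (MinTensor.of (A := A) (B := C)), hP.tensor_of,
      Algebra.TensorProduct.one_def, algTensor_tmul, hP.apply_one]
    exact map_one (MinTensor.of (A := B) (B := C))

theorem norm_hom (hP : IsCondExp i P) (b : B) : ‖i b‖ = ‖b‖ :=
  NonUnitalStarAlgHom.norm_map i (Function.LeftInverse.injective hP.apply_hom) b

end IsCondExp

end TensorCondExp

namespace CircleAction

variable {A : Type u} [CStarAlgebra A] (γ : CircleAction A)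

theorem isPos_of_coe {b : γ.fixed} (hb : IsPos (b : A)) : IsPos b := by
  let _ := CStarAlgebra.spectralOrder A
  have _ := CStarAlgebra.spectralOrderedRing A
  have h0 : 0 ≤ (b : A) := (isPos_iff_nonneg _).1 hb
  have hc : CFC.sqrt (b : A) ∈ γ.fixed := fun z => by
    rw [zpow_zero, one_smul]
    refine (CFC.sqrt_unique ?_ ?_).symm
    · rw [← _root_.map_mul, CFC.sqrt_mul_sqrt_self _ h0]
      simpa using b.2 z
    · refine (isPos_iff_nonneg _).1 (IsPos.map ?_ (γ.act z))
      exact (isPos_iff_nonneg _).2 (CFC.sqrt_nonneg _)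
  refine ⟨⟨_, hc⟩, Subtype.ext ?_⟩
  have hs : star (CFC.sqrt (b : A)) = CFC.sqrt (b : A) :=
    (CFC.sqrt_nonneg (b : A)).isSelfAdjoint.star_eq
  change _ = star (CFC.sqrt (b : A)) * CFC.sqrt (b : A)
  rw [hs, CFC.sqrt_mul_sqrt_self _ h0]

/-- The conditional expectation of `A` onto `A(0)`. -/
noncomputable def condExp : A →L[ℂ] γ.fixed :=
  LinearMap.mkContinuous
    { toFun := fun a => ⟨γ.proj 0 a, (γ.proj 0 a).2⟩
      map_add' := fun a b => Subtype.ext (congrArg Subtype.val (map_add (γ.proj 0) a b))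
      map_smul' := fun c a => Subtype.ext (congrArg Subtype.val (map_smul (γ.proj 0) c a)) } 1
    fun a => by rw [one_mul]; exact γ.norm_proj_le 0 a

theorem coe_condExp (a : A) : (γ.condExp a : A) = circleCoeff 0 (fun z => γ.act z a) := rfl

theorem convex_isPos : Convex ℝ {d : A | IsPos d} := by
  let _ := CStarAlgebra.spectralOrder A
  have _ := CStarAlgebra.spectralOrderedRing A
  intro x hx y hy s t hs ht _
  simp only [Set.mem_ofPred_eq, isPos_iff_nonneg] at *
  exact add_nonneg (smul_nonneg hs hx) (smul_nonneg ht hy)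

theorem isCondExp_condExp : IsCondExp γ.fixed.subtype γ.condExp where
  apply_mul a b := Subtype.ext (by
    change _ = (γ.condExp a : A) * b
    rw [coe_condExp, coe_condExp]
    have h : ∀ z, γ.act z (a * γ.fixed.subtype b)
        = (ContinuousLinearMap.mul ℂ A).flip (b : A) (γ.act z a) := fun z => by
      have := γ.mem_spectral.1 b.2 z
      rw [zpow_zero, one_smul] at this
      rw [_root_.map_mul]
      exact congrArg (γ.act z a * ·) this
    simp only [h]
    exact circleCoeff_clm 0 ((ContinuousLinearMap.mul ℂ A).flip (b : A)) (γ.continuous a))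
  apply_star a := Subtype.ext (by
    change _ = star (γ.condExp a : A)
    rw [coe_condExp, coe_condExp]
    simp only [circleCoeff, neg_zero, zpow_zero, one_smul, map_star]
    exact ((starL' ℝ : A ≃L[ℝ] A) : A →L[ℝ] A).integral_comp_comm (by
      simpa using integrable_circleCoeff 0 (γ.continuous a)))
  isPos a := by
    refine γ.isPos_of_coe ?_
    rw [coe_condExp]
    refine convex_isPos.integral_mem isClosed_isPos (Filter.Eventually.of_forall fun t => ?_)
      (integrable_circleCoeff 0 (γ.continuous _))
    rw [neg_zero, zpow_zero, one_smul]
    exact IsPos.map ⟨a, rfl⟩ _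
  apply_one := Subtype.ext (γ.proj_of_mem (n := 0) γ.fixed.one_mem)

end CircleAction

section Averages

variable {X Y : Type*} [NormedAddCommGroup X] [NormedSpace ℂ X]
  [NormedAddCommGroup Y] [NormedSpace ℂ Y]

/-- `f` is continuous with `n`-th Fourier coefficient `x`. -/
structure HasCircleCoeff (n : ℤ) (f : Circle → X) (x : X) : Prop where
  continuous : Continuous f
  eq : circleCoeff n f = x

theorem HasCircleCoeff.add {n : ℤ} {f g : Circle → X} {x y : X} (hf : HasCircleCoeff n f x)
    (hg : HasCircleCoeff n g y) : HasCircleCoeff n (fun z => f z + g z) (x + y) :=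
  ⟨hf.continuous.add hg.continuous, by
    rw [circleCoeff_add n hf.continuous hg.continuous, hf.eq, hg.eq]⟩

theorem HasCircleCoeff.zero (n : ℤ) : HasCircleCoeff n (fun _ => (0 : X)) 0 :=
  ⟨continuous_const, circleCoeff_zero n⟩

theorem HasCircleCoeff.clm [CompleteSpace X] [CompleteSpace Y] {n : ℤ} {f : Circle → X} {x : X}
    (hf : HasCircleCoeff n f x) (L : X →L[ℂ] Y) : HasCircleCoeff n (fun z => L (f z)) (L x) :=
  ⟨L.continuous.comp hf.continuous, by rw [circleCoeff_clm n L hf.continuous, hf.eq]⟩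

theorem CircleAction.hasCircleCoeff {A : Type u} [CStarAlgebra A] (γ : CircleAction A) (n : ℤ)
    (a : A) : HasCircleCoeff n (fun z => γ.act z a) (γ.proj n a : A) :=
  ⟨γ.continuous a, rfl⟩

/-- An eigenvector of a family of contractions that is a limit of vectors in `S` is a limit of
averages of vectors in `S`. -/
theorem mem_closure_of_hasCircleCoeff [CompleteSpace X] {U : Circle → X →ₗ[ℂ] X}
    (hU : ∀ z x, ‖U z x‖ ≤ ‖x‖) {n : ℤ} {x : X} (hx : ∀ z : Circle, U z x = (z : ℂ) ^ n • x)
    {S S' : Set X} (hS : ∀ y ∈ S, ∃ y' ∈ S', HasCircleCoeff n (fun z => U z y) y')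
    (hxS : x ∈ closure S) : x ∈ closure S' := by
  rw [Metric.mem_closure_iff] at hxS ⊢
  intro ε hε
  obtain ⟨y, hy, hxy⟩ := hxS ε hε
  obtain ⟨y', hy', h⟩ := hS y hy
  refine ⟨y', hy', lt_of_le_of_lt ?_ hxy⟩
  rw [dist_comm, dist_comm x, dist_eq_norm, dist_eq_norm, ← h.eq]
  exact norm_circleCoeff_sub_le hU hx h.continuous

theorem Isometry.mem_closure_of_subset_image {X Y : Type*} [PseudoEMetricSpace X]
    [PseudoEMetricSpace Y] {f : X → Y} (hf : Isometry f) {S : Set X} {S' : Set Y}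
    (h : S' ⊆ f '' S) {x : X} (hx : f x ∈ closure S') : x ∈ closure S := by
  rw [hf.isUniformInducing.isInducing.closure_eq_preimage_closure_image]
  exact closure_mono h hx

end Averages

section TensorMaps

open MulOpposite HilbertModule

variable {A A' A'' B C C' C'' D : Type u} [CStarAlgebra A] [CStarAlgebra A'] [CStarAlgebra A'']
  [CStarAlgebra B] [CStarAlgebra C] [CStarAlgebra C'] [CStarAlgebra C''] [CStarAlgebra D]

namespace MinTensor

theorem map_tmul (f : A →⋆ₐ[ℂ] A') (g : C →⋆ₐ[ℂ] C') (a : A) (c : C) :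
    MinTensor.map f g (MinTensor.tmul a c) = MinTensor.tmul (f a) (g c) :=
  MinTensor.map_of f g (a ⊗ₜ c)

theorem map_map (f : A →⋆ₐ[ℂ] A') (g : C →⋆ₐ[ℂ] C') (f' : A' →⋆ₐ[ℂ] A'') (g' : C' →⋆ₐ[ℂ] C'')
    (x : MinTensor A C) :
    MinTensor.map f' g' (MinTensor.map f g x) = MinTensor.map (f'.comp f) (g'.comp g) x := by
  have h1 := StarAlgHom.continuous_cstar (MinTensor.map f g)
  have h2 := StarAlgHom.continuous_cstar (MinTensor.map f' g')
  have h3 := StarAlgHom.continuous_cstar (MinTensor.map (f'.comp f) (g'.comp g))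
  refine denseRange_of.induction_on x (isClosed_eq (by fun_prop) (by fun_prop)) fun x => ?_
  induction x with
  | zero => simp
  | add x y hx hy => simp only [map_add, hx, hy]
  | tmul a c => simp only [of_tmul, map_tmul]; rfl

theorem norm_tmul_le (a : A) (c : C) : ‖MinTensor.tmul a c‖ ≤ ‖a‖ * ‖c‖ := by
  refine (norm_of (a ⊗ₜ c)).trans_le ?_
  exact Real.iSup_le (fun p => p.1.norm_prod_tmul_le p.2 a c) (by positivity)

variable (A) in
/-- The map `a ↦ a ⊗ c`. -/
noncomputable def tmulRight (c : C) : A →L[ℂ] MinTensor A C :=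
  LinearMap.mkContinuous (of.toAlgHom.toLinearMap ∘ₗ (TensorProduct.mk ℂ A C).flip c) ‖c‖
    fun a => (norm_tmul_le a c).trans_eq (mul_comm _ _)

theorem tmulRight_apply (a : A) (c : C) : tmulRight A c a = tmul a c := rfl

end MinTensor

theorem StarAlgHom.exists_lift {f : A →⋆ₐ[ℂ] D} (hf : Function.Injective f) {g : B →⋆ₐ[ℂ] D}
    (hg : ∀ b, ∃ a, f a = g b) : ∃ h : B →⋆ₐ[ℂ] A, ∀ b, f (h b) = g b := by
  let e := StarAlgEquiv.ofInjective f hf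
  let g' : B →⋆ₐ[ℂ] f.range := g.codRestrict f.range hg
  refine ⟨(e.symm : f.range →⋆ₐ[ℂ] A).comp g', fun b => ?_⟩
  exact congrArg Subtype.val (e.apply_symm_apply (g' b))

theorem LinearMap.exists_lift {X Y Z : Type*} [AddCommGroup X] [Module ℂ X] [AddCommGroup Y]
    [Module ℂ Y] [AddCommGroup Z] [Module ℂ Z] {f : X →ₗ[ℂ] Z} (hf : Function.Injective f)
    {g : Y →ₗ[ℂ] Z} (hg : ∀ b, ∃ a, f a = g b) : ∃ h : Y →ₗ[ℂ] X, ∀ b, f (h b) = g b := by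
  let e := LinearEquiv.ofInjective f hf
  let g' : Y →ₗ[ℂ] LinearMap.range f := g.codRestrict _ hg
  refine ⟨e.symm.toLinearMap ∘ₗ g', fun b => ?_⟩
  exact congrArg Subtype.val (e.apply_symm_apply (g' b))

variable {E : Type u} [NormedAddCommGroup E] [NormedSpace ℂ E] [Module Bᵐᵒᵖ E] [HilbertModule B E]

namespace ExtTensor

variable {t : E →ₗ[ℂ] D} {π : B →⋆ₐ[ℂ] D} (h : ∀ x y, star (t x) * t y = π (ip x y))

theorem mapAlg_tmul (x : E) (c : C) : mapAlg t π h (tmul B x c) = MinTensor.tmul (t x) c :=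
  mapAlg_of t π h (x ⊗ₜ c)

theorem star_mapAlg_mul (x y : ExtTensor B E C) :
    star (mapAlg t π h x) * mapAlg t π h y = MinTensor.map π (StarAlgHom.id ℂ C) (ip x y) := by
  have h1 := StarAlgHom.continuous_cstar (MinTensor.map π (StarAlgHom.id ℂ C))
  rw [ip_eq]
  refine denseRange_of.induction_on₂ (isClosed_eq (by fun_prop) (by fun_prop)) (fun x y => ?_) x y
  rw [inn_of, mapAlg_of, mapAlg_of, MinTensor.map_of, ← map_star, ← map_mul]
  congr 1
  induction x with
  | zero => simp
  | add x x' h h' => simp only [map_add, star_add, add_mul, LinearMap.add_apply, h, h']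
  | tmul x c =>
    induction y with
    | zero => simp
    | add y y' h h' => simp only [map_add, mul_add, h, h']
    | tmul y d =>
      rw [TensorProduct.map_tmul, TensorProduct.map_tmul, AlgExt.ip_tmul,
        TensorProduct.star_tmul, Algebra.TensorProduct.tmul_mul_tmul, h]
      rfl

theorem norm_mapAlg (hπ : ∀ y, ‖MinTensor.map π (StarAlgHom.id ℂ C) y‖ = ‖y‖)
    (x : ExtTensor B E C) : ‖mapAlg t π h x‖ = ‖x‖ := by
  refine (sq_eq_sq₀ (norm_nonneg _) (norm_nonneg _)).1 ?_
  rw [norm_sq_eq, ← hπ, ← ip_eq, ← star_mapAlg_mul h, CStarRing.norm_star_mul_self, sq]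

theorem isometry_mapAlg (hπ : ∀ y, ‖MinTensor.map π (StarAlgHom.id ℂ C) y‖ = ‖y‖) :
    Isometry (mapAlg (C := C) t π h) :=
  AddMonoidHomClass.isometry_of_norm _ (norm_mapAlg h hπ)

theorem mapAlg_alg {L : LeftAction B E} (hL : ∀ b x, t (L.φ b x) = π b * t x) (p : B ⊗[ℂ] C)
    (q : E ⊗[ℂ] C) : mapAlg t π h (of B (L.alg p q))
      = MinTensor.map π (StarAlgHom.id ℂ C) (MinTensor.of p) * mapAlg t π h (of B q) := by
  induction p with
  | zero => simp
  | add p p' hp hp' => simp only [map_add, LinearMap.add_apply, add_mul, hp, hp']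
  | tmul b c =>
    induction q with
    | zero => simp
    | add q q' hq hq' => simp only [map_add, mul_add, hq, hq']
    | tmul x d =>
      have h1 : L.alg (b ⊗ₜ[ℂ] c) (x ⊗ₜ[ℂ] d) = L.φ b x ⊗ₜ[ℂ] (c * d) := rfl
      rw [h1, mapAlg_of, mapAlg_of, MinTensor.map_of, ← map_mul]
      congr 1
      rw [TensorProduct.map_tmul, TensorProduct.map_tmul, hL, AlgTensor.map_tmul,
        Algebra.TensorProduct.tmul_mul_tmul]
      rfl

end ExtTensor

end TensorMaps

namespace CircleAction

open MulOpposite HilbertModule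

variable {A : Type u} [CStarAlgebra A] (γ : CircleAction A) {C D : Type u} [CStarAlgebra C]
  [CStarAlgebra D]

variable (C) in
/-- The operator `γ_z ⊗ id` on `A ⊗ C`. -/
noncomputable def tensorAct (z : Circle) : MinTensor A C →ₗ[ℂ] MinTensor A C :=
  (MinTensor.map (γ.act z) (StarAlgHom.id ℂ C)).toAlgHom.toLinearMap

theorem tensorAct_apply (z : Circle) (x : MinTensor A C) :
    γ.tensorAct C z x = MinTensor.map (γ.act z) (StarAlgHom.id ℂ C) x := rfl

theorem norm_tensorAct_le (z : Circle) (x : MinTensor A C) : ‖γ.tensorAct C z x‖ ≤ ‖x‖ :=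
  NonUnitalStarAlgHom.norm_apply_le (MinTensor.map (γ.act z) (StarAlgHom.id ℂ C)) x

theorem tensorAct_tmul (z : Circle) (a : A) (c : C) :
    γ.tensorAct C z (MinTensor.tmul a c) = MinTensor.tmul (γ.act z a) c :=
  MinTensor.map_tmul _ _ _ _

theorem tensorAct_mul (z : Circle) (x y : MinTensor A C) :
    γ.tensorAct C z (x * y) = γ.tensorAct C z x * γ.tensorAct C z y :=
  _root_.map_mul (MinTensor.map (γ.act z) (StarAlgHom.id ℂ C)) x y

variable (C D) in
/-- The operator `γ_z ⊗ id ⊗ id` on `(A ⊗ C) ⊗ D`. -/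
noncomputable def tensorActLeft (z : Circle) :
    MinTensor (MinTensor A C) D →ₗ[ℂ] MinTensor (MinTensor A C) D :=
  (MinTensor.map (MinTensor.map (γ.act z) (StarAlgHom.id ℂ C))
    (StarAlgHom.id ℂ D)).toAlgHom.toLinearMap

theorem tensorActLeft_apply (z : Circle) (x : MinTensor (MinTensor A C) D) :
    γ.tensorActLeft C D z x = MinTensor.map (MinTensor.map (γ.act z) (StarAlgHom.id ℂ C))
      (StarAlgHom.id ℂ D) x := rfl

theorem norm_tensorActLeft_le (z : Circle) (x : MinTensor (MinTensor A C) D) :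
    ‖γ.tensorActLeft C D z x‖ ≤ ‖x‖ :=
  NonUnitalStarAlgHom.norm_apply_le (MinTensor.map (MinTensor.map (γ.act z) (StarAlgHom.id ℂ C))
    (StarAlgHom.id ℂ D)) x

theorem tensorActLeft_tmul (z : Circle) (a : A) (c : C) (d : D) :
    γ.tensorActLeft C D z (MinTensor.tmul (MinTensor.tmul a c) d)
      = MinTensor.tmul (MinTensor.tmul (γ.act z a) c) d := by
  rw [tensorActLeft_apply, MinTensor.map_tmul, MinTensor.map_tmul]; rfl

variable (C) in
/-- The map `A(n) ⊙ C → A ⊗ C`. -/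
noncomputable def spectralTensor (n : ℤ) : γ.spectral n ⊗[ℂ] C →ₗ[ℂ] MinTensor A C :=
  MinTensor.of.toAlgHom.toLinearMap ∘ₗ TensorProduct.map (γ.spectral n).subtype LinearMap.id

theorem spectralTensor_tmul (n : ℤ) (x : γ.spectral n) (c : C) :
    γ.spectralTensor C n (x ⊗ₜ c) = MinTensor.tmul (x : A) c := rfl

variable (C D) in
/-- The map `(A(n) ⊙ C) ⊙ D → (A ⊗ C) ⊗ D`. -/
noncomputable def spectralLeft (n : ℤ) :
    (γ.spectral n ⊗[ℂ] C) ⊗[ℂ] D →ₗ[ℂ] MinTensor (MinTensor A C) D :=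
  MinTensor.of.toAlgHom.toLinearMap ∘ₗ TensorProduct.map (γ.spectralTensor C n) LinearMap.id

variable (C D) in
/-- The map `(A(n) ⊙ C) ⊙ D → A ⊗ (C ⊗ D)`. -/
noncomputable def spectralRight (n : ℤ) :
    (γ.spectral n ⊗[ℂ] C) ⊗[ℂ] D →ₗ[ℂ] MinTensor A (MinTensor C D) :=
  γ.spectralTensor (MinTensor C D) n ∘ₗ
    TensorProduct.map LinearMap.id MinTensor.of.toAlgHom.toLinearMap ∘ₗ
      (TensorProduct.assoc ℂ (γ.spectral n) C D).toLinearMap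

theorem hasCircleCoeff_tensorAct (n : ℤ) (y : A ⊗[ℂ] C) :
    HasCircleCoeff n (fun z => γ.tensorAct C z (MinTensor.of y))
      (γ.spectralTensor C n (TensorProduct.map (γ.proj n).toLinearMap LinearMap.id y)) := by
  induction y with
  | zero => simpa using HasCircleCoeff.zero n
  | add x y hx hy => simpa only [map_add] using hx.add hy
  | tmul a c =>
    simp only [MinTensor.of_tmul, tensorAct_tmul]
    exact (γ.hasCircleCoeff n a).clm (MinTensor.tmulRight A c)

theorem mem_closure_spectralTensor {n : ℤ} {x : MinTensor A C}
    (hx : ∀ z : Circle, γ.tensorAct C z x = (z : ℂ) ^ n • x) :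
    x ∈ closure (Set.range (γ.spectralTensor C n)) := by
  refine mem_closure_of_hasCircleCoeff γ.norm_tensorAct_le hx (S := Set.range MinTensor.of) ?_
    (MinTensor.denseRange_of x)
  rintro _ ⟨y, rfl⟩
  exact ⟨_, ⟨_, rfl⟩, γ.hasCircleCoeff_tensorAct n y⟩

theorem hasCircleCoeff_tensorActLeft (n : ℤ) (y : (A ⊗[ℂ] C) ⊗[ℂ] D) :
    HasCircleCoeff n (fun z => γ.tensorActLeft C D z (MinTensor.of
      (TensorProduct.map (MinTensor.of (A := A) (B := C)).toAlgHom.toLinearMap LinearMap.id y)))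
      (γ.spectralLeft C D n (TensorProduct.map
        (TensorProduct.map (γ.proj n).toLinearMap LinearMap.id) LinearMap.id y)) := by
  induction y with
  | zero => simpa using HasCircleCoeff.zero n
  | add x y hx hy => simpa only [map_add] using hx.add hy
  | tmul x d =>
    induction x with
    | zero => simpa using HasCircleCoeff.zero n
    | add x y hx hy => simpa only [TensorProduct.add_tmul, map_add] using hx.add hy
    | tmul a c =>
      have h : ∀ z, γ.tensorActLeft C D z (MinTensor.of (TensorProduct.map
          (MinTensor.of (A := A) (B := C)).toAlgHom.toLinearMap LinearMap.id
            ((a ⊗ₜ[ℂ] c) ⊗ₜ[ℂ] d))) = MinTensor.tmul (MinTensor.tmul (γ.act z a) c) d :=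
        fun z => γ.tensorActLeft_tmul z a c d
      simp only [h]
      exact ((γ.hasCircleCoeff n a).clm (MinTensor.tmulRight A c)).clm (MinTensor.tmulRight _ d)

theorem hasCircleCoeff_tensorActRight (n : ℤ) (y : (A ⊗[ℂ] C) ⊗[ℂ] D) :
    HasCircleCoeff n (fun z => γ.tensorAct (MinTensor C D) z (MinTensor.of
      (TensorProduct.map LinearMap.id (MinTensor.of (A := C) (B := D)).toAlgHom.toLinearMap
        (TensorProduct.assoc ℂ A C D y))))
      (γ.spectralRight C D n (TensorProduct.map
        (TensorProduct.map (γ.proj n).toLinearMap LinearMap.id) LinearMap.id y)) := by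
  induction y with
  | zero => simpa using HasCircleCoeff.zero n
  | add x y hx hy => simpa only [map_add] using hx.add hy
  | tmul x d =>
    induction x with
    | zero => simpa using HasCircleCoeff.zero n
    | add x y hx hy => simpa only [TensorProduct.add_tmul, map_add] using hx.add hy
    | tmul a c =>
      have h : ∀ z, γ.tensorAct (MinTensor C D) z (MinTensor.of (TensorProduct.map LinearMap.id
          (MinTensor.of (A := C) (B := D)).toAlgHom.toLinearMap
            (TensorProduct.assoc ℂ A C D ((a ⊗ₜ[ℂ] c) ⊗ₜ[ℂ] d))))
              = MinTensor.tmul (γ.act z a) (MinTensor.tmul c d) :=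
        fun z => γ.tensorAct_tmul z a _
      simp only [h]
      exact (γ.hasCircleCoeff n a).clm (MinTensor.tmulRight A (MinTensor.tmul c d))

theorem mem_closure_of_assoc {n : ℤ} {x : MinTensor (MinTensor A C) D}
    {y : MinTensor A (MinTensor C D)} (hxy : MinTensor.Assoc x y)
    (hx : ∀ z : Circle, γ.tensorActLeft C D z x = (z : ℂ) ^ n • x)
    (hy : ∀ z : Circle, γ.tensorAct (MinTensor C D) z y = (z : ℂ) ^ n • y) :
    (x, y) ∈ closure (Set.range fun w => (γ.spectralLeft C D n w, γ.spectralRight C D n w)) := by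
  unfold MinTensor.Assoc at hxy
  rw [Metric.mem_closure_iff] at hxy ⊢
  intro ε hε
  obtain ⟨_, ⟨w, rfl⟩, hw⟩ := hxy ε hε
  refine ⟨_, ⟨TensorProduct.map (TensorProduct.map (γ.proj n).toLinearMap LinearMap.id)
    LinearMap.id w, rfl⟩, lt_of_le_of_lt ?_ hw⟩
  have h1 := γ.hasCircleCoeff_tensorActLeft n w
  have h2 := γ.hasCircleCoeff_tensorActRight n w
  rw [dist_comm, dist_comm (x, y), Prod.dist_eq, Prod.dist_eq]
  refine max_le_max ?_ ?_
  · rw [dist_eq_norm, dist_eq_norm]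
    have h := norm_circleCoeff_sub_le γ.norm_tensorActLeft_le hx h1.continuous
    rw [h1.eq] at h
    exact h
  · rw [dist_eq_norm, dist_eq_norm]
    have h := norm_circleCoeff_sub_le γ.norm_tensorAct_le hy h2.continuous
    rw [h2.eq] at h
    exact h

section Equivariant

variable {γ} {ρ : A →⋆ₐ[ℂ] MinTensor A C} (hρ : γ.IsGaugeEquivariant ρ)

include hρ

theorem IsGaugeEquivariant.tensorAct (z : Circle) (a : A) :
    γ.tensorAct C z (ρ a) = ρ (γ.act z a) := hρ z a

theorem IsGaugeEquivariant.tensorAct_of_mem {n : ℤ} {a : A} (ha : a ∈ γ.spectral n) (z : Circle) :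
    γ.tensorAct C z (ρ a) = (z : ℂ) ^ n • ρ a := by
  rw [hρ.tensorAct, ha z, map_smul]

theorem IsGaugeEquivariant.mem_closure_coassoc {G : CompactQuantumGroup C} (hG : IsAction G ρ)
    {n : ℤ} {a : A} (ha : a ∈ γ.spectral n) :
    (MinTensor.map ρ (StarAlgHom.id ℂ C) (ρ a), MinTensor.map (StarAlgHom.id ℂ A) G.Δ (ρ a)) ∈
      closure (Set.range fun w => (γ.spectralLeft C C n w, γ.spectralRight C C n w)) := by
  refine γ.mem_closure_of_assoc (hG.coassoc a) (fun z => ?_) fun z => ?_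
  · have h : (MinTensor.map (γ.act z) (StarAlgHom.id ℂ C)).comp ρ = ρ.comp (γ.act z) :=
      StarAlgHom.ext (hρ z)
    rw [tensorActLeft_apply, MinTensor.map_map, h, ← MinTensor.map_map (γ.act z)
      (StarAlgHom.id ℂ C) ρ (StarAlgHom.id ℂ C), ← tensorAct_apply, hρ.tensorAct_of_mem ha,
      map_smul]
  · have h : MinTensor.map (γ.act z) (StarAlgHom.id ℂ (MinTensor C C))
        (MinTensor.map (StarAlgHom.id ℂ A) G.Δ (ρ a))
        = MinTensor.map (StarAlgHom.id ℂ A) G.Δ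
          (MinTensor.map (γ.act z) (StarAlgHom.id ℂ C) (ρ a)) := by
      rw [MinTensor.map_map, MinTensor.map_map]; rfl
    rw [tensorAct_apply, h, ← tensorAct_apply, hρ.tensorAct_of_mem ha, map_smul]

/-- The Podleś condition in degree `n`. -/
theorem IsGaugeEquivariant.mem_closure_podles {G : CompactQuantumGroup C} (hG : IsAction G ρ)
    {n : ℤ} {x : MinTensor A C} (hx : ∀ z : Circle, γ.tensorAct C z x = (z : ℂ) ^ n • x) :
    x ∈ closure (Submodule.span ℂ {y : MinTensor A C | ∃ (a : γ.spectral n) (c : C),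
      y = ρ a * MinTensor.tmul 1 c} : Set (MinTensor A C)) := by
  refine mem_closure_of_hasCircleCoeff γ.norm_tensorAct_le hx
    (S := Submodule.span ℂ {x : MinTensor A C | ∃ (b : A) (c : C), x = ρ b * MinTensor.tmul 1 c})
    (fun y hy => ?_) ?_
  · induction hy using Submodule.span_induction with
    | zero => exact ⟨0, zero_mem _, by simpa using HasCircleCoeff.zero n⟩
    | add x y _ _ hx hy =>
      obtain ⟨x', hx', hx⟩ := hx
      obtain ⟨y', hy', hy⟩ := hy
      exact ⟨x' + y', add_mem hx' hy', by simpa only [map_add] using hx.add hy⟩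
    | smul k x _ hx =>
      obtain ⟨x', hx', hx⟩ := hx
      exact ⟨k • x', Submodule.smul_mem _ k hx', by
        simp only [map_smul]
        exact hx.clm (k • ContinuousLinearMap.id ℂ _)⟩
    | mem x hx =>
      obtain ⟨a, c, rfl⟩ := hx
      refine ⟨_, Submodule.subset_span ⟨γ.proj n a, c, rfl⟩, ?_⟩
      have h : ∀ z, γ.tensorAct C z (ρ a * MinTensor.tmul 1 c)
          = ρ (γ.act z a) * MinTensor.tmul 1 c := fun z => by
        rw [tensorAct_mul, hρ.tensorAct, tensorAct_tmul, _root_.map_one (γ.act z)]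
      simp only [h]
      let L : A →L[ℂ] MinTensor A C :=
        ((ContinuousLinearMap.mul ℂ (MinTensor A C)).flip (MinTensor.tmul 1 c)).comp
          ⟨ρ.toAlgHom.toLinearMap, ρ.continuous_cstar⟩
      exact (γ.hasCircleCoeff n a).clm L
  · have := hG.podles
    rw [← Submodule.topologicalClosure_coe, this]
    trivial

end Equivariant

variable (C) in
/-- The inclusion `A(0) ⊗ C → A ⊗ C`. -/
noncomputable def fixedTensor : MinTensor γ.fixed C →⋆ₐ[ℂ] MinTensor A C :=
  MinTensor.map γ.fixed.subtype (StarAlgHom.id ℂ C)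

theorem norm_fixedTensor (x : MinTensor γ.fixed C) : ‖γ.fixedTensor C x‖ = ‖x‖ :=
  (γ.isCondExp_condExp.isCondExp_tensor (C := C)).norm_hom x

theorem isometry_fixedTensor : Isometry (γ.fixedTensor C) :=
  AddMonoidHomClass.isometry_of_norm _ γ.norm_fixedTensor

theorem norm_fixedTensor_tensor (x : MinTensor (MinTensor γ.fixed C) D) :
    ‖MinTensor.map (γ.fixedTensor C) (StarAlgHom.id ℂ D) x‖ = ‖x‖ :=
  ((γ.isCondExp_condExp.isCondExp_tensor (C := C)).isCondExp_tensor (C := D)).norm_hom x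

variable (C) in
/-- The inclusion `A(1) ⊗ C → A ⊗ C`. -/
noncomputable def oneTensor : ExtTensor γ.fixed (γ.spectral 1) C →L[ℂ] MinTensor A C :=
  γ.inclusion.tensor

theorem oneTensor_of (x : γ.spectral 1 ⊗[ℂ] C) :
    γ.oneTensor C (ExtTensor.of γ.fixed x) = γ.spectralTensor C 1 x :=
  ExtTensor.mapAlg_of γ.inclusion.t γ.inclusion.π γ.inclusion.star_mul x

theorem star_oneTensor_mul (x y : ExtTensor γ.fixed (γ.spectral 1) C) :
    star (γ.oneTensor C x) * γ.oneTensor C y = γ.fixedTensor C (ip x y) :=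
  ExtTensor.star_mapAlg_mul γ.inclusion.star_mul x y

theorem oneTensor_op_smul (b : MinTensor γ.fixed C) (x : ExtTensor γ.fixed (γ.spectral 1) C) :
    γ.oneTensor C (op b • x) = γ.oneTensor C x * γ.fixedTensor C b :=
  map_op_smul_of_ip (t := (γ.oneTensor C).toLinearMap) γ.star_oneTensor_mul b x

theorem isometry_oneTensor : Isometry (γ.oneTensor C) :=
  ExtTensor.isometry_mapAlg γ.inclusion.star_mul γ.norm_fixedTensor

variable (C D) in
/-- The inclusion `(A(1) ⊗ C) ⊗ D → (A ⊗ C) ⊗ D`. -/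
noncomputable def oneTensorLeft :
    ExtTensor (MinTensor γ.fixed C) (ExtTensor γ.fixed (γ.spectral 1) C) D →L[ℂ]
      MinTensor (MinTensor A C) D :=
  ExtTensor.mapAlg (γ.oneTensor C).toLinearMap (γ.fixedTensor C) γ.star_oneTensor_mul

theorem isometry_oneTensorLeft : Isometry (γ.oneTensorLeft C D) :=
  ExtTensor.isometry_mapAlg _ γ.norm_fixedTensor_tensor

/-- The identification of `A(0)` as a spectral subspace and as an algebra. -/
def toFixed : γ.spectral 0 →ₗ[ℂ] γ.fixed where
  toFun x := ⟨x, x.2⟩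
  map_add' _ _ := rfl
  map_smul' _ _ := rfl

theorem fixedTensor_toFixed (x : γ.spectral 0 ⊗[ℂ] C) :
    γ.fixedTensor C (MinTensor.of (TensorProduct.map γ.toFixed LinearMap.id x))
      = γ.spectralTensor C 0 x := by
  induction x with
  | zero => simp
  | add x y hx hy => simp only [map_add, hx, hy]
  | tmul a c => exact MinTensor.map_tmul _ _ _ _

theorem tensorAct_fixedTensor (z : Circle) (x : MinTensor γ.fixed C) :
    γ.tensorAct C z (γ.fixedTensor C x) = (z : ℂ) ^ (0 : ℤ) • γ.fixedTensor C x := by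
  have h : (γ.act z).comp γ.fixed.subtype = γ.fixed.subtype := StarAlgHom.ext fun b => by
    have := γ.mem_spectral.1 b.2 z
    rw [zpow_zero, one_smul] at this
    exact this
  rw [zpow_zero, one_smul, tensorAct_apply, fixedTensor, MinTensor.map_map, h]
  rfl

theorem tensorAct_oneTensor (z : Circle) (x : ExtTensor γ.fixed (γ.spectral 1) C) :
    γ.tensorAct C z (γ.oneTensor C x) = (z : ℂ) ^ (1 : ℤ) • γ.oneTensor C x := by
  have hc : Continuous (γ.tensorAct C z) :=
    StarAlgHom.continuous_cstar (MinTensor.map (γ.act z) (StarAlgHom.id ℂ C))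
  refine ExtTensor.denseRange_of.induction_on x (isClosed_eq
    (hc.comp (γ.oneTensor C).continuous)
    ((continuous_const_smul ((z : ℂ) ^ (1 : ℤ))).comp (γ.oneTensor C).continuous)) fun x => ?_
  rw [oneTensor_of]
  induction x with
  | zero => simp
  | add x y hx hy => simp only [map_add, hx, hy, smul_add]
  | tmul a c =>
    rw [spectralTensor_tmul, tensorAct_tmul, a.2 z, ← MinTensor.tmulRight_apply, map_smul]
    rfl

section Lift

variable {γ} {ρ : A →⋆ₐ[ℂ] MinTensor A C} (hρ : γ.IsGaugeEquivariant ρ)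

include hρ in
theorem IsGaugeEquivariant.exists_fixed_lift : ∃ α : γ.fixed →⋆ₐ[ℂ] MinTensor γ.fixed C,
    ∀ b : γ.fixed, γ.fixedTensor C (α b) = ρ b := by
  suffices h : ∀ b : γ.fixed, ∃ a, γ.fixedTensor C a = ρ.comp γ.fixed.subtype b by
    obtain ⟨α, hα⟩ := StarAlgHom.exists_lift γ.isometry_fixedTensor.injective h
    exact ⟨α, hα⟩
  intro b
  have h1 := γ.mem_closure_spectralTensor (hρ.tensorAct_of_mem b.2)
  refine (closure_minimal ?_ γ.isometry_fixedTensor.isClosedEmbedding.isClosed_range) h1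
  rintro _ ⟨x, rfl⟩
  exact ⟨_, γ.fixedTensor_toFixed x⟩

include hρ in
theorem IsGaugeEquivariant.exists_one_lift :
    ∃ l : γ.spectral 1 →ₗ[ℂ] ExtTensor γ.fixed (γ.spectral 1) C,
      ∀ x : γ.spectral 1, γ.oneTensor C (l x) = ρ x := by
  refine LinearMap.exists_lift (f := (γ.oneTensor C).toLinearMap)
    (g := ρ.toAlgHom.toLinearMap ∘ₗ (γ.spectral 1).subtype)
    γ.isometry_oneTensor.injective fun b => ?_
  have h1 := γ.mem_closure_spectralTensor (hρ.tensorAct_of_mem b.2)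
  refine (closure_minimal ?_ γ.isometry_oneTensor.isClosedEmbedding.isClosed_range) h1
  rintro _ ⟨x, rfl⟩
  exact ⟨_, γ.oneTensor_of x⟩

variable {G : CompactQuantumGroup C} (hG : IsAction G ρ)
  {α : γ.fixed →⋆ₐ[ℂ] MinTensor γ.fixed C} (hα : ∀ b : γ.fixed, γ.fixedTensor C (α b) = ρ b)
  {l : γ.spectral 1 →ₗ[ℂ] ExtTensor γ.fixed (γ.spectral 1) C}
  (hl : ∀ x : γ.spectral 1, γ.oneTensor C (l x) = ρ x)

include hρ hG hα in
theorem IsGaugeEquivariant.isAction_fixed : IsAction G α where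
  coassoc b := by
    have hcomp : (γ.fixedTensor C).comp α = ρ.comp γ.fixed.subtype := StarAlgHom.ext hα
    have h1 : MinTensor.map (γ.fixedTensor C) (StarAlgHom.id ℂ C)
        (MinTensor.map α (StarAlgHom.id ℂ C) (α b)) = MinTensor.map ρ (StarAlgHom.id ℂ C) (ρ b) := by
      rw [MinTensor.map_map, hcomp, ← MinTensor.map_map γ.fixed.subtype (StarAlgHom.id ℂ C) ρ
        (StarAlgHom.id ℂ C), ← hα b]
      rfl
    have h2 : γ.fixedTensor (MinTensor C C) (MinTensor.map (StarAlgHom.id ℂ γ.fixed) G.Δ (α b))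
        = MinTensor.map (StarAlgHom.id ℂ A) G.Δ (ρ b) := by
      rw [← hα b, fixedTensor, fixedTensor, MinTensor.map_map, MinTensor.map_map]
      rfl
    have hiso : Isometry (Prod.map (MinTensor.map (γ.fixedTensor C) (StarAlgHom.id ℂ C))
        (γ.fixedTensor (MinTensor C C))) :=
      (AddMonoidHomClass.isometry_of_norm _ γ.norm_fixedTensor_tensor).prodMap
        γ.isometry_fixedTensor
    have h3 := hρ.mem_closure_coassoc hG (n := 0) b.2
    rw [← h1, ← h2] at h3
    refine hiso.mem_closure_of_subset_image ?_ h3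
    rintro _ ⟨w, rfl⟩
    refine ⟨_, ⟨TensorProduct.map (TensorProduct.map γ.toFixed LinearMap.id) LinearMap.id w, rfl⟩,
      Prod.ext ?_ ?_⟩
    · simp only [Prod.map_fst]
      induction w with
      | zero => simp
      | add x y hx hy => simp only [map_add, hx, hy]
      | tmul x d =>
        refine (MinTensor.map_tmul (γ.fixedTensor C) (StarAlgHom.id ℂ C) _ d).trans ?_
        exact congrArg (MinTensor.tmul · d) (γ.fixedTensor_toFixed x)
    · simp only [Prod.map_snd]
      induction w with
      | zero => simp
      | add x y hx hy => simp only [map_add, hx, hy]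
      | tmul x d =>
        induction x with
        | zero => simp
        | add x y hx hy => simp only [TensorProduct.add_tmul, map_add, hx, hy]
        | tmul a c => exact MinTensor.map_tmul _ _ _ _
  podles := by
    refine eq_top_iff.2 fun x _ => ?_
    refine γ.isometry_fixedTensor.mem_closure_of_subset_image ?_
      (hρ.mem_closure_podles hG (γ.tensorAct_fixedTensor · x))
    intro y hy
    induction hy using Submodule.span_induction with
    | zero => exact ⟨0, zero_mem _, map_zero _⟩
    | add x y _ _ hx hy =>
      obtain ⟨x', hx', rfl⟩ := hx
      obtain ⟨y', hy', rfl⟩ := hy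
      exact ⟨x' + y', add_mem hx' hy', map_add _ _ _⟩
    | smul k x _ hx =>
      obtain ⟨x', hx', rfl⟩ := hx
      exact ⟨k • x', Submodule.smul_mem _ k hx', map_smul _ _ _⟩
    | mem x hx =>
      obtain ⟨a, c, rfl⟩ := hx
      refine ⟨_, Submodule.subset_span ⟨γ.toFixed a, c, rfl⟩, ?_⟩
      rw [_root_.map_mul, hα]
      exact congrArg (_ * ·) (MinTensor.map_tmul _ _ _ _)

include hα hl in
theorem ip_lift (x y : γ.spectral 1) : ip (l x) (l y) = α (ip x y) := by
  refine γ.isometry_fixedTensor.injective ?_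
  rw [← star_oneTensor_mul, hl, hl, hα, ← map_star, ← _root_.map_mul]
  rfl

include hl in
theorem oneTensorLeft_map (h : ∀ x y, ip (l x) (l y) = α (ip x y))
    (y : ExtTensor γ.fixed (γ.spectral 1) C) :
    γ.oneTensorLeft C C (ExtTensor.map l α (StarAlgHom.id ℂ C) h y)
      = MinTensor.map ρ (StarAlgHom.id ℂ C) (γ.oneTensor C y) := by
  have hc := StarAlgHom.continuous_cstar (MinTensor.map ρ (StarAlgHom.id ℂ C))
  refine ExtTensor.denseRange_of.induction_on y
    (isClosed_eq (by fun_prop) (by fun_prop)) fun y => ?_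
  rw [ExtTensor.map_of, oneTensor_of]
  induction y with
  | zero => simp
  | add x y hx hy => simp only [map_add, hx, hy]
  | tmul x c =>
    rw [spectralTensor_tmul, MinTensor.map_tmul, ← hl]
    exact ExtTensor.mapAlg_tmul _ (l x) c

theorem oneTensor_map (Δ : C →⋆ₐ[ℂ] MinTensor C C)
    (h : ∀ x y : γ.spectral 1, ip (B := γ.fixed) (LinearMap.id (R := ℂ) x)
      (LinearMap.id (R := ℂ) y) = StarAlgHom.id ℂ γ.fixed (ip x y))
    (y : ExtTensor γ.fixed (γ.spectral 1) C) :
    γ.oneTensor (MinTensor C C) (ExtTensor.map LinearMap.id (StarAlgHom.id ℂ γ.fixed) Δ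
      h y) = MinTensor.map (StarAlgHom.id ℂ A) Δ (γ.oneTensor C y) := by
  have hc := StarAlgHom.continuous_cstar (MinTensor.map (StarAlgHom.id ℂ A) Δ)
  refine ExtTensor.denseRange_of.induction_on y
    (isClosed_eq (by fun_prop) (by fun_prop)) fun y => ?_
  rw [ExtTensor.map_of, oneTensor_of, oneTensor_of]
  induction y with
  | zero => simp
  | add x y hx hy => simp only [map_add, hx, hy]
  | tmul x c =>
    rw [spectralTensor_tmul, MinTensor.map_tmul]
    rfl

include hρ hG hα hl in
theorem IsGaugeEquivariant.isEquivariantModule : IsEquivariantModule G α l where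
  map_op_smul b x := by
    refine γ.isometry_oneTensor.injective ?_
    rw [hl, oneTensor_op_smul, hl, hα, ← _root_.map_mul]
    rfl
  ip_map := ip_lift hα hl
  coassoc x := by
    have h3 := hρ.mem_closure_coassoc hG (n := 1) x.2
    rw [← hl, ← oneTensorLeft_map hl (ip_lift hα hl), ← oneTensor_map G.Δ (fun _ _ => rfl)] at h3
    refine (γ.isometry_oneTensorLeft.prodMap γ.isometry_oneTensor).mem_closure_of_subset_image
      ?_ h3
    rintro _ ⟨w, rfl⟩
    refine ⟨_, ⟨w, rfl⟩, Prod.ext ?_ ?_⟩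
    · simp only [Prod.map_fst]
      induction w with
      | zero => simp
      | add x y hx hy => simp only [map_add, hx, hy]
      | tmul x d =>
        refine (ExtTensor.mapAlg_tmul γ.star_oneTensor_mul (ExtTensor.of γ.fixed x) d).trans ?_
        exact congrArg (MinTensor.tmul · d) (γ.oneTensor_of x)
    · exact γ.oneTensor_of _
  podles := by
    refine eq_top_iff.2 fun x _ => ?_
    refine γ.isometry_oneTensor.mem_closure_of_subset_image ?_
      (hρ.mem_closure_podles hG (γ.tensorAct_oneTensor · x))
    intro y hy
    induction hy using Submodule.span_induction with
    | zero => exact ⟨0, zero_mem _, map_zero _⟩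
    | add x y _ _ hx hy =>
      obtain ⟨x', hx', rfl⟩ := hx
      obtain ⟨y', hy', rfl⟩ := hy
      exact ⟨x' + y', add_mem hx' hy', map_add _ _ _⟩
    | smul k x _ hx =>
      obtain ⟨x', hx', rfl⟩ := hx
      exact ⟨k • x', Submodule.smul_mem _ k hx', map_smul _ _ _⟩
    | mem x hx =>
      obtain ⟨a, c, rfl⟩ := hx
      refine ⟨_, Submodule.subset_span ⟨a, c, rfl⟩, ?_⟩
      rw [oneTensor_op_smul, hl]
      exact congrArg (_ * ·) (MinTensor.map_tmul _ _ _ _)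

include hα hl in
theorem rel_lift (b : γ.fixed) (x : γ.spectral 1) :
    γ.leftAction.Rel (α b) (l x) (l (γ.leftAction.φ b x)) := by
  have hiso : Isometry (Prod.map (γ.fixedTensor C) (Prod.map (γ.oneTensor C) (γ.oneTensor C))) :=
    γ.isometry_fixedTensor.prodMap (γ.isometry_oneTensor.prodMap γ.isometry_oneTensor)
  refine hiso.mem_closure_of_subset_image (S' := Set.range fun p :
    (γ.fixed ⊗[ℂ] C) × (γ.spectral 1 ⊗[ℂ] C) => (γ.fixedTensor C (MinTensor.of p.1),
      γ.oneTensor C (ExtTensor.of γ.fixed p.2), γ.fixedTensor C (MinTensor.of p.1) *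
        γ.oneTensor C (ExtTensor.of γ.fixed p.2))) ?_ ?_
  · rintro _ ⟨p, rfl⟩
    refine ⟨_, ⟨p, rfl⟩, Prod.ext rfl (Prod.ext rfl ?_)⟩
    exact ExtTensor.mapAlg_alg γ.inclusion.star_mul γ.inclusion.left_mul p.1 p.2
  · have h : γ.oneTensor C (l (γ.leftAction.φ b x))
        = γ.fixedTensor C (α b) * γ.oneTensor C (l x) := by
      rw [hl, hl, hα, ← _root_.map_mul]; rfl
    change (γ.fixedTensor C (α b), γ.oneTensor C (l x), γ.oneTensor C (l (γ.leftAction.φ b x))) ∈ _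
    rw [h]
    have hc := (γ.fixedTensor C).continuous_cstar
    have hd : DenseRange fun p : (γ.fixed ⊗[ℂ] C) × (γ.spectral 1 ⊗[ℂ] C) =>
        ((MinTensor.of p.1 : MinTensor γ.fixed C),
          (ExtTensor.of γ.fixed p.2 : ExtTensor γ.fixed (γ.spectral 1) C)) :=
      MinTensor.denseRange_of.prodMap ExtTensor.denseRange_of
    refine hd.induction_on (p := fun q => (γ.fixedTensor C q.1, γ.oneTensor C q.2,
      γ.fixedTensor C q.1 * γ.oneTensor C q.2) ∈ closure _) (α b, l x) ?_ fun p => ?_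
    · exact isClosed_closure.preimage (by fun_prop)
    · exact subset_closure ⟨p, rfl⟩

include hρ hG in
theorem IsPrincipal.isLift (hγ : γ.IsPrincipal) : γ.inclusion.IsLift G ρ := by
  obtain ⟨α, hα⟩ := hρ.exists_fixed_lift
  obtain ⟨l, hl⟩ := hρ.exists_one_lift
  refine ⟨α, l, hρ.isAction_fixed hG hα,
    { toIsEquivariantModule := hρ.isEquivariantModule hG hα hl
      map_left := rel_lift hα hl }, ⟨fun x => (hl x).symm, fun b => (hα b).symm⟩, fun ω hω => ?_⟩
  refine hγ.starAlgHom_ext (fun a ha => ?_) fun a ha => ?_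
  · exact (hω.2 ⟨a, ha⟩).trans (hα ⟨a, ha⟩)
  · exact (hω.1 ⟨a, ha⟩).trans (hl ⟨a, ha⟩)

end Lift

end CircleAction

theorem theorem1p3 {A : Type u} [CStarAlgebra A] (γ : CircleAction A)
    (hprincipal : γ.IsPrincipal)
    (hseparable : TopologicalSpace.SeparableSpace γ.fixed)
    (hfull : HilbertModule.IsFull γ.fixed (γ.spectral 1))
    (hfull_neg : HilbertModule.IsFull γ.fixed (γ.spectral (-1))) :
    (Module.Finite (γ.fixed)ᵐᵒᵖ (γ.spectral 1) ∧ Module.Projective (γ.fixed)ᵐᵒᵖ (γ.spectral 1)) ∧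
    γ.inclusion.IsPimsnerAlgebra ∧
    γ.IsGaugeAction γ.inclusion ∧
    ∀ (C : Type u) [CStarAlgebra C] (G : CompactQuantumGroup C) (ρ : A →⋆ₐ[ℂ] MinTensor A C),
      IsAction G ρ → γ.IsGaugeEquivariant ρ → γ.inclusion.IsLift G ρ := by
  refine ⟨hprincipal.finite_and_projective, hprincipal.isPimsnerAlgebra,
    CircleAction.isGaugeAction_inclusion, fun C _ G ρ hG hρ => ?_⟩
  exact hprincipal.isLift hρ hG
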